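/- Let $f:\mathbb{R}^n\to\mathbb{R}$ be continuous, $\lambda>0$, $\varphi(x)=f(x)+\lambda\|x\|_1$, $x^0\in\mathbb{R}^n$, and $\mathcal{L}=\{x:\varphi(x)\le\varphi(x^0)\}$. Assume that $\varphi$ attains its minimum $\varphi_{\rm low}$, that $\mathcal{L}$ is bounded, and that $f$ is twice continuously differentiable with Lipschitz continuous Hessian on an open neighborhood of $\mathcal{L}$. Then there are constants $L_g,L_H>0$ such that for all $x,y\in\mathcal{L}$: $\|\nabla^2 f(x)\|\le L_g$; $f(y)\le f(x)+\nabla f(x)^\top(y-x)+\frac L2\|y-x\|^2$ for all $L\ge L_g$; $\|\nabla^2f(x)(y-x)-(\nabla f(y)-\nabla f(x))\|\le\frac{L_H}2\|y-x\|^2$; and $f(y)\le f(x)+\nabla f(x)^\top(y-x)+\frac12(y-x)^\top\nabla^2f(x)(y-x)+\frac{L_H}6\|y-x\|^3$. Fix any such $L_g,L_H$. *Notation.* Let $0<\varepsilon_g,\varepsilon_h<1$ and ${\rm sgn}(0)=1$. For $x\in\mathbb{R}^n$ put $I_{\ne0}=\{i:x_i\ne0\}$, $I_0^\varepsilon=\{i:|x_i|\le\varepsilon_g^{1/2}\}$,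 $I_{\ne0}^\varepsilon=\{i:|x_i|>\varepsilon_g^{1/2}\}$; $v_J$ and $A_J$ denote the subvector and the principal submatrix on the index set $J$. Let $g^\varepsilon_i(x)=\nabla_if(x)+\lambda$ if $x_i>\varepsilon_g^{1/2}$, $\nabla_if(x)-\lambda$ if $x_i<-\varepsilon_g^{1/2}$, and $\nabla_if(x)-\min\{\max\{-\lambda-\varepsilon_g^{3/4},\nabla_if(x)\},\lambda+\varepsilon_g^{3/4}\}$ otherwise. Let $g_i(x)=\nabla_if(x)+\lambda\,{\rm sgn}(x_i)$ for $i\in I_{\ne0}$. Let $S={\rm Diag}(s)$ with $s_i=1$ if $|x_i|>\varepsilon_g^{1/2}$ and $s_i=x_i$ otherwise, and $A(x)=S_{I_{\ne0}}(\nabla^2f(x))_{I_{\ne0}}S_{I_{\ne0}}$. The point $x$ is a *weak $(\varepsilon_g,\varepsilon_h)$-2o point* if $\|g^\varepsilon(x)\|\le\varepsilon_g$ and every eigenvalue of $A(x)$ is at least $-\varepsilon_h$. For $t>0$ let $p_t(x)={\rm prox}_{(\lambda/t)\|\cdot\|_1}(x-\frac1t\nabla f(x))$ and $\mathcal{G}_t(x)=t(x-p_t(x))$.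 *Capped CG.* Inputs: a symmetric $H$, a vector $g\neq0$, a shift $\mu>0$, $\epsilon>0$, $\zeta\in(0,1)$, $M\ge0$. Put $\bar H=H+\mu I$ and, for the current value of $M$, $\kappa=(M+\mu)/\epsilon$, $\hat\zeta=\zeta/(3\kappa)$, $\tau=\sqrt\kappa/(\sqrt\kappa+1)$, $T=4\kappa^4/(1-\sqrt\tau)^2$. Run the conjugate gradient iteration $y_0=0$, $r_0=g$, $p_0=-g$, $\alpha_j=\|r_j\|^2/p_j^\top\bar Hp_j$, $y_{j+1}=y_j+\alpha_jp_j$, $r_{j+1}=r_j+\alpha_j\bar Hp_j$, $p_{j+1}=-r_{j+1}+(\|r_{j+1}\|^2/\|r_j\|^2)p_j$. If $p_0^\top\bar Hp_0<\epsilon\|p_0\|^2$, return $(p_0,{\rm NC})$; otherwise update $M$ at $v=p_0$, i.e. replace $M$ by $\|Hv\|/\|v\|$ if $\|Hv\|>M\|v\|$. For $j=1,2,\dots$: update $M$ at $p_j$, $y_j$, $r_j$ in this order; then, in this order, return $(y_j,{\rm NC})$ if $y_j^\top\bar Hy_j<\epsilon\|y_j\|^2$; return $(y_j,{\rm SOL})$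 if $\|r_j\|\le\hat\zeta\|r_0\|$; return $(p_j,{\rm NC})$ if $p_j^\top\bar Hp_j<\epsilon\|p_j\|^2$; and if $\|r_j\|>\sqrt T\tau^{j/2}\|r_0\|$, return $(d,{\rm NC})$ with $d=y_{j+1}-y_i$ for some $i\in\{0,\dots,j-1\}$ such that $d^\top\bar Hd<\epsilon\|d\|^2$. *The algorithm PGN2CM.* Parameters: $\varepsilon_g,\varepsilon_h\in(0,1)$, $\beta>1$, $\delta\in[0,1]$, $\hat\tau\ge1$, $\zeta,\bar\eta,\theta\in(0,1)$, $\eta\in(0,\frac{1-\zeta}2)$. Iteration $k=0,1,2,\dots$ at $x=x^k$ (each time, $j_k$ is the smallest $j\in\{0,1,\dots\}$ with the stated property, and the algorithm fails if there is none or if Capped CG returns nothing): 1. If $I_0^\varepsilon\ne\emptyset$ and $g^\varepsilon(x)_{I_0^\varepsilon}\ne0$, set $x^{k+1}=p_{\beta^{j_k}}(x)$, with $\varphi(p_{\beta^j}(x))<\varphi(x)-\frac{\bar\eta}{\beta^j}\|\mathcal{G}_{\beta^j}(x)\|^2$. 2. Otherwise, if $I_{\ne0}^\varepsilon\ne\emptyset$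 and $\hat g:=g^\varepsilon(x)_{I_{\ne0}^\varepsilon}$ satisfies $\|\hat g\|>\varepsilon_g$, let $\hat H=(\nabla^2f(x))_{I_{\ne0}^\varepsilon}$, choose any $\tau_k\in[2\varepsilon_h\|\hat g\|^{-\delta},2\hat\tau\varepsilon_h\|\hat g\|^{-\delta}]$ and $M\ge0$, and let $(d,\text{type})$ be an output of Capped CG for $\hat H,\hat g,\mu=\tau_k\|\hat g\|^\delta,\epsilon=\varepsilon_h,\zeta,M$. Let $d^k$ be zero on $I_0^\varepsilon$ and on $I_{\ne0}^\varepsilon$ equal to $d$ (type SOL) or $-{\rm sgn}(d^\top\hat g)\frac{|d^\top\hat Hd|}{\|d\|^2}\frac{d}{\|d\|}$ (type NC). Set $x^{k+1}=x+\theta^{j_k}d^k$, with $\varphi(x+\theta^jd^k)<\varphi(x)-\eta\theta^{2j}\varepsilon_h\|d^k\|^2$. 3. Otherwise call the minimum eigenvalue oracle (MEO) on $A(x)$ with tolerance $\varepsilon_h$. It returns either a certificate that $\lambda_{\min}(A(x))\ge-\varepsilon_h$, in which case the algorithm stops with output $x$, or a unit vector $u$ with $u^\top A(x)u\le-\varepsilon_h/2$.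 In the latter case let $d^k$ be zero off $I_{\ne0}$ and $d^k_{I_{\ne0}}=-{\rm sgn}(g(x)_{I_{\ne0}}^\top S_{I_{\ne0}}u)\,|u^\top A(x)u|\,u$, and set $x^{k+1}=x+\theta^{j_k}Sd^k$, with $\varphi(x+\theta^jSd^k)<\varphi(x)-\eta\theta^{2j}\|d^k\|^3$. The MEO is randomized: for some $\sigma\in[0,1)$, at each call, conditionally on everything that happened before it, the probability that a certificate is issued although $\lambda_{\min}(A(x))<-\varepsilon_h$ is at most $\sigma$. *Claim.* Let $c_{pg}=\bar\eta/\max\{\beta L_g/(2-2\bar\eta),1\}$, $c_{nc}=\eta\theta^2\min\{1,9(1-2\eta)^2/L_H^2\}$, $$c_{sol}=\eta\min\Big\{\Big(\tfrac{4}{\sqrt{(\zeta+4\hat\tau)^2+8L_H}+(\zeta+4\hat\tau)}\Big)^2,\ \tfrac{9(1-\zeta-2\eta)^2\theta^2}{L_H^2},\ \theta^2,\ \tfrac{(1-\zeta)^2\theta^2}{4\max\{L_H/3,2\eta\}^2}\Big\},$$ $$K=\Big\lceil\frac{5(\varphi(x^0)-\varphi_{\rm low})}{\min\{c_{nc}/8,\,c_{pg},\,c_{sol}\}}\max\{\varepsilon_g^{-1}\varepsilon_h^{-1},\varepsilon_h^{-3},\varepsilon_g^{-2}\varepsilon_h,\varepsilon_g^{-3/2}\}\Big\rceil+2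 .$$ Then, with probability at least $(1-\sigma)^K$, PGN2CM started at $x^0$ stops within at most $K$ iterations with a weak $(\varepsilon_g,\varepsilon_h)$-2o point as output. In particular, if $\varepsilon_g=\varepsilon$ and $\varepsilon_h=\varepsilon^{1/2}$, then the same holds with $K$ replaced by $\overline K=\big\lceil\frac{5(\varphi(x^0)-\varphi_{\rm low})}{\min\{c_{nc}/8,\,c_{pg},\,c_{sol}\}}\varepsilon^{-3/2}\big\rceil+2$. -/

import Mathlib

open MeasureTheory ProbabilityTheory
open scoped NNReal RealInnerProductSpace

noncomputable section

namespace PGN2CM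

/-- `ℝⁿ` with the Euclidean norm. -/
abbrev Vec (n : ℕ) : Type := EuclideanSpace ℝ (Fin n)

/-! ### Vectors, principal submatrices, proximal mapping -/

/-- The sign function with the convention `sgn 0 = 1`. -/
def sgn (a : ℝ) : ℝ := if 0 ≤ a then 1 else -1

/-- The norm `‖x‖₁ = ∑ |xᵢ|`. -/
def l1norm {n : ℕ} (x : Vec n) : ℝ := ∑ i, |x i|

/-- The subvector `x_J`. -/
def restrict {n : ℕ} (J : Finset (Fin n)) : Vec n →ₗ[ℝ] EuclideanSpace ℝ J where
  toFun x := WithLp.toLp 2 fun i : J => x i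
  map_add' _ _ := by ext i; simp
  map_smul' _ _ := by ext i; simp

/-- The vector `x` with `x_J = z` and `xᵢ = 0` for `i ∉ J`. -/
def extend {n : ℕ} (J : Finset (Fin n)) : EuclideanSpace ℝ J →ₗ[ℝ] Vec n where
  toFun z := WithLp.toLp 2 fun i => if h : i ∈ J then z ⟨i, h⟩ else 0
  map_add' _ _ := by ext i; by_cases h : i ∈ J <;> simp [h]
  map_smul' _ _ := by ext i; by_cases h : i ∈ J <;> simp [h]

/-- The principal submatrix `A_J`, as a linear map. -/
def principal {n : ℕ} (J : Finset (Fin n)) (A : Vec n →ₗ[ℝ] Vec n) :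
    EuclideanSpace ℝ J →ₗ[ℝ] EuclideanSpace ℝ J :=
  restrict J ∘ₗ A ∘ₗ extend J

/-- The diagonal matrix `Diag(s)`, as a linear map. -/
def diag {n : ℕ} (s : Fin n → ℝ) : Vec n →ₗ[ℝ] Vec n where
  toFun x := WithLp.toLp 2 fun i => s i * x i
  map_add' _ _ := by ext i; simp [mul_add]
  map_smul' _ _ := by ext i; simp [mul_left_comm]

/-- `λ_min(A) ≥ c`: every eigenvalue of `A` is at least `c`. -/
def MinEigenvalueGE {V : Type*} [AddCommGroup V] [Module ℝ V] (A : V →ₗ[ℝ] V) (c : ℝ) : Prop :=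
  ∀ ν : ℝ, Module.End.HasEigenvalue A ν → c ≤ ν

/-- The proximal mapping `prox_h(z) = argmin_y {h(y) + ½‖y - z‖²}`. -/
def prox {n : ℕ} (h : Vec n → ℝ) (z : Vec n) : Vec n :=
  Classical.epsilon fun p => IsMinOn (fun y => h y + 1 / 2 * ‖y - z‖ ^ 2) Set.univ p

/-! ### The problem -/

/-- The objective `φ(x) = f(x) + λ‖x‖₁`. -/
def objective {n : ℕ} (f : Vec n → ℝ) (lam : ℝ) (x : Vec n) : ℝ := f x + lam * l1norm x

/-- The level set `{x | φ(x) ≤ φ(x⁰)}`. -/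
def levelSet {n : ℕ} (f : Vec n → ℝ) (lam : ℝ) (x0 : Vec n) : Set (Vec n) :=
  {x | objective f lam x ≤ objective f lam x0}

/-- The Hessian `∇²f(x)`, as an operator on `ℝⁿ`. -/
def hessian {n : ℕ} (f : Vec n → ℝ) (x : Vec n) : Vec n →L[ℝ] Vec n := fderiv ℝ (gradient f) x

/-- The level set of `x⁰` is bounded, and `f` is twice uniformly Lipschitz continuously
differentiable on an open neighborhood of it. -/
structure ProblemAssumption {n : ℕ} (f : Vec n → ℝ) (lam : ℝ) (x0 : Vec n) : Prop where
  bounded : Bornology.IsBounded (levelSet f lam x0)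
  smooth : ∃ U : Set (Vec n), IsOpen U ∧ levelSet f lam x0 ⊆ U ∧ ContDiffOn ℝ 2 f U ∧
    ∃ C : ℝ≥0, LipschitzOnWith C (hessian f) U

/-- `L_g` and `L_H` are smoothness constants of `f` on the level set of `x⁰`. -/
structure SmoothnessConstants {n : ℕ} (f : Vec n → ℝ) (lam : ℝ) (x0 : Vec n) (Lg LH : ℝ) :
    Prop where
  Lg_pos : 0 < Lg
  LH_pos : 0 < LH
  descent : ∀ x ∈ levelSet f lam x0, ∀ y ∈ levelSet f lam x0, ∀ L : ℝ, Lg ≤ L →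
    f y ≤ f x + ⟪gradient f x, y - x⟫ + L / 2 * ‖y - x‖ ^ 2
  grad_taylor : ∀ x ∈ levelSet f lam x0, ∀ y ∈ levelSet f lam x0,
    ‖hessian f x (y - x) - (gradient f y - gradient f x)‖ ≤ LH / 2 * ‖y - x‖ ^ 2
  taylor : ∀ x ∈ levelSet f lam x0, ∀ y ∈ levelSet f lam x0,
    f y ≤ f x + ⟪gradient f x, y - x⟫ + 1 / 2 * ⟪y - x, hessian f x (y - x)⟫
      + LH / 6 * ‖y - x‖ ^ 3
  hessian_le : ∀ x ∈ levelSet f lam x0, ‖hessian f x‖ ≤ Lg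

/-! ### Index sets and approximate stationary points -/

/-- `I_{≠0} = {i | xᵢ ≠ 0}`. -/
def supp {n : ℕ} (x : Vec n) : Finset (Fin n) := Finset.univ.filter fun i => x i ≠ 0

/-- `I_0^ε = {i | |xᵢ| ≤ ε_g^{1/2}}`. -/
def smallSet {n : ℕ} (εg : ℝ) (x : Vec n) : Finset (Fin n) :=
  Finset.univ.filter fun i => |x i| ≤ εg ^ (1 / 2 : ℝ)

/-- `I_{≠0}^ε = {i | |xᵢ| > ε_g^{1/2}}`. -/
def largeSet {n : ℕ} (εg : ℝ) (x : Vec n) : Finset (Fin n) :=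
  Finset.univ.filter fun i => εg ^ (1 / 2 : ℝ) < |x i|

/-- The vector `g(x)`, the element of least norm of `∇f(x) + λ∂‖x‖₁`. -/
def gVec {n : ℕ} (f : Vec n → ℝ) (lam : ℝ) (x : Vec n) : Vec n :=
  WithLp.toLp 2 fun i =>
    if 0 < x i then gradient f x i + lam
    else if x i < 0 then gradient f x i - lam
    else gradient f x i - min (max (-lam) (gradient f x i)) lam

/-- The vector `g^ε(x)`. -/
def gEps {n : ℕ} (f : Vec n → ℝ) (lam εg : ℝ) (x : Vec n) : Vec n :=
  WithLp.toLp 2 fun i =>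
    if εg ^ (1 / 2 : ℝ) < x i then gradient f x i + lam
    else if x i < -εg ^ (1 / 2 : ℝ) then gradient f x i - lam
    else gradient f x i -
      min (max (-lam - εg ^ (3 / 4 : ℝ)) (gradient f x i)) (lam + εg ^ (3 / 4 : ℝ))

/-- The diagonal scaling `S = Diag(s)` with `sᵢ = 1` if `|xᵢ| > ε_g^{1/2}`, else `sᵢ = xᵢ`. -/
def scaling {n : ℕ} (εg : ℝ) (x : Vec n) : Vec n →ₗ[ℝ] Vec n :=
  diag fun i => if εg ^ (1 / 2 : ℝ) < |x i| then 1 else x i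

/-- The scaled reduced Hessian `S_{≠0} (∇²f(x))_{≠0} S_{≠0}`. -/
def scaledHessian {n : ℕ} (f : Vec n → ℝ) (εg : ℝ) (x : Vec n) :
    EuclideanSpace ℝ (supp x) →ₗ[ℝ] EuclideanSpace ℝ (supp x) :=
  principal (supp x) (scaling εg x) ∘ₗ principal (supp x) (hessian f x : Vec n →ₗ[ℝ] Vec n) ∘ₗ
    principal (supp x) (scaling εg x)

/-- Weak `ε_g`-1o point. -/
def WeakFirstOrder {n : ℕ} (f : Vec n → ℝ) (lam εg : ℝ) (x : Vec n) : Prop :=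
  ‖gEps f lam εg x‖ ≤ εg

/-- Weak `(ε_g, ε_h)`-2o point. -/
def WeakSecondOrder {n : ℕ} (f : Vec n → ℝ) (lam εg εh : ℝ) (x : Vec n) : Prop :=
  WeakFirstOrder f lam εg x ∧ MinEigenvalueGE (scaledHessian f εg x) (-εh)

/-! ### The Capped CG method

The system is `(H + μ I) d = -g` with shift `μ = τ̄ ‖g‖^δ`. -/

section CappedCG

variable {V : Type*} [NormedAddCommGroup V] [InnerProductSpace ℝ V]

/-- The output type of Capped CG: approximate solution or negative curvature. -/
inductive CGType
  | sol
  | nc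

/-- The shifted operator `H + μ I`. -/
def shifted (H : V →ₗ[ℝ] V) (μ : ℝ) : V →ₗ[ℝ] V := H + μ • LinearMap.id

/-- The CG iterates `(y_j, r_j, p_j)` for the operator `A` and right-hand side `-g`. -/
def cgIter (A : V →ₗ[ℝ] V) (g : V) : ℕ → V × V × V
  | 0 => (0, g, -g)
  | j + 1 =>
    let y := (cgIter A g j).1
    let r := (cgIter A g j).2.1
    let p := (cgIter A g j).2.2
    let a := ⟪r, r⟫ / ⟪p, A p⟫
    let r' := r + a • A p
    let b := ⟪r', r'⟫ / ⟪r, r⟫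
    (y + a • p, r', -r' + b • p)

def cgY (A : V →ₗ[ℝ] V) (g : V) (j : ℕ) : V := (cgIter A g j).1
def cgR (A : V →ₗ[ℝ] V) (g : V) (j : ℕ) : V := (cgIter A g j).2.1
def cgP (A : V →ₗ[ℝ] V) (g : V) (j : ℕ) : V := (cgIter A g j).2.2

/-- The update of the estimate `M` of `‖H‖` at a vector `v`. -/
def bump (H : V →ₗ[ℝ] V) (v : V) (M : ℝ) : ℝ :=
  if M * ‖v‖ < ‖H v‖ then ‖H v‖ / ‖v‖ else M

/-- The value of `M` after the updates of pass `j`, starting from the input value `M`. -/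
def cgM (H : V →ₗ[ℝ] V) (μ : ℝ) (g : V) (M : ℝ) : ℕ → ℝ
  | 0 => bump H (cgP (shifted H μ) g 0) M
  | j + 1 =>
    bump H (cgR (shifted H μ) g (j + 1)) (bump H (cgY (shifted H μ) g (j + 1))
      (bump H (cgP (shifted H μ) g (j + 1)) (cgM H μ g M j)))

/-- `κ = (M + μ) / ε`. -/
def cgKappa (μ ε M : ℝ) : ℝ := (M + μ) / ε
/-- `ζ̂ = ζ / (3κ)`. -/
def cgZeta (ζ κ : ℝ) : ℝ := ζ / (3 * κ)
/-- `τ = √κ / (√κ + 1)`. -/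
def cgTau (κ : ℝ) : ℝ := √κ / (√κ + 1)
/-- `T = 4κ⁴ / (1 - √τ)²`. -/
def cgT (κ : ℝ) : ℝ := 4 * κ ^ 4 / (1 - √(cgTau κ)) ^ 2

/-- `⟨v, A v⟩ < ε ‖v‖²`. -/
def SmallCurvature (A : V →ₗ[ℝ] V) (ε : ℝ) (v : V) : Prop := ⟪v, A v⟫ < ε * ‖v‖ ^ 2

/-- `‖r_j‖ ≤ ζ̂ ‖r_0‖`. -/
def CGSolved (H : V →ₗ[ℝ] V) (μ : ℝ) (g : V) (ε ζ M : ℝ) (j : ℕ) : Prop :=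
  ‖cgR (shifted H μ) g j‖ ≤
    cgZeta ζ (cgKappa μ ε (cgM H μ g M j)) * ‖cgR (shifted H μ) g 0‖

/-- `‖r_j‖ > √T τ^{j/2} ‖r_0‖`. -/
def CGSlow (H : V →ₗ[ℝ] V) (μ : ℝ) (g : V) (ε M : ℝ) (j : ℕ) : Prop :=
  √(cgT (cgKappa μ ε (cgM H μ g M j))) *
      cgTau (cgKappa μ ε (cgM H μ g M j)) ^ ((j : ℝ) / 2) * ‖cgR (shifted H μ) g 0‖ <
    ‖cgR (shifted H μ) g j‖

/-- A termination test of pass `j` succeeds (only the test on `p_0` is made in pass `0`). -/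
def CGDone (H : V →ₗ[ℝ] V) (μ : ℝ) (g : V) (ε ζ M : ℝ) (j : ℕ) : Prop :=
  SmallCurvature (shifted H μ) ε (cgP (shifted H μ) g j) ∨
    (1 ≤ j ∧ (SmallCurvature (shifted H μ) ε (cgY (shifted H μ) g j) ∨
      CGSolved H μ g ε ζ M j ∨ CGSlow H μ g ε M j))

/-- Capped CG with inputs `H, g, ε, ζ, M` and shift `μ` may return `(d, type)`. The tests of a
pass are made in the order of the constructors `nc_y`, `sol`, `nc_p`, `slow`, and the index `i`
that is looked for in the last case may be any that qualifies. -/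
inductive CappedCGReturns (H : V →ₗ[ℝ] V) (μ : ℝ) (g : V) (ε ζ M : ℝ) : V → CGType → Prop
  | nc_zero (h : SmallCurvature (shifted H μ) ε (cgP (shifted H μ) g 0)) :
      CappedCGReturns H μ g ε ζ M (cgP (shifted H μ) g 0) .nc
  | nc_y (j : ℕ) (hj : 1 ≤ j) (hprev : ∀ i < j, ¬ CGDone H μ g ε ζ M i)
      (hy : SmallCurvature (shifted H μ) ε (cgY (shifted H μ) g j)) :
      CappedCGReturns H μ g ε ζ M (cgY (shifted H μ) g j) .nc
  | sol (j : ℕ) (hj : 1 ≤ j) (hprev : ∀ i < j, ¬ CGDone H μ g ε ζ M i)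
      (hy : ¬ SmallCurvature (shifted H μ) ε (cgY (shifted H μ) g j))
      (hs : CGSolved H μ g ε ζ M j) :
      CappedCGReturns H μ g ε ζ M (cgY (shifted H μ) g j) .sol
  | nc_p (j : ℕ) (hj : 1 ≤ j) (hprev : ∀ i < j, ¬ CGDone H μ g ε ζ M i)
      (hy : ¬ SmallCurvature (shifted H μ) ε (cgY (shifted H μ) g j))
      (hs : ¬ CGSolved H μ g ε ζ M j)
      (hp : SmallCurvature (shifted H μ) ε (cgP (shifted H μ) g j)) :
      CappedCGReturns H μ g ε ζ M (cgP (shifted H μ) g j) .nc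
  | slow (j : ℕ) (hj : 1 ≤ j) (hprev : ∀ i < j, ¬ CGDone H μ g ε ζ M i)
      (hy : ¬ SmallCurvature (shifted H μ) ε (cgY (shifted H μ) g j))
      (hs : ¬ CGSolved H μ g ε ζ M j)
      (hp : ¬ SmallCurvature (shifted H μ) ε (cgP (shifted H μ) g j))
      (ht : CGSlow H μ g ε M j) (i : ℕ) (hi : i < j)
      (hc : SmallCurvature (shifted H μ) ε
        (cgY (shifted H μ) g (j + 1) - cgY (shifted H μ) g i)) :
      CappedCGReturns H μ g ε ζ M (cgY (shifted H μ) g (j + 1) - cgY (shifted H μ) g i) .nc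

/-- The Newton-CG direction made from the output of Capped CG. -/
def newtonDir (H : V →ₗ[ℝ] V) (g d : V) : CGType → V
  | .sol => d
  | .nc => -((sgn ⟪d, g⟫ * (|⟪d, H d⟫| / ‖d‖ ^ 2)) • (‖d‖⁻¹ • d))

end CappedCG

/-! ### The algorithm -/

/-- The input parameters of the algorithm. -/
structure Params where
  εg : ℝ
  εh : ℝ
  β : ℝ
  δ : ℝ
  τhat : ℝ
  ζ : ℝ
  ηbar : ℝ
  η : ℝ
  θ : ℝ
  εg_mem : εg ∈ Set.Ioo (0 : ℝ) 1
  εh_mem : εh ∈ Set.Ioo (0 : ℝ) 1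
  β_gt : 1 < β
  δ_mem : δ ∈ Set.Icc (0 : ℝ) 1
  τhat_ge : 1 ≤ τhat
  ζ_mem : ζ ∈ Set.Ioo (0 : ℝ) 1
  ηbar_mem : ηbar ∈ Set.Ioo (0 : ℝ) 1
  η_mem : η ∈ Set.Ioo (0 : ℝ) ((1 - ζ) / 2)
  θ_mem : θ ∈ Set.Ioo (0 : ℝ) 1

/-- A state between two iterations: running at the current iterate, stopped with an output, or
failed (an inner loop of an iteration has not terminated with a result). -/
inductive State (n : ℕ)
  | running (x : Vec n)
  | stopped (x : Vec n)
  | failed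

/-- Backtracking: move to `trial j` for the smallest `j` that is acceptable; if no `j` is
acceptable, the search runs forever and the algorithm fails. -/
def LineSearch {n : ℕ} (trial : ℕ → Vec n) (ok : ℕ → Prop) (s : State n) : Prop :=
  (∃ j, IsLeast {i | ok i} j ∧ s = .running (trial j)) ∨ ((∀ j, ¬ ok j) ∧ s = .failed)

variable {n : ℕ}

/-- The proximal gradient point `prox_{(λ/t)‖·‖₁}(x - (1/t)∇f(x))`. -/
def proxPoint (f : Vec n → ℝ) (lam : ℝ) (x : Vec n) (t : ℝ) : Vec n :=
  prox (fun y => lam / t * l1norm y) (x - (1 / t) • gradient f x)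

/-- The gradient mapping `𝒢_t(x)`. -/
def gradMap (f : Vec n → ℝ) (lam : ℝ) (x : Vec n) (t : ℝ) : Vec n :=
  t • (x - proxPoint f lam x t)

/-- The case of the proximal gradient step. -/
def ProxStage (P : Params) (f : Vec n → ℝ) (lam : ℝ) (x : Vec n) : Prop :=
  (smallSet P.εg x).Nonempty ∧ ‖restrict (smallSet P.εg x) (gEps f lam P.εg x)‖ ≠ 0

/-- The case of the Newton-CG step. -/
def NewtonStage (P : Params) (f : Vec n → ℝ) (lam : ℝ) (x : Vec n) : Prop :=
  ¬ ProxStage P f lam x ∧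
    (largeSet P.εg x).Nonempty ∧ P.εg < ‖restrict (largeSet P.εg x) (gEps f lam P.εg x)‖

/-- The second phase, in which the minimum eigenvalue oracle is called. -/
def OracleStage (P : Params) (f : Vec n → ℝ) (lam : ℝ) (x : Vec n) : Prop :=
  ¬ ProxStage P f lam x ∧ ¬ NewtonStage P f lam x

/-- The reduced gradient `g_{≠0ε}`. -/
def redGrad (P : Params) (f : Vec n → ℝ) (lam : ℝ) (x : Vec n) :
    EuclideanSpace ℝ (largeSet P.εg x) :=
  restrict (largeSet P.εg x) (gEps f lam P.εg x)

/-- The reduced Hessian `H_{≠0ε}`. -/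
def redHess (P : Params) (f : Vec n → ℝ) (x : Vec n) :
    EuclideanSpace ℝ (largeSet P.εg x) →ₗ[ℝ] EuclideanSpace ℝ (largeSet P.εg x) :=
  principal (largeSet P.εg x) (hessian f x : Vec n →ₗ[ℝ] Vec n)

/-- The direction of the negative curvature step of the second phase, from the unit vector `u`
that the oracle has returned. -/
def curvDir (P : Params) (f : Vec n → ℝ) (lam : ℝ) (x : Vec n) (u : EuclideanSpace ℝ (supp x)) :
    Vec n :=
  extend (supp x)
    (-((sgn ⟪restrict (supp x) (gVec f lam x), principal (supp x) (scaling P.εg x) u⟫ *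
      |⟪u, scaledHessian f P.εg x u⟫|) • u))

/-- One iteration of the algorithm, for any admissible choice of `τ_k` and of the input `M` of
Capped CG, and any answer of the minimum eigenvalue oracle that has its form: a certificate
(correct or not), or a unit vector of curvature at most `-ε_h/2`. -/
inductive Step (P : Params) (f : Vec n → ℝ) (lam : ℝ) : State n → State n → Prop
  | prox_step (x : Vec n) (s : State n) (hx : ProxStage P f lam x)
      (hs : LineSearch (fun j => proxPoint f lam x (P.β ^ j))
        (fun j => objective f lam (proxPoint f lam x (P.β ^ j)) <
          objective f lam x - P.ηbar / P.β ^ j * ‖gradMap f lam x (P.β ^ j)‖ ^ 2) s) :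
      Step P f lam (.running x) s
  | newton_step (x : Vec n) (s : State n) (hx : NewtonStage P f lam x)
      (τ : ℝ) (hτ : τ ∈ Set.Icc (2 * P.εh / ‖redGrad P f lam x‖ ^ P.δ)
        (2 * P.τhat * P.εh / ‖redGrad P f lam x‖ ^ P.δ))
      (M : ℝ) (hM : 0 ≤ M)
      (d : EuclideanSpace ℝ (largeSet P.εg x)) (c : CGType)
      (hd : CappedCGReturns (redHess P f x) (τ * ‖redGrad P f lam x‖ ^ P.δ) (redGrad P f lam x)
        P.εh P.ζ M d c)
      (D : Vec n)
      (hD : D = extend (largeSet P.εg x) (newtonDir (redHess P f x) (redGrad P f lam x) d c))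
      (hs : LineSearch (fun j => x + P.θ ^ j • D)
        (fun j => objective f lam (x + P.θ ^ j • D) <
          objective f lam x - P.η * P.θ ^ (2 * j) * P.εh * ‖D‖ ^ 2) s) :
      Step P f lam (.running x) s
  | newton_fail (x : Vec n) (hx : NewtonStage P f lam x)
      (τ : ℝ) (hτ : τ ∈ Set.Icc (2 * P.εh / ‖redGrad P f lam x‖ ^ P.δ)
        (2 * P.τhat * P.εh / ‖redGrad P f lam x‖ ^ P.δ))
      (M : ℝ) (hM : 0 ≤ M)
      (hd : ∀ d c, ¬ CappedCGReturns (redHess P f x) (τ * ‖redGrad P f lam x‖ ^ P.δ)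
        (redGrad P f lam x) P.εh P.ζ M d c) :
      Step P f lam (.running x) .failed
  | certificate (x : Vec n) (hx : OracleStage P f lam x) :
      Step P f lam (.running x) (.stopped x)
  | curvature_step (x : Vec n) (s : State n) (hx : OracleStage P f lam x)
      (u : EuclideanSpace ℝ (supp x)) (hu : ‖u‖ = 1)
      (hcurv : ⟪u, scaledHessian f P.εg x u⟫ ≤ -P.εh / 2)
      (hs : LineSearch
        (fun j => x + P.θ ^ j • scaling P.εg x (curvDir P f lam x u))
        (fun j => objective f lam (x + P.θ ^ j • scaling P.εg x (curvDir P f lam x u)) <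
          objective f lam x - P.η * P.θ ^ (2 * j) * ‖curvDir P f lam x u‖ ^ 3) s) :
      Step P f lam (.running x) s
  | stay_stopped (x : Vec n) : Step P f lam (.stopped x) (.stopped x)
  | stay_failed : Step P f lam .failed .failed

/-- The event that in iteration `k` the oracle issues a wrong certificate: the algorithm stops at
its iterate `x` although `λ_min` of the scaled reduced Hessian is below `-ε_h`. -/
def wrongCertificate {Ω : Type*} (P : Params) (f : Vec n → ℝ) (Z : ℕ → Ω → State n) (k : ℕ) :
    Set Ω :=
  {ω | ∃ x, Z k ω = .running x ∧ Z (k + 1) ω = .stopped x ∧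
    ¬ MinEigenvalueGE (scaledHessian f P.εg x) (-P.εh)}

/-- `Z` is a random run of the algorithm from `x⁰`, where `Z k` is the state before iteration `k`
and `ℱ k` is the information that is available then. Whatever has happened before, a call of the
oracle issues a wrong certificate with probability at most `σ`. -/
structure IsRandomRun {Ω : Type*} [mΩ : MeasurableSpace Ω] (P : Params) (f : Vec n → ℝ) (lam : ℝ)
    (x0 : Vec n) (σ : ℝ) (μ : Measure Ω) (ℱ : Filtration ℕ mΩ) (Z : ℕ → Ω → State n) : Prop where
  init : ∀ᵐ ω ∂μ, Z 0 ω = .running x0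
  step : ∀ᵐ ω ∂μ, ∀ k, Step P f lam (Z k ω) (Z (k + 1) ω)
  measurable : ∀ k, MeasurableSet[ℱ (k + 1)] (wrongCertificate P f Z k)
  oracle : ∀ k, μ⟦wrongCertificate P f Z k | ℱ k⟧ ≤ᵐ[μ] fun _ => σ

/-! ### The constants of the complexity bound -/

/-- `c_pg = η̄ / max{β L_g / (2 - 2η̄), 1}`. -/
def cPG (P : Params) (Lg : ℝ) : ℝ := P.ηbar / max (P.β * Lg / (2 - 2 * P.ηbar)) 1

/-- `c_nc = η θ² min{1, 9(1 - 2η)² / L_H²}`. -/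
def cNC (P : Params) (LH : ℝ) : ℝ :=
  P.η * P.θ ^ 2 * min 1 (9 * (1 - 2 * P.η) ^ 2 / LH ^ 2)

/-- The constant `c_sol`. -/
def cSOL (P : Params) (LH : ℝ) : ℝ :=
  P.η * min
    (min ((4 / (√((P.ζ + 4 * P.τhat) ^ 2 + 8 * LH) + (P.ζ + 4 * P.τhat))) ^ 2)
      (9 * (1 - P.ζ - 2 * P.η) ^ 2 * P.θ ^ 2 / LH ^ 2))
    (min (P.θ ^ 2) ((1 - P.ζ) ^ 2 * P.θ ^ 2 / (4 * max (LH / 3) (2 * P.η) ^ 2)))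

/-- `min{c_nc/8, c_pg, c_sol}`. -/
def cMin (P : Params) (Lg LH : ℝ) : ℝ := min (min (cNC P LH / 8) (cPG P Lg)) (cSOL P LH)

/-- The bound `⌈5(φ(x⁰) - φ_low)/min{c_nc/8, c_pg, c_sol} · r⌉ + 2` on the number of iterations,
with gap `φ(x⁰) - φ_low` and rate `r`. -/
def iterBound (P : Params) (Lg LH gap rate : ℝ) : ℕ :=
  ⌈5 * gap / cMin P Lg LH * rate⌉₊ + 2

/-- `max{ε_g⁻¹ε_h⁻¹, ε_h⁻³, ε_g⁻²ε_h, ε_g^{-3/2}}`. -/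
def soRate (εg εh : ℝ) : ℝ :=
  max (max (εg⁻¹ * εh⁻¹) ((εh ^ 3)⁻¹)) (max ((εg ^ 2)⁻¹ * εh) (εg ^ (-(3 / 2) : ℝ)))

end PGN2CM

end

noncomputable section

namespace PGN2CM

/-! ### The Capped CG method -/

section CappedCGTheory

variable {V : Type*} [NormedAddCommGroup V] [InnerProductSpace ℝ V]

/-! The bound is an amortized descent count with the single unit `Δ = cMin / soRate`. Every
iteration that does not stop lowers `φ` by `Δ`, with one exception: a Newton step of type SOL may be
too short for that. A full SOL step `d` with `‖d‖ < ε_g^{1/2}` solves the reduced Newton system up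
to `O(ε_h ‖d‖)`, so the next reduced gradient is at most `L_H/2 ‖d‖² + O(ε_h ‖d‖)`. If the next
iterate is again in the Newton case, this gradient exceeds `ε_g`, which bounds `‖d‖` below and
yields `Δ` after all. If not, the next iteration earns `Δ` itself or stops. Hence `k` iterations
gain at least `(k - 1)/2 · Δ` (`run_invariant`), and the gap is exhausted before `K` (`run_stops`).

The decrease of Newton and curvature steps comes from the linearity of `‖·‖₁` along moves that keep
the signs: there `φ` has a cubic Taylor bound (`objective_le_cubic`), and backtracking accepts the
first trial or a step limited by the signs or by the cubic remainder
(`LineSearch.exists_step_of_keep_sign`). The smoothness constants compare only points of the level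
set, so each trial point must first be shown to lie in it; `path_mem_levelSet` does this by
following a path from the current iterate. The proximal step uses the same device with `1/t` as the
path parameter.

No iteration fails. Capped CG ends because nonzero orthogonal residuals cannot continue forever in
finite dimension, and because slow convergence reveals small curvature: `cg_potential` is the
potential of an accelerated method and needs curvature only along the differences `z - y_i`, here
with `z = y_{j+1}`.

All this is deterministic. At a stop the first-order condition follows from the failed tests, the
second-order one from a correct certificate. Conditioning on the past shows that the first `K`
iterations contain no wrong certificate with probability at least `(1 - σ)^K`. -/

lemma cgY_zero (A : V →ₗ[ℝ] V) (g : V) : cgY A g 0 = 0 := rfl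

lemma cgR_zero (A : V →ₗ[ℝ] V) (g : V) : cgR A g 0 = g := rfl

lemma cgP_zero (A : V →ₗ[ℝ] V) (g : V) : cgP A g 0 = -g := rfl

/-- The step length `α_j` of CG. -/
def cgStep (A : V →ₗ[ℝ] V) (g : V) (j : ℕ) : ℝ :=
  ⟪cgR A g j, cgR A g j⟫ / ⟪cgP A g j, A (cgP A g j)⟫

/-- The coefficient `‖r_{j+1}‖² / ‖r_j‖²` of CG. -/
def cgCoeff (A : V →ₗ[ℝ] V) (g : V) (j : ℕ) : ℝ :=
  ⟪cgR A g (j + 1), cgR A g (j + 1)⟫ / ⟪cgR A g j, cgR A g j⟫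

lemma cgY_succ (A : V →ₗ[ℝ] V) (g : V) (j : ℕ) :
    cgY A g (j + 1) = cgY A g j + cgStep A g j • cgP A g j := rfl

lemma cgR_succ (A : V →ₗ[ℝ] V) (g : V) (j : ℕ) :
    cgR A g (j + 1) = cgR A g j + cgStep A g j • A (cgP A g j) := rfl

lemma cgP_succ (A : V →ₗ[ℝ] V) (g : V) (j : ℕ) :
    cgP A g (j + 1) = -cgR A g (j + 1) + cgCoeff A g j • cgP A g j := rfl

/-- The residual identity `r_j = A y_j + g`. -/
lemma cgR_eq (A : V →ₗ[ℝ] V) (g : V) (j : ℕ) : cgR A g j = A (cgY A g j) + g := by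
  induction j with
  | zero => simp [cgY_zero, cgR_zero]
  | succ j ih => rw [cgR_succ, cgY_succ, ih, map_add, map_smul]; abel

/-- CG has not broken down before pass `j`. -/
def CGRegular (A : V →ₗ[ℝ] V) (g : V) (j : ℕ) : Prop :=
  ∀ i < j, cgR A g i ≠ 0 ∧ 0 < ⟪cgP A g i, A (cgP A g i)⟫

lemma CGRegular.mono {A : V →ₗ[ℝ] V} {g : V} {i j : ℕ} (h : CGRegular A g j) (hij : i ≤ j) :
    CGRegular A g i := fun k hk => h k (hk.trans_le hij)

/-- The span of the search directions before pass `j`. -/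
def cgSpan (A : V →ₗ[ℝ] V) (g : V) (j : ℕ) : Submodule ℝ V :=
  Submodule.span ℝ (cgP A g '' Set.Iio j)

lemma cgSpan_mono (A : V →ₗ[ℝ] V) (g : V) {i j : ℕ} (h : i ≤ j) : cgSpan A g i ≤ cgSpan A g j :=
  Submodule.span_mono (Set.image_mono (Set.Iio_subset_Iio h))

lemma cgP_mem_cgSpan (A : V →ₗ[ℝ] V) (g : V) {i j : ℕ} (h : i < j) : cgP A g i ∈ cgSpan A g j :=
  Submodule.subset_span ⟨i, h, rfl⟩

lemma cgR_mem_cgSpan (A : V →ₗ[ℝ] V) (g : V) (j : ℕ) : cgR A g j ∈ cgSpan A g (j + 1) := by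
  cases j with
  | zero =>
    rw [cgR_zero]
    have := cgP_mem_cgSpan A g (Nat.zero_lt_one)
    rw [cgP_zero] at this
    simpa using this
  | succ j =>
    have h : cgR A g (j + 1) = cgCoeff A g j • cgP A g j - cgP A g (j + 1) := by
      rw [cgP_succ]; abel
    rw [h]
    exact Submodule.sub_mem _ (Submodule.smul_mem _ _ (cgP_mem_cgSpan A g (by omega)))
      (cgP_mem_cgSpan A g (by omega))

lemma cgY_mem_cgSpan (A : V →ₗ[ℝ] V) (g : V) (j : ℕ) : cgY A g j ∈ cgSpan A g j := by
  induction j with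
  | zero => rw [cgY_zero]; exact Submodule.zero_mem _
  | succ j ih =>
    rw [cgY_succ]
    exact Submodule.add_mem _ (cgSpan_mono A g (Nat.le_succ j) ih)
      (Submodule.smul_mem _ _ (cgP_mem_cgSpan A g (by omega)))

/-- The residuals are orthogonal to the earlier search directions, and the search directions are
conjugate. -/
lemma cg_orthogonal {A : V →ₗ[ℝ] V} (hA : A.IsSymmetric) (g : V) (j : ℕ)
    (h : CGRegular A g j) :
    (∀ v ∈ cgSpan A g j, ⟪cgR A g j, v⟫ = 0) ∧ (∀ i < j, ⟪cgP A g j, A (cgP A g i)⟫ = 0) ∧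
      ⟪cgR A g j, cgP A g j⟫ = -⟪cgR A g j, cgR A g j⟫ := by
  induction j with
  | zero =>
    refine ⟨fun v hv => ?_, fun i hi => absurd hi (Nat.not_lt_zero i), ?_⟩
    · have : v = 0 := by simpa [cgSpan] using hv
      simp [this]
    · simp [cgP_zero, cgR_zero]
  | succ j ih =>
    obtain ⟨h1, h2, h3⟩ := ih (h.mono (Nat.le_succ j))
    obtain ⟨hr, hp⟩ := h j (Nat.lt_succ_self j)
    have hrr : ⟪cgR A g j, cgR A g j⟫ ≠ 0 := inner_self_ne_zero.2 hr
    have hstep : cgStep A g j ≠ 0 := div_ne_zero hrr hp.ne'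
    have hspan : ∀ v ∈ cgSpan A g (j + 1), ⟪cgR A g (j + 1), v⟫ = 0 := by
      intro v hv
      refine Submodule.span_induction (p := fun v _ => ⟪cgR A g (j + 1), v⟫ = 0) ?_ ?_ ?_ ?_ hv
      · rintro _ ⟨i, hi, rfl⟩
        rw [cgR_succ, inner_add_left, inner_smul_left, hA]
        rcases Nat.lt_succ_iff_lt_or_eq.1 hi with hi | rfl
        · rw [h1 _ (cgP_mem_cgSpan A g hi), h2 i hi]; simp
        · rw [h3, cgStep]; simp; field_simp; ring
      · simp
      · intro x y _ _ hx hy; rw [inner_add_right, hx, hy, add_zero]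
      · intro a x _ hx; rw [inner_smul_right, hx, mul_zero]
    -- This expresses `A p_i` through two consecutive residuals, so that conjugacy reduces to the
    -- orthogonality just proved.
    have hAp : ∀ i, cgStep A g i • A (cgP A g i) = cgR A g (i + 1) - cgR A g i := by
      intro i; rw [cgR_succ]; abel
    refine ⟨hspan, ?_, ?_⟩
    · intro i hi
      rw [cgP_succ, inner_add_left, inner_neg_left, inner_smul_left]
      have hri := (h i hi)
      have hsi : cgStep A g i ≠ 0 := div_ne_zero (inner_self_ne_zero.2 hri.1) hri.2.ne'
      have key : cgStep A g i * ⟪cgR A g (j + 1), A (cgP A g i)⟫ =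
          ⟪cgR A g (j + 1), cgR A g (i + 1)⟫ := by
        rw [← inner_smul_right, hAp, inner_sub_right,
          hspan _ (cgSpan_mono A g hi (cgR_mem_cgSpan A g i)), sub_zero]
      rcases Nat.lt_succ_iff_lt_or_eq.1 hi with hi' | rfl
      · rw [hspan _ (cgSpan_mono A g (Nat.succ_lt_succ hi') (cgR_mem_cgSpan A g (i + 1)))] at key
        rw [(mul_eq_zero.1 key).resolve_left hsi, h2 i hi']; simp
      · have : ⟪cgR A g (i + 1), A (cgP A g i)⟫ =
            ⟪cgR A g (i + 1), cgR A g (i + 1)⟫ / cgStep A g i := by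
          rw [← key]; field_simp
        rw [this, cgCoeff, cgStep]
        simp only [conj_trivial]
        field_simp; ring
    · rw [cgP_succ, inner_add_right, inner_neg_right, inner_smul_right,
        hspan _ (cgP_mem_cgSpan A g (Nat.lt_succ_self j))]
      simp

lemma cgP_ne_zero {A : V →ₗ[ℝ] V} (hA : A.IsSymmetric) {g : V} {j : ℕ} (h : CGRegular A g j)
    (hr : cgR A g j ≠ 0) : cgP A g j ≠ 0 := by
  intro h0
  have := (cg_orthogonal hA g j h).2.2
  rw [h0, inner_zero_right] at this
  exact (inner_self_ne_zero (𝕜 := ℝ)).2 hr (by linarith)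

/-- `⟨p_j, A p_j⟩ ≤ ⟨r_j, A r_j⟩`. -/
lemma cg_curvature_le {A : V →ₗ[ℝ] V} (hA : A.IsSymmetric) {g : V} {j : ℕ}
    (h : CGRegular A g j) : ⟪cgP A g j, A (cgP A g j)⟫ ≤ ⟪cgR A g j, A (cgR A g j)⟫ := by
  cases j with
  | zero => simp [cgP_zero, cgR_zero]
  | succ j =>
    have hr : cgR A g (j + 1) = cgCoeff A g j • cgP A g j - cgP A g (j + 1) := by
      rw [cgP_succ]; abel
    -- Conjugacy removes the cross terms of `r = β p_j - p_{j+1}`, and what remains besides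
    -- `⟨p_{j+1}, A p_{j+1}⟩` is `β² ⟨p_j, A p_j⟩ ≥ 0`.
    have h2 := (cg_orthogonal hA g (j + 1) h).2.1 j (Nat.lt_succ_self j)
    have h2' : ⟪cgP A g j, A (cgP A g (j + 1))⟫ = 0 := by
      rw [← hA, real_inner_comm, h2]
    rw [hr]
    simp only [map_sub, map_smul, inner_sub_left, inner_sub_right, inner_smul_left,
      inner_smul_right, h2, h2', conj_trivial]
    nlinarith [mul_nonneg (sq_nonneg (cgCoeff A g j)) (h j (Nat.lt_succ_self j)).2.le]

/-! ### Linear convergence of the CG residuals -/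

/-- The quadratic `½⟨y, A y⟩ + ⟨g, y⟩` that CG minimizes. -/
def cgQuad (A : V →ₗ[ℝ] V) (g y : V) : ℝ := 1 / 2 * ⟪y, A y⟫ + ⟪g, y⟫

lemma cgQuad_add {A : V →ₗ[ℝ] V} (hA : A.IsSymmetric) (g y d : V) :
    cgQuad A g (y + d) = cgQuad A g y + ⟪A y + g, d⟫ + 1 / 2 * ⟪d, A d⟫ := by
  have : ⟪d, A y⟫ = ⟪y, A d⟫ := by rw [← hA, real_inner_comm]
  have h' : ⟪A y, d⟫ = ⟪y, A d⟫ := hA _ _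
  simp only [cgQuad, map_add, inner_add_left, inner_add_right, this, h']
  ring

/-- The exact line search gains `‖r_j‖⁴ / (2⟨p_j, A p_j⟩)`. Since `p_j` has no more curvature than
`r_j`, a norm bound at `r_j` alone controls the denominator; no operator norm of `A` enters. -/
lemma cgQuad_succ_le {A : V →ₗ[ℝ] V} (hA : A.IsSymmetric) {g : V} {j : ℕ} {L : ℝ} (hL : 0 < L)
    (h : CGRegular A g (j + 1)) (hLr : ‖A (cgR A g j)‖ ≤ L * ‖cgR A g j‖) :
    cgQuad A g (cgY A g (j + 1)) ≤ cgQuad A g (cgY A g j) - ‖cgR A g j‖ ^ 2 / (2 * L) := by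
  obtain ⟨hr, hp⟩ := h j (Nat.lt_succ_self j)
  have hreg := h.mono (Nat.le_succ j)
  obtain ⟨-, -, h3⟩ := cg_orthogonal hA g j hreg
  rw [cgY_succ, cgQuad_add hA, ← cgR_eq, map_smul, inner_smul_right, inner_smul_left,
    inner_smul_right, h3, cgStep]
  have hle : ⟪cgP A g j, A (cgP A g j)⟫ ≤ L * ‖cgR A g j‖ ^ 2 :=
    (cg_curvature_le hA hreg).trans ((real_inner_le_norm _ _).trans (by
      nlinarith [norm_nonneg (cgR A g j)]))
  rw [real_inner_self_eq_norm_sq]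
  set q := ⟪cgP A g j, A (cgP A g j)⟫
  have hr2 : 0 < ‖cgR A g j‖ ^ 2 := by positivity
  set r := ‖cgR A g j‖ ^ 2
  have : r / (2 * L) ≤ r ^ 2 / (2 * q) := by
    rw [div_le_div_iff₀ (by positivity) (by positivity)]
    nlinarith
  simp only [conj_trivial]
  have e : r / q * -r + 1 / 2 * (r / q * (r / q * q)) = -(r ^ 2 / (2 * q)) := by
    field_simp; ring
  linarith

/-- The combination of two squared distances. -/
lemma norm_sub_convexComb_sq (a : ℝ) (z v w : V) :
    ‖z - ((1 - a) • v + a • w)‖ ^ 2 =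
      (1 - a) * ‖z - v‖ ^ 2 + a * ‖z - w‖ ^ 2 - a * (1 - a) * ‖v - w‖ ^ 2 := by
  have e1 : z - ((1 - a) • v + a • w) = (1 - a) • (z - v) + a • (z - w) := by
    module
  have e2 : v - w = (z - w) - (z - v) := by abel
  rw [e1, e2, norm_add_sq_real, norm_sub_sq_real (z - w) (z - v), norm_smul, norm_smul,
    inner_smul_left, inner_smul_right, mul_pow, mul_pow, Real.norm_eq_abs, Real.norm_eq_abs,
    sq_abs, sq_abs, real_inner_comm]
  simp only [conj_trivial]
  ring

/-- If `A` has curvature at least `ε` along `z - y_i` for `i < j`, then CG converges linearly to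
`z` with the rate of an accelerated method. -/
lemma cg_potential {A : V →ₗ[ℝ] V} (hA : A.IsSymmetric) {g z : V} {j : ℕ} {L ε a : ℝ}
    (hL : 0 < L) (hε : 0 < ε) (ha : 0 ≤ a) (ha1 : a ≤ 1) (haL : a ^ 2 * L ≤ ε)
    (h : CGRegular A g j) (hLr : ∀ i < j, ‖A (cgR A g i)‖ ≤ L * ‖cgR A g i‖)
    (hz : ∀ i < j, ε * ‖z - cgY A g i‖ ^ 2 ≤ ⟪z - cgY A g i, A (z - cgY A g i)⟫) :
    ∀ i ≤ j, ∃ v ∈ cgSpan A g i, cgQuad A g (cgY A g i) - cgQuad A g z + ε / 2 * ‖z - v‖ ^ 2 ≤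
      (1 - a) ^ i * (ε / 2 * ‖z‖ ^ 2 - cgQuad A g z) := by
  intro i
  induction i with
  | zero =>
    intro _
    refine ⟨0, Submodule.zero_mem _, ?_⟩
    simp [cgY_zero, cgQuad]
    linarith
  | succ i ih =>
    intro hi
    obtain ⟨v, hv, hE⟩ := ih (by omega)
    set y := cgY A g i with hy
    set r := cgR A g i with hr
    have hdec := cgQuad_succ_le hA hL (h.mono hi) (hLr i hi)
    have horth := (cg_orthogonal hA g i (h.mono (by omega))).1
    -- The estimate-sequence update: `y - r/ε` is the centre of the quadratic lower model of
    -- curvature `ε` at `y`.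
    refine ⟨(1 - a) • v + a • (y - ε⁻¹ • r), ?_, ?_⟩
    · have m := cgSpan_mono A g (Nat.le_succ i)
      exact Submodule.add_mem _ (Submodule.smul_mem _ _ (m hv)) (Submodule.smul_mem _ _
        (Submodule.sub_mem _ (m (cgY_mem_cgSpan A g i))
          (Submodule.smul_mem _ _ (cgR_mem_cgSpan A g i))))
    · rw [norm_sub_convexComb_sq]
      -- Both `v` and `y` lie in the span to which `r` is orthogonal. This replaces the
      -- extrapolation of an accelerated gradient method.
      have e1 : ‖v - (y - ε⁻¹ • r)‖ ^ 2 = ‖v - y‖ ^ 2 + ε⁻¹ ^ 2 * ‖r‖ ^ 2 := by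
        have : v - (y - ε⁻¹ • r) = (v - y) + ε⁻¹ • r := by abel
        rw [this, norm_add_sq_real, inner_smul_right, real_inner_comm,
          horth _ (Submodule.sub_mem _ hv (cgY_mem_cgSpan A g i)), norm_smul, mul_pow,
          Real.norm_eq_abs, sq_abs]
        ring
      have e2 : ‖z - (y - ε⁻¹ • r)‖ ^ 2 =
          ‖z - y‖ ^ 2 + 2 * ε⁻¹ * ⟪r, z - y⟫ + ε⁻¹ ^ 2 * ‖r‖ ^ 2 := by
        have : z - (y - ε⁻¹ • r) = (z - y) + ε⁻¹ • r := by abel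
        rw [this, norm_add_sq_real, inner_smul_right, real_inner_comm, norm_smul, mul_pow,
          Real.norm_eq_abs, sq_abs]
        ring
      have hq : cgQuad A g z = cgQuad A g y + ⟪r, z - y⟫ + 1 / 2 * ⟪z - y, A (z - y)⟫ := by
        rw [hr, cgR_eq, ← cgQuad_add hA]; congr 1; rw [hy]; abel
      have hzi := hz i hi
      rw [e1, e2]
      -- Strong convexity is needed only along `z - y_i`; `A` itself may be indefinite.
      have hlow : cgQuad A g y + ⟪r, z - y⟫ + ε / 2 * ‖z - y‖ ^ 2 ≤ cgQuad A g z := by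
        rw [hq]; linarith
      have hmul := mul_le_mul_of_nonneg_left hE (by linarith : 0 ≤ 1 - a)
      have hmul2 := mul_le_mul_of_nonneg_left hlow ha
      have h3 : 0 ≤ a * (1 - a) * ‖v - y‖ ^ 2 := by
        have : 0 ≤ 1 - a := by linarith
        positivity
      -- The error of the update is paid for by the decrease of the quadratic, thanks to `a² L ≤ ε`.
      have h4 : a ^ 2 * ‖r‖ ^ 2 / (2 * ε) ≤ ‖r‖ ^ 2 / (2 * L) := by
        rw [div_le_div_iff₀ (by positivity) (by positivity)]
        nlinarith [sq_nonneg ‖r‖]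
      have e3 : ε / 2 * ((1 - a) * ‖z - v‖ ^ 2 + a * (‖z - y‖ ^ 2 + 2 * ε⁻¹ * ⟪r, z - y⟫ +
            ε⁻¹ ^ 2 * ‖r‖ ^ 2) - a * (1 - a) * (‖v - y‖ ^ 2 + ε⁻¹ ^ 2 * ‖r‖ ^ 2)) =
          (1 - a) * (ε / 2 * ‖z - v‖ ^ 2) + a * (⟪r, z - y⟫ + ε / 2 * ‖z - y‖ ^ 2) +
            a ^ 2 * ‖r‖ ^ 2 / (2 * ε) - ε / 2 * (a * (1 - a) * ‖v - y‖ ^ 2) := by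
        field_simp; ring
      rw [e3, pow_succ (1 - a)]
      have h5 : 0 ≤ ε / 2 * (a * (1 - a) * ‖v - y‖ ^ 2) := by positivity
      nlinarith

/-- Linear convergence of CG as long as no small curvature is met. -/
lemma cg_residual_le {A : V →ₗ[ℝ] V} (hA : A.IsSymmetric) {g : V} {j : ℕ} {L ε a : ℝ}
    (hL : 0 < L) (hε : 0 < ε) (ha : 0 ≤ a) (ha1 : a ≤ 1) (haL : a ^ 2 * L ≤ ε) (hj : 1 ≤ j)
    (h : CGRegular A g (j + 1)) (hLr : ∀ i ≤ j, ‖A (cgR A g i)‖ ≤ L * ‖cgR A g i‖)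
    (hz : ∀ i < j, ε * ‖cgY A g (j + 1) - cgY A g i‖ ^ 2 ≤
      ⟪cgY A g (j + 1) - cgY A g i, A (cgY A g (j + 1) - cgY A g i)⟫) :
    ‖cgR A g j‖ ^ 2 ≤ 2 * (L / ε) * (1 - a) ^ j * ‖g‖ ^ 2 := by
  -- With the next iterate as comparison point, the gain `‖r_j‖² / (2L)` of the last step is itself
  -- bounded by the potential.
  set z := cgY A g (j + 1) with hzdef
  obtain ⟨v, -, hE⟩ := cg_potential hA hL hε ha ha1 haL (h.mono (Nat.le_succ j))
    (fun i hi => hLr i hi.le) hz j le_rfl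
  have hdec := cgQuad_succ_le hA hL h (hLr j le_rfl)
  -- Orthogonality gives `⟨z, A z⟩ = -⟨g, z⟩`. With the curvature bound at `y_0 = 0` this yields
  -- `ε‖z‖ ≤ ‖g‖`, which bounds the initial potential by `‖g‖²/ε`.
  have horth := (cg_orthogonal hA g (j + 1) h).1 z (cgY_mem_cgSpan A g (j + 1))
  rw [cgR_eq, ← hzdef, inner_add_left] at horth
  have hcomm : ⟪A z, z⟫ = ⟪z, A z⟫ := hA z z
  have h0 := hz 0 (by omega)
  rw [cgY_zero, sub_zero] at h0
  have hgz : -⟪g, z⟫ ≤ ‖g‖ * ‖z‖ := by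
    have := real_inner_le_norm (-g) z
    rwa [inner_neg_left, norm_neg] at this
  have hzn : ε * ‖z‖ ≤ ‖g‖ := by
    rcases eq_or_lt_of_le (norm_nonneg z) with h0' | hpos
    · rw [← h0']; simp
    · have : ε * ‖z‖ * ‖z‖ ≤ ‖g‖ * ‖z‖ := by nlinarith
      exact le_of_mul_le_mul_right this hpos
  have hB : ε / 2 * ‖z‖ ^ 2 - cgQuad A g z ≤ ‖g‖ ^ 2 / ε := by
    rw [le_div_iff₀ hε]
    have : ε / 2 * ‖z‖ ^ 2 - cgQuad A g z ≤ ‖g‖ * ‖z‖ := by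
      rw [cgQuad]; nlinarith
    nlinarith [norm_nonneg g]
  have h6 : ‖cgR A g j‖ ^ 2 / (2 * L) ≤ (1 - a) ^ j * (‖g‖ ^ 2 / ε) := by
    have : 0 ≤ (1 - a) ^ j := pow_nonneg (by linarith) _
    have := mul_le_mul_of_nonneg_left hB this
    have : 0 ≤ ε / 2 * ‖z - v‖ ^ 2 := by positivity
    linarith
  rw [div_le_iff₀ (by positivity)] at h6
  refine h6.trans_eq ?_
  field_simp

/-! The estimate `M` of the norm -/

lemma le_bump (H : V →ₗ[ℝ] V) (v : V) (M : ℝ) : M ≤ bump H v M := by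
  unfold bump
  split_ifs with h
  · rcases eq_or_ne v 0 with rfl | hv
    · simp at h
    · rw [le_div_iff₀ (norm_pos_iff.2 hv)]; exact h.le
  · exact le_rfl

lemma norm_le_bump (H : V →ₗ[ℝ] V) (v : V) (M : ℝ) : ‖H v‖ ≤ bump H v M * ‖v‖ := by
  unfold bump
  split_ifs with h
  · rcases eq_or_ne v 0 with rfl | hv
    · simp
    · rw [div_mul_cancel₀ _ (norm_ne_zero_iff.2 hv)]
  · exact not_lt.1 h

lemma cgM_mono (H : V →ₗ[ℝ] V) (μ : ℝ) (g : V) (M : ℝ) : Monotone (cgM H μ g M) :=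
  monotone_nat_of_le_succ fun j => by
    rw [cgM.eq_def H μ g M (j + 1)]
    exact (le_bump H _ _).trans ((le_bump H _ _).trans (le_bump H _ _))

lemma le_cgM (H : V →ₗ[ℝ] V) (μ : ℝ) (g : V) (M : ℝ) (j : ℕ) : M ≤ cgM H μ g M j :=
  (le_bump H _ _).trans (cgM_mono H μ g M (Nat.zero_le j))

lemma norm_cgY_le (H : V →ₗ[ℝ] V) (μ : ℝ) (g : V) (M : ℝ) (j : ℕ) :
    ‖H (cgY (shifted H μ) g j)‖ ≤ cgM H μ g M j * ‖cgY (shifted H μ) g j‖ := by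
  cases j with
  | zero => simp [cgY_zero]
  | succ j =>
    refine (norm_le_bump H _ (bump H (cgP (shifted H μ) g (j + 1)) (cgM H μ g M j))).trans ?_
    gcongr
    exact le_bump H _ _

lemma norm_cgR_le (H : V →ₗ[ℝ] V) (μ : ℝ) (g : V) (M : ℝ) (j : ℕ) :
    ‖H (cgR (shifted H μ) g j)‖ ≤ cgM H μ g M j * ‖cgR (shifted H μ) g j‖ := by
  cases j with
  | zero =>
    -- Since `p_0 = -r_0`, the update at `p_0` already covers `r_0`.
    have := norm_le_bump H (cgP (shifted H μ) g 0) M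
    rw [cgP_zero, map_neg, norm_neg, norm_neg] at this
    rw [cgR_zero]
    exact this
  | succ j => exact norm_le_bump H _ _

lemma norm_shifted_le (H : V →ₗ[ℝ] V) {μ M : ℝ} (hμ : 0 ≤ μ) {v : V} (h : ‖H v‖ ≤ M * ‖v‖) :
    ‖shifted H μ v‖ ≤ (M + μ) * ‖v‖ := by
  simp only [shifted, LinearMap.add_apply, LinearMap.smul_apply, LinearMap.id_apply]
  refine (norm_add_le _ _).trans ?_
  rw [norm_smul, Real.norm_of_nonneg hμ, add_mul]
  gcongr

lemma inner_shifted (H : V →ₗ[ℝ] V) (μ : ℝ) (v : V) :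
    ⟪v, shifted H μ v⟫ = ⟪v, H v⟫ + μ * ‖v‖ ^ 2 := by
  simp [shifted, inner_add_right, inner_smul_right]

lemma isSymmetric_shifted {H : V →ₗ[ℝ] V} (hH : H.IsSymmetric) (μ : ℝ) :
    (shifted H μ).IsSymmetric := by
  intro x y
  simp [shifted, inner_add_left, inner_add_right, inner_smul_left, inner_smul_right, hH x y]

/-! ### Termination and output of Capped CG -/

/-- CG does not break down as long as no termination test succeeds. -/
lemma cgRegular_of_not_done {H : V →ₗ[ℝ] V} (hH : H.IsSymmetric) {μ ε ζ M : ℝ} {g : V}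
    (hg : g ≠ 0) (hε : 0 < ε) (hμ : 0 ≤ μ) (hζ : 0 ≤ ζ) (hM : 0 ≤ M) {j : ℕ}
    (h : ∀ i < j, ¬ CGDone H μ g ε ζ M i) : CGRegular (shifted H μ) g j := by
  induction j with
  | zero => intro i hi; exact absurd hi (Nat.not_lt_zero i)
  | succ j ih =>
    have hreg := ih fun i hi => h i (hi.trans (Nat.lt_succ_self j))
    intro i hi
    rcases Nat.lt_succ_iff_lt_or_eq.1 hi with hi | rfl
    · exact hreg i hi
    have hd := h i hi
    simp only [CGDone, not_or, not_and] at hd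
    have hr : cgR (shifted H μ) g i ≠ 0 := by
      rcases Nat.eq_zero_or_pos i with rfl | hpos
      · exact hg
      · intro h0
        -- A zero residual would have passed the SOL test; in pass `0`, which lacks that test, the
        -- residual is `g ≠ 0`.
        refine (hd.2 hpos).2.1 ?_
        rw [CGSolved, h0, norm_zero]
        have : 0 ≤ cgM H μ g M i := hM.trans (le_cgM H μ g M i)
        unfold cgZeta cgKappa
        positivity
    have hp := cgP_ne_zero (isSymmetric_shifted hH μ) hreg hr
    refine ⟨hr, ?_⟩
    have := hd.1
    rw [SmallCurvature, not_lt] at this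
    exact lt_of_lt_of_le (by positivity) this

/-- The residuals are orthogonal, so that a termination test succeeds eventually. -/
lemma exists_cgDone [FiniteDimensional ℝ V] {H : V →ₗ[ℝ] V} (hH : H.IsSymmetric) {μ ε ζ M : ℝ}
    {g : V} (hg : g ≠ 0) (hε : 0 < ε) (hμ : 0 ≤ μ) (hζ : 0 ≤ ζ) (hM : 0 ≤ M) :
    ∃ j, CGDone H μ g ε ζ M j := by
  by_contra! hcon
  have hreg : ∀ j, CGRegular (shifted H μ) g j := fun j =>
    cgRegular_of_not_done hH hg hε hμ hζ hM fun i _ => hcon i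
  have horth : ∀ i j, i < j → ⟪cgR (shifted H μ) g j, cgR (shifted H μ) g i⟫ = 0 := fun i j hij =>
    (cg_orthogonal (isSymmetric_shifted hH μ) g j (hreg j)).1 _
      (cgSpan_mono _ g hij (cgR_mem_cgSpan _ g i))
  have hli : LinearIndependent ℝ (cgR (shifted H μ) g) := by
    refine linearIndependent_of_ne_zero_of_inner_eq_zero
      (fun j => (hreg (j + 1) j (Nat.lt_succ_self j)).1) fun i j hij => ?_
    rcases lt_or_gt_of_ne hij with h | h
    · change ⟪_, _⟫ = 0
      rw [real_inner_comm]; exact horth i j h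
    · exact horth j i h
  have := hli.finite
  exact not_finite ℕ

/-- Some earlier iterate reveals small curvature if CG converges slowly. -/
lemma exists_smallCurvature_of_slow {H : V →ₗ[ℝ] V} (hH : H.IsSymmetric) {μ ε M : ℝ} {g : V}
    (hε : 0 < ε) (hμ : ε ≤ μ) (hM : 0 ≤ M) {j : ℕ} (hj : 1 ≤ j)
    (hreg : CGRegular (shifted H μ) g (j + 1)) (hs : CGSlow H μ g ε M j) :
    ∃ i < j, SmallCurvature (shifted H μ) ε
      (cgY (shifted H μ) g (j + 1) - cgY (shifted H μ) g i) := by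
  by_contra! hcon
  have hμ0 : 0 ≤ μ := hε.le.trans hμ
  set A := shifted H μ with hAdef
  have hA : A.IsSymmetric := isSymmetric_shifted hH μ
  set Mj := cgM H μ g M j with hMj
  have hMj0 : 0 ≤ Mj := hM.trans (le_cgM H μ g M j)
  set κ := cgKappa μ ε Mj with hκ
  have hκ1 : 1 ≤ κ := by
    rw [hκ, cgKappa, le_div_iff₀ hε]; linarith
  have hL : 0 < Mj + μ := by linarith
  have hsq : 1 ≤ √κ := Real.one_le_sqrt.2 hκ1
  have hsq2 : √κ ^ 2 = κ := Real.sq_sqrt (by linarith)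
  have htau0 : 0 ≤ cgTau κ := by unfold cgTau; positivity
  have htau1 : cgTau κ < 1 := by
    unfold cgTau; rw [div_lt_one (by positivity)]; linarith
  have hae : 1 - cgTau κ = 1 / (√κ + 1) := by
    unfold cgTau; field_simp; ring
  -- Here `a = 1/(√κ + 1)` and `L = M_j + μ = κε`, so `a² L ≤ ε`. The estimate `M` only grows, so
  -- `M_j` also serves the earlier residuals.
  have hle := cg_residual_le (a := 1 - cgTau κ) hA hL hε (by linarith) (by linarith) (by
      have e : Mj + μ = √κ ^ 2 * ε := by rw [hsq2, hκ, cgKappa]; field_simp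
      rw [hae, e, ← mul_assoc, ← mul_pow]
      have : (1 / (√κ + 1) * √κ) ^ 2 ≤ 1 := by
        apply pow_le_one₀ (by positivity)
        rw [one_div, inv_mul_le_iff₀ (by positivity)]; linarith
      nlinarith) hj hreg (fun i hi => norm_shifted_le H hμ0 ((norm_cgR_le H μ g M i).trans (by
        gcongr; exact cgM_mono H μ g M hi))) (fun i hi => not_lt.1 (hcon i hi))
  rw [sub_sub_cancel] at hle
  change _ ≤ 2 * κ * _ * _ at hle
  -- The convergence bound has the factor `2κ`, which `T` dominates because `κ ≥ 1` and `(1 - √τ)² ≤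
  -- 1`; squaring the slowness test then contradicts it.
  have hT : 2 * κ ≤ cgT κ := by
    have hst : √(cgTau κ) < 1 := by rw [Real.sqrt_lt' one_pos]; simpa using htau1
    have hst0 := Real.sqrt_nonneg (cgTau κ)
    have h1 : 0 < (1 - √(cgTau κ)) ^ 2 := pow_pos (by linarith) 2
    have h2 : (1 - √(cgTau κ)) ^ 2 ≤ 1 := pow_le_one₀ (by linarith) (by linarith)
    unfold cgT
    rw [le_div_iff₀ h1]
    have h3 : κ ≤ κ ^ 4 := le_self_pow₀ hκ1 (by norm_num)
    nlinarith
  rw [CGSlow, ← hMj, ← hκ, cgR_zero] at hs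
  have hsq' := pow_lt_pow_left₀ hs (by positivity) two_ne_zero
  rw [mul_pow, mul_pow, Real.sq_sqrt (by linarith), ← Real.rpow_natCast (_ ^ _),
    ← Real.rpow_mul htau0] at hsq'
  have e : (j : ℝ) / 2 * ((2 : ℕ) : ℝ) = (j : ℕ) := by push_cast; ring
  rw [e, Real.rpow_natCast] at hsq'
  have : 2 * κ * cgTau κ ^ j * ‖g‖ ^ 2 ≤ cgT κ * cgTau κ ^ j * ‖g‖ ^ 2 := by gcongr
  linarith

/-- Capped CG returns a result. -/
lemma exists_cappedCGReturns [FiniteDimensional ℝ V] {H : V →ₗ[ℝ] V} (hH : H.IsSymmetric)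
    {μ ε ζ M : ℝ} {g : V} (hg : g ≠ 0) (hε : 0 < ε) (hμ : ε ≤ μ) (hζ : 0 ≤ ζ) (hM : 0 ≤ M) :
    ∃ d c, CappedCGReturns H μ g ε ζ M d c := by
  classical
  have hμ0 : 0 ≤ μ := hε.le.trans hμ
  have hex := exists_cgDone (μ := μ) (ζ := ζ) hH hg hε hμ0 hζ hM
  set j := Nat.find hex with hjdef
  have hdone : CGDone H μ g ε ζ M j := Nat.find_spec hex
  have hprev : ∀ i < j, ¬ CGDone H μ g ε ζ M i := fun i hi => Nat.find_min hex hi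
  rcases Nat.eq_zero_or_pos j with h0 | hpos
  · rw [h0] at hdone
    rcases hdone with h | ⟨h, -⟩
    · exact ⟨_, _, .nc_zero h⟩
    · exact absurd h (by norm_num)
  by_cases hy : SmallCurvature (shifted H μ) ε (cgY (shifted H μ) g j)
  · exact ⟨_, _, .nc_y j hpos hprev hy⟩
  by_cases hs : CGSolved H μ g ε ζ M j
  · exact ⟨_, _, .sol j hpos hprev hy hs⟩
  by_cases hp : SmallCurvature (shifted H μ) ε (cgP (shifted H μ) g j)
  · exact ⟨_, _, .nc_p j hpos hprev hy hs hp⟩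
  have ht : CGSlow H μ g ε M j := by
    rcases hdone with h | ⟨-, h | h | h⟩
    · exact absurd h hp
    · exact absurd h hy
    · exact absurd h hs
    · exact h
  have hreg := cgRegular_of_not_done hH hg hε hμ0 hζ hM hprev
  have hr : cgR (shifted H μ) g j ≠ 0 := by
    intro h0
    refine hs ?_
    rw [CGSolved, h0, norm_zero]
    have : 0 ≤ cgM H μ g M j := hM.trans (le_cgM H μ g M j)
    unfold cgZeta cgKappa
    positivity
  -- The step from `y_j` to `y_{j+1}` is also regular, because the tests on `r_j` and `p_j` have
  -- failed.
  have hreg' : CGRegular (shifted H μ) g (j + 1) := by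
    intro i hi
    rcases Nat.lt_succ_iff_lt_or_eq.1 hi with hi | rfl
    · exact hreg i hi
    · have := cgP_ne_zero (isSymmetric_shifted hH μ) hreg hr
      exact ⟨hr, lt_of_lt_of_le (by positivity) (not_lt.1 hp)⟩
  obtain ⟨i, hi, hc⟩ := exists_smallCurvature_of_slow hH hε hμ hM hpos hreg' ht
  exact ⟨_, _, .slow j hpos hprev hy hs hp ht i hi hc⟩

lemma CappedCGReturns.smallCurvature {H : V →ₗ[ℝ] V} {μ ε ζ M : ℝ} {g d : V}
    (h : CappedCGReturns H μ g ε ζ M d .nc) : SmallCurvature (shifted H μ) ε d := by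
  cases h <;> assumption

/-- A direction of type `SOL` has curvature at least `ε` and a small residual. -/
lemma CappedCGReturns.sol_properties {H : V →ₗ[ℝ] V} {μ ε ζ M : ℝ} {g d : V}
    (h : CappedCGReturns H μ g ε ζ M d .sol) (hg : g ≠ 0) (hε : 0 < ε) (hμ : 2 * ε ≤ μ)
    (hζ : 0 ≤ ζ) (hζ1 : ζ ≤ 1) (hM : 0 ≤ M) :
    d ≠ 0 ∧ ε * ‖d‖ ^ 2 ≤ ⟪d, H d⟫ + μ * ‖d‖ ^ 2 ∧ ‖H d + μ • d + g‖ ≤ ζ / 2 * ε * ‖d‖ := by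
  cases h with
  | sol j hj hprev hy hs =>
    set y := cgY (shifted H μ) g j with hydef
    have hMj0 : 0 ≤ cgM H μ g M j := hM.trans (le_cgM H μ g M j)
    set Mj := cgM H μ g M j with hMj
    have hres : cgR (shifted H μ) g j = H y + μ • y + g := by
      rw [cgR_eq]; simp [shifted, hydef]
    -- The shift `μ ≥ 2ε` forces `κ ≥ 2`, hence `ζ̂ ≤ 1/6`. This rules out `d = 0` and lets the
    -- residual be absorbed below.
    have hκ : 2 ≤ cgKappa μ ε Mj := by
      rw [cgKappa, le_div_iff₀ hε]; linarith
    have hzh : cgZeta ζ (cgKappa μ ε Mj) ≤ 1 / 6 := by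
      rw [cgZeta, div_le_iff₀ (by positivity)]; linarith
    have hzh0 : 0 ≤ cgZeta ζ (cgKappa μ ε Mj) := by unfold cgZeta; positivity
    rw [CGSolved, hres, cgR_zero, ← hMj] at hs
    have hzl : cgZeta ζ (cgKappa μ ε Mj) * (Mj + μ) = ζ / 3 * ε := by
      have : 0 < Mj + μ := by linarith
      rw [cgZeta, cgKappa]; field_simp
    have hHy : ‖H y + μ • y‖ ≤ (Mj + μ) * ‖y‖ := by
      exact norm_shifted_le H (by linarith : 0 ≤ μ) (norm_cgY_le H μ g M j)
    refine ⟨?_, ?_, ?_⟩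
    · intro h0
      rw [h0] at hs
      simp only [map_zero, smul_zero, zero_add] at hs
      have : 0 < ‖g‖ := norm_pos_iff.2 hg
      nlinarith
    · rw [SmallCurvature, not_lt, inner_shifted] at hy
      exact hy
    · set r := H y + μ • y + g with hr
      have hgn : ‖g‖ ≤ ‖r‖ + (Mj + μ) * ‖y‖ := by
        have : g = r - (H y + μ • y) := by rw [hr]; abel
        rw [this]
        exact (norm_sub_le _ _).trans (by gcongr)
      -- Replacing `‖g‖` by `‖r‖ + (M_j + μ)‖y‖` costs a factor `6/5`: the result `2ζε‖y‖/5` is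
      -- below `ζε‖y‖/2`.
      have h1 : ‖r‖ ≤ 1 / 6 * ‖r‖ + ζ / 3 * ε * ‖y‖ := by
        calc ‖r‖ ≤ cgZeta ζ (cgKappa μ ε Mj) * ‖g‖ := hs
          _ ≤ cgZeta ζ (cgKappa μ ε Mj) * (‖r‖ + (Mj + μ) * ‖y‖) := by gcongr
          _ = cgZeta ζ (cgKappa μ ε Mj) * ‖r‖ + ζ / 3 * ε * ‖y‖ := by rw [← hzl]; ring
          _ ≤ _ := by gcongr
      have : 0 ≤ ζ * ε * ‖y‖ := by positivity
      linarith

end CappedCGTheory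

/-! ### Subvectors and principal submatrices -/

section Vectors

variable {n : ℕ}

lemma inner_eq_sum {ι : Type*} [Fintype ι] (x y : EuclideanSpace ℝ ι) :
    ⟪x, y⟫ = ∑ i, x i * y i := by
  rw [PiLp.inner_apply]
  exact Finset.sum_congr rfl fun i _ => by simp [mul_comm]

lemma abs_apply_le_norm {ι : Type*} [Fintype ι] (x : EuclideanSpace ℝ ι) (i : ι) :
    |x i| ≤ ‖x‖ := PiLp.norm_apply_le x i

lemma restrict_apply (J : Finset (Fin n)) (x : Vec n) (i : J) : restrict J x i = x i := rfl

lemma extend_apply (J : Finset (Fin n)) (z : EuclideanSpace ℝ J) (i : Fin n) :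
    extend J z i = if h : i ∈ J then z ⟨i, h⟩ else 0 := rfl

lemma extend_apply_of_notMem {J : Finset (Fin n)} (z : EuclideanSpace ℝ J) {i : Fin n}
    (h : i ∉ J) : extend J z i = 0 := by simp [extend_apply, h]

lemma diag_apply (s : Fin n → ℝ) (x : Vec n) (i : Fin n) : diag s x i = s i * x i := rfl

lemma restrict_extend (J : Finset (Fin n)) (z : EuclideanSpace ℝ J) :
    restrict J (extend J z) = z := by
  ext i; simp [restrict_apply, extend_apply]

lemma extend_restrict {J : Finset (Fin n)} {x : Vec n} (h : ∀ i ∉ J, x i = 0) :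
    extend J (restrict J x) = x := by
  ext i
  by_cases hi : i ∈ J
  · simp [extend_apply, restrict_apply, hi]
  · rw [extend_apply_of_notMem _ hi, h i hi]

lemma inner_restrict (J : Finset (Fin n)) (x : Vec n) (z : EuclideanSpace ℝ J) :
    ⟪restrict J x, z⟫ = ⟪x, extend J z⟫ := by
  rw [inner_eq_sum, inner_eq_sum, ← Finset.sum_subset (Finset.subset_univ J)
    (fun i _ hi => by rw [extend_apply_of_notMem _ hi, mul_zero]), ← Finset.sum_coe_sort J]
  exact Finset.sum_congr rfl fun i _ => by simp [restrict_apply, extend_apply]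

lemma inner_restrict' (J : Finset (Fin n)) (x : Vec n) (z : EuclideanSpace ℝ J) :
    ⟪z, restrict J x⟫ = ⟪extend J z, x⟫ := by
  rw [real_inner_comm, inner_restrict, real_inner_comm]

lemma norm_extend (J : Finset (Fin n)) (z : EuclideanSpace ℝ J) : ‖extend J z‖ = ‖z‖ := by
  rw [← sq_eq_sq₀ (norm_nonneg _) (norm_nonneg _), ← real_inner_self_eq_norm_sq,
    ← real_inner_self_eq_norm_sq, ← inner_restrict, restrict_extend]

lemma norm_sq_restrict (J : Finset (Fin n)) (x : Vec n) :
    ‖restrict J x‖ ^ 2 = ∑ i ∈ J, x i ^ 2 := by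
  rw [← real_inner_self_eq_norm_sq, inner_eq_sum, ← Finset.sum_coe_sort J]
  exact Finset.sum_congr rfl fun i _ => by rw [restrict_apply, sq]

lemma norm_restrict_le (J : Finset (Fin n)) (x : Vec n) : ‖restrict J x‖ ≤ ‖x‖ := by
  refine le_of_sq_le_sq ?_ (norm_nonneg _)
  rw [norm_sq_restrict, EuclideanSpace.norm_sq_eq]
  simp only [Real.norm_eq_abs, sq_abs]
  exact Finset.sum_le_sum_of_subset_of_nonneg (Finset.subset_univ _) fun _ _ _ => sq_nonneg _

lemma isSymmetric_principal (J : Finset (Fin n)) {A : Vec n →ₗ[ℝ] Vec n} (hA : A.IsSymmetric) :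
    (principal J A).IsSymmetric := by
  intro z w
  simp only [principal, LinearMap.comp_apply]
  rw [inner_restrict, inner_restrict', hA]

lemma inner_principal (J : Finset (Fin n)) (A : Vec n →ₗ[ℝ] Vec n) (z w : EuclideanSpace ℝ J) :
    ⟪z, principal J A w⟫ = ⟪extend J z, A (extend J w)⟫ := by
  simp only [principal, LinearMap.comp_apply]
  rw [inner_restrict']

/-- The scaled direction `S d`, for `d` vanishing off the support of `x`. -/
lemma extend_principal_diag (J : Finset (Fin n)) (s : Fin n → ℝ) (z : EuclideanSpace ℝ J) :
    extend J (principal J (diag s) z) = diag s (extend J z) := by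
  simp only [principal, LinearMap.comp_apply]
  exact extend_restrict fun i hi => by rw [diag_apply, extend_apply_of_notMem _ hi, mul_zero]

lemma inner_diag (s : Fin n → ℝ) (x y : Vec n) : ⟪x, diag s y⟫ = ⟪diag s x, y⟫ := by
  rw [inner_eq_sum, inner_eq_sum]
  exact Finset.sum_congr rfl fun i _ => by rw [diag_apply, diag_apply]; ring

lemma norm_diag_le {s : Fin n → ℝ} (hs : ∀ i, |s i| ≤ 1) (x : Vec n) : ‖diag s x‖ ≤ ‖x‖ := by
  refine le_of_sq_le_sq ?_ (norm_nonneg _)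
  rw [EuclideanSpace.norm_sq_eq, EuclideanSpace.norm_sq_eq]
  refine Finset.sum_le_sum fun i _ => ?_
  rw [diag_apply, norm_mul, mul_pow]
  have : ‖s i‖ ^ 2 ≤ 1 := pow_le_one₀ (norm_nonneg _) (hs i)
  nlinarith [sq_nonneg ‖x i‖]

lemma inner_scaledHessian (f : Vec n → ℝ) (εg : ℝ) (x : Vec n) (u : EuclideanSpace ℝ (supp x)) :
    ⟪u, scaledHessian f εg x u⟫ = ⟪scaling εg x (extend (supp x) u),
      hessian f x (scaling εg x (extend (supp x) u))⟫ := by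
  simp only [scaledHessian, LinearMap.comp_apply]
  rw [inner_principal]
  simp only [scaling]
  rw [inner_diag, ← extend_principal_diag, ← inner_restrict', restrict_extend, inner_principal]
  rfl

/-! ### Steps that keep the signs -/

/-- The move may reach zero but not cross it, and a zero coordinate cannot move. This is the source
of the linearity of `‖·‖₁` along steps. -/
lemma abs_add_of_abs_le {a e : ℝ} (h : |e| ≤ |a|) : |a + e| = |a| + Real.sign a * e := by
  rcases lt_trichotomy a 0 with ha | rfl | ha
  · rw [abs_of_neg ha, abs_le] at h
    rw [Real.sign_of_neg ha, abs_of_neg ha, abs_of_nonpos (by linarith)]; ring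
  · simp at h; simp [h]
  · rw [abs_of_pos ha, abs_le] at h
    rw [Real.sign_of_pos ha, abs_of_pos ha, abs_of_nonneg (by linarith)]; ring

/-- The slope of the objective at `x` in a direction `e` along which the signs are kept. -/
def dirSlope (f : Vec n → ℝ) (lam : ℝ) (x e : Vec n) : ℝ :=
  ⟪gradient f x, e⟫ + lam * ∑ i, Real.sign (x i) * e i

lemma dirSlope_smul (f : Vec n → ℝ) (lam : ℝ) (x e : Vec n) (a : ℝ) :
    dirSlope f lam x (a • e) = a * dirSlope f lam x e := by
  simp only [dirSlope, inner_smul_right, PiLp.smul_apply, smul_eq_mul, mul_left_comm _ a,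
    ← Finset.mul_sum]
  ring

lemma objective_add_of_abs_le (f : Vec n → ℝ) (lam : ℝ) {x e : Vec n} (h : ∀ i, |e i| ≤ |x i|) :
    objective f lam (x + e) =
      objective f lam x + (f (x + e) - f x - ⟪gradient f x, e⟫) + dirSlope f lam x e := by
  have : l1norm (x + e) = l1norm x + ∑ i, Real.sign (x i) * e i := by
    simp only [l1norm, PiLp.add_apply]
    rw [← Finset.sum_add_distrib]
    exact Finset.sum_congr rfl fun i _ => abs_add_of_abs_le (h i)
  simp only [objective, dirSlope, this]
  ring

/-! ### Reduced gradients as slopes of the objective -/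

lemma mem_largeSet {εg : ℝ} {x : Vec n} {i : Fin n} :
    i ∈ largeSet εg x ↔ εg ^ (1 / 2 : ℝ) < |x i| := by simp [largeSet]

lemma mem_smallSet {εg : ℝ} {x : Vec n} {i : Fin n} :
    i ∈ smallSet εg x ↔ |x i| ≤ εg ^ (1 / 2 : ℝ) := by simp [smallSet]

lemma mem_supp {x : Vec n} {i : Fin n} : i ∈ supp x ↔ x i ≠ 0 := by simp [supp]

lemma gEps_apply_of_large (f : Vec n → ℝ) (lam : ℝ) {εg : ℝ} (hε : 0 < εg) {x : Vec n}
    {i : Fin n} (hi : εg ^ (1 / 2 : ℝ) < |x i|) :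
    gEps f lam εg x i = gradient f x i + lam * Real.sign (x i) := by
  have h0 : 0 < εg ^ (1 / 2 : ℝ) := Real.rpow_pos_of_pos hε _
  simp only [gEps]
  rcases lt_abs.1 hi with h | h
  · rw [if_pos h, Real.sign_of_pos (h0.trans h), mul_one]
  · rw [if_neg (by linarith), if_pos (by linarith), Real.sign_of_neg (by linarith)]; ring

lemma gVec_apply_of_ne (f : Vec n → ℝ) (lam : ℝ) {x : Vec n} {i : Fin n} (hi : x i ≠ 0) :
    gVec f lam x i = gradient f x i + lam * Real.sign (x i) := by
  simp only [gVec]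
  rcases lt_or_gt_of_ne hi with h | h
  · rw [if_neg h.le.not_gt, if_pos h, Real.sign_of_neg h]; ring
  · rw [if_pos h, Real.sign_of_pos h, mul_one]

/-- Only the coordinates that move matter. Thus `g^ε` and `g`, which differ elsewhere, produce the
same kind of slope. -/
lemma inner_eq_dirSlope (f : Vec n → ℝ) (lam : ℝ) {x e G : Vec n}
    (h : ∀ i, e i ≠ 0 → G i = gradient f x i + lam * Real.sign (x i)) :
    ⟪G, e⟫ = dirSlope f lam x e := by
  rw [dirSlope, inner_eq_sum, inner_eq_sum, Finset.mul_sum, ← Finset.sum_add_distrib]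
  refine Finset.sum_congr rfl fun i _ => ?_
  by_cases hi : e i = 0
  · simp [hi]
  · rw [h i hi]; ring

lemma inner_redGrad (P : Params) (f : Vec n → ℝ) (lam : ℝ) (x : Vec n)
    (d : EuclideanSpace ℝ (largeSet P.εg x)) :
    ⟪redGrad P f lam x, d⟫ = dirSlope f lam x (extend (largeSet P.εg x) d) := by
  rw [redGrad, inner_restrict]
  refine inner_eq_dirSlope f lam fun i hi => gEps_apply_of_large f lam P.εg_mem.1 ?_
  by_contra h
  exact hi (extend_apply_of_notMem _ (mt mem_largeSet.1 h))

lemma inner_gVec (f : Vec n → ℝ) (lam εg : ℝ) (x : Vec n) (u : EuclideanSpace ℝ (supp x)) :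
    ⟪restrict (supp x) (gVec f lam x), principal (supp x) (scaling εg x) u⟫ =
      dirSlope f lam x (scaling εg x (extend (supp x) u)) := by
  rw [inner_restrict, scaling, extend_principal_diag]
  refine inner_eq_dirSlope f lam fun i hi => gVec_apply_of_ne f lam ?_
  rw [diag_apply] at hi
  by_contra h
  exact hi (by rw [extend_apply_of_notMem _ (by simpa [mem_supp] using h), mul_zero])

/-! ### The proximal mapping of the `ℓ₁` norm -/

/-- Soft thresholding. -/
def soft (a w : ℝ) : ℝ := max (w - a) 0 - max (-w - a) 0

/-- The extra square on the left is strong convexity. It gives both uniqueness of the minimizer and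
the sharp descent inequality of the proximal step. -/
lemma soft_optimal {a : ℝ} (ha : 0 ≤ a) (w y : ℝ) :
    a * |soft a w| + 1 / 2 * (soft a w - w) ^ 2 + 1 / 2 * (y - soft a w) ^ 2 ≤
      a * |y| + 1 / 2 * (y - w) ^ 2 := by
  have h1 := mul_le_mul_of_nonneg_left (le_abs_self y) ha
  have h2 := mul_le_mul_of_nonneg_left (neg_abs_le y) ha
  unfold soft
  rcases le_total (w - a) 0 with h | h <;> rcases le_total (-w - a) 0 with h' | h'
  · rw [max_eq_right h, max_eq_right h']
    rcases le_total 0 y with hy | hy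
    · simp only [sub_zero, abs_zero, abs_of_nonneg hy]; nlinarith
    · simp only [sub_zero, abs_zero, abs_of_nonpos hy]; nlinarith
  · rw [max_eq_right h, max_eq_left h', zero_sub, abs_neg, abs_of_nonneg h']; nlinarith
  · rw [max_eq_left h, max_eq_right h', sub_zero, abs_of_nonneg h]; nlinarith
  · have ha0 : a = 0 := by linarith
    subst ha0
    rw [max_eq_left h, max_eq_left h']
    have : w = 0 := by linarith
    subst this; simp

/-- Coordinatewise soft thresholding. -/
def softVec (a : ℝ) (w : Vec n) : Vec n := WithLp.toLp 2 fun i => soft a (w i)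

lemma softVec_apply (a : ℝ) (w : Vec n) (i : Fin n) : softVec a w i = soft a (w i) := rfl

lemma softVec_optimal {a : ℝ} (ha : 0 ≤ a) (w y : Vec n) :
    a * l1norm (softVec a w) + 1 / 2 * ‖softVec a w - w‖ ^ 2 + 1 / 2 * ‖y - softVec a w‖ ^ 2 ≤
      a * l1norm y + 1 / 2 * ‖y - w‖ ^ 2 := by
  simp only [l1norm, EuclideanSpace.norm_sq_eq, Finset.mul_sum, ← Finset.sum_add_distrib,
    PiLp.sub_apply, Real.norm_eq_abs, sq_abs]
  exact Finset.sum_le_sum fun i _ => soft_optimal ha (w i) (y i)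

/-- Since `prox` chooses an arbitrary minimizer, uniqueness is needed to identify the choice. -/
lemma prox_l1norm {a : ℝ} (ha : 0 ≤ a) (w : Vec n) :
    prox (fun y => a * l1norm y) w = softVec a w := by
  have hmin : IsMinOn (fun y : Vec n => a * l1norm y + 1 / 2 * ‖y - w‖ ^ 2) Set.univ
      (softVec a w) := by
    intro y _
    have := softVec_optimal ha w y
    have h0 := sq_nonneg ‖y - softVec a w‖
    simp only [Set.mem_ofPred_eq]
    linarith
  have hp : IsMinOn (fun y : Vec n => a * l1norm y + 1 / 2 * ‖y - w‖ ^ 2) Set.univ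
      (prox (fun y => a * l1norm y) w) :=
    Classical.epsilon_spec (p := fun p => IsMinOn (fun y : Vec n => a * l1norm y +
      1 / 2 * ‖y - w‖ ^ 2) Set.univ p) ⟨_, hmin⟩
  have h1 := hp (Set.mem_univ (softVec a w))
  have h2 := softVec_optimal ha w (prox (fun y => a * l1norm y) w)
  simp only [Set.mem_ofPred_eq] at h1
  have : ‖prox (fun y => a * l1norm y) w - softVec a w‖ ^ 2 ≤ 0 := by linarith
  have h3 := pow_eq_zero_iff (two_ne_zero) |>.1 (le_antisymm this (sq_nonneg _))
  exact sub_eq_zero.1 (norm_eq_zero.1 h3)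

lemma proxPoint_eq (f : Vec n → ℝ) {lam : ℝ} (hlam : 0 < lam) (x : Vec n) {t : ℝ} (ht : 0 < t) :
    proxPoint f lam x t = softVec (t⁻¹ * lam) (x - t⁻¹ • gradient f x) := by
  rw [proxPoint, prox_l1norm (by positivity)]
  congr 1
  · field_simp
  · rw [one_div]

/-- Strong convexity tested at `x`, multiplied by `t`; it supplies the full `t‖p - x‖²` rather than
half of it. -/
lemma proxPoint_optimal (f : Vec n → ℝ) {lam : ℝ} (hlam : 0 < lam) (x : Vec n) {t : ℝ}
    (ht : 0 < t) :
    ⟪gradient f x, proxPoint f lam x t - x⟫ + lam * l1norm (proxPoint f lam x t) +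
      t * ‖proxPoint f lam x t - x‖ ^ 2 ≤ lam * l1norm x := by
  have h := softVec_optimal (a := t⁻¹ * lam) (by positivity) (x - t⁻¹ • gradient f x) x
  rw [← proxPoint_eq f hlam x ht] at h
  set p := proxPoint f lam x t
  have e1 : p - (x - t⁻¹ • gradient f x) = (p - x) + t⁻¹ • gradient f x := by abel
  rw [e1, sub_sub_cancel, norm_add_sq_real, inner_smul_right, norm_sub_rev x p,
    real_inner_comm] at h
  have := mul_le_mul_of_nonneg_left h ht.le
  have e2 : t * (t⁻¹ * lam * l1norm p + 1 / 2 * (‖p - x‖ ^ 2 + 2 * (t⁻¹ * ⟪gradient f x, p - x⟫) +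
      ‖t⁻¹ • gradient f x‖ ^ 2) + 1 / 2 * ‖p - x‖ ^ 2) = lam * l1norm p + t * ‖p - x‖ ^ 2 +
        ⟪gradient f x, p - x⟫ + t / 2 * ‖t⁻¹ • gradient f x‖ ^ 2 := by
    field_simp; ring
  have e3 : t * (t⁻¹ * lam * l1norm x + 1 / 2 * ‖t⁻¹ • gradient f x‖ ^ 2) =
      lam * l1norm x + t / 2 * ‖t⁻¹ • gradient f x‖ ^ 2 := by
    field_simp
  rw [e2, e3] at this
  linarith

/-- Thresholding removes at most `lam` from the gradient component. If the point lands on zero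
instead, it was already far enough from zero on the descent side. -/
lemma soft_step_lower {lam a gi xi t : ℝ} (ht : 0 < t) (hlam : 0 < lam) (hg : lam + a < |gi|)
    (ha : 0 < a) : a < |t * (xi - soft (t⁻¹ * lam) (xi - t⁻¹ * gi))| := by
  have hc : ∀ b c : ℝ, t * (xi - (xi - t⁻¹ * b - t⁻¹ * c)) = b + c := fun b c => by
    field_simp; ring
  have key : ∀ b : ℝ, lam + a < b → ∀ y : ℝ,
      a < |t * (y - (max (y - t⁻¹ * b - t⁻¹ * lam) 0 - max (-(y - t⁻¹ * b) - t⁻¹ * lam) 0))| := by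
    intro b hb y
    have hlt : t⁻¹ * lam ≤ t⁻¹ * b := by gcongr; linarith
    have h0 : 0 < t⁻¹ * lam := by positivity
    have e : ∀ c : ℝ, t * (t⁻¹ * c) = c := fun c => by field_simp
    rcases le_total (y - t⁻¹ * b - t⁻¹ * lam) 0 with h | h <;>
      rcases le_total (-(y - t⁻¹ * b) - t⁻¹ * lam) 0 with h' | h'
    · rw [max_eq_right h, max_eq_right h', sub_zero, sub_zero]
      refine lt_of_lt_of_le ?_ (le_abs_self _)
      have : t * (t⁻¹ * b - t⁻¹ * lam) ≤ t * y := by gcongr; linarith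
      rw [mul_sub, e, e] at this; linarith
    · rw [max_eq_right h, max_eq_left h']
      refine lt_of_lt_of_le ?_ (le_abs_self _)
      have : y - (0 - (-(y - t⁻¹ * b) - t⁻¹ * lam)) = t⁻¹ * b - t⁻¹ * lam := by ring
      rw [this, mul_sub, e, e]; linarith
    · rw [max_eq_left h, max_eq_right h']
      refine lt_of_lt_of_le ?_ (le_abs_self _)
      have : y - (y - t⁻¹ * b - t⁻¹ * lam - 0) = t⁻¹ * b + t⁻¹ * lam := by ring
      rw [this, mul_add, e, e]; linarith
    · exfalso; linarith
  unfold soft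
  rcases lt_abs.1 hg with h | h
  · exact key gi h xi
  · have := key (-gi) h (-xi)
    rw [← abs_neg]
    refine this.trans_eq (congrArg _ ?_)
    have e1 : -xi - t⁻¹ * -gi = -(xi - t⁻¹ * gi) := by ring
    rw [e1, neg_neg]; ring

/-- In the case of the proximal gradient step, the gradient mapping is bounded below. -/
lemma ProxStage.norm_gradMap_sq {P : Params} {f : Vec n → ℝ} {lam : ℝ} (hlam : 0 < lam)
    {x : Vec n} (hx : ProxStage P f lam x) {t : ℝ} (ht : 0 < t) :
    P.εg ^ (3 / 2 : ℝ) < ‖gradMap f lam x t‖ ^ 2 := by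
  have hε := P.εg_mem.1
  obtain ⟨i, hi, hgi⟩ : ∃ i ∈ smallSet P.εg x, gEps f lam P.εg x i ≠ 0 := by
    by_contra! hcon
    refine hx.2 (norm_eq_zero.2 ?_)
    ext i
    exact hcon i i.2
  rw [mem_smallSet, abs_le] at hi
  have ha : 0 < P.εg ^ (3 / 4 : ℝ) := Real.rpow_pos_of_pos hε _
  simp only [gEps] at hgi
  rw [if_neg (by linarith), if_neg (by linarith)] at hgi
  -- A nonzero component of `g^ε` on the small set means that the clipping at `lam + ε_g^{3/4}` is
  -- active; squaring the excess gives the exponent `3/2`.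
  have hg : lam + P.εg ^ (3 / 4 : ℝ) < |gradient f x i| := by
    by_contra h
    rw [not_lt, abs_le] at h
    refine hgi ?_
    rw [max_eq_right (by linarith), min_eq_left (by linarith), sub_self]
  have h1 := soft_step_lower (xi := x i) ht hlam hg ha
  have h2 : |t * (x i - soft (t⁻¹ * lam) (x i - t⁻¹ * gradient f x i))| ≤ ‖gradMap f lam x t‖ := by
    have := abs_apply_le_norm (gradMap f lam x t) i
    rw [gradMap, proxPoint_eq f hlam x ht] at this ⊢
    exact this
  have h3 : P.εg ^ (3 / 2 : ℝ) = (P.εg ^ (3 / 4 : ℝ)) ^ 2 := by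
    rw [← Real.rpow_natCast, ← Real.rpow_mul hε.le]; norm_num
  rw [h3]
  exact pow_lt_pow_left₀ (h1.trans_le h2) ha.le two_ne_zero

end Vectors

/-! ### Taylor estimates -/

section Smoothness

variable {n : ℕ} {f : Vec n → ℝ} {U : Set (Vec n)}

lemma gradient_eq_toDual_symm (f : Vec n → ℝ) :
    gradient f = (InnerProductSpace.toDual ℝ (Vec n)).symm ∘ fderiv ℝ f := rfl

lemma hasGradientAt_of_contDiffOn (hU : IsOpen U) (hf : ContDiffOn ℝ 2 f U) {x : Vec n}
    (hx : x ∈ U) : HasGradientAt f (gradient f x) x :=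
  (((hf x hx).contDiffAt (hU.mem_nhds hx)).differentiableAt (by norm_num)).hasGradientAt

lemma hasFDerivAt_gradient (hU : IsOpen U) (hf : ContDiffOn ℝ 2 f U) {x : Vec n}
    (hx : x ∈ U) : HasFDerivAt (gradient f) (hessian f x) x := by
  have h : ContDiffAt ℝ 1 (fderiv ℝ f) x :=
    ((hf x hx).contDiffAt (hU.mem_nhds hx)).fderiv_right (by norm_num)
  have h2 : DifferentiableAt ℝ (gradient f) x := by
    rw [gradient_eq_toDual_symm]
    exact ((InnerProductSpace.toDual ℝ (Vec n)).symm.differentiable _).comp x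
      (h.differentiableAt (by norm_num))
  exact h2.hasFDerivAt

lemma inner_hessian (hU : IsOpen U) (hf : ContDiffOn ℝ 2 f U) {x : Vec n} (hx : x ∈ U)
    (v w : Vec n) : ⟪hessian f x v, w⟫ = fderiv ℝ (fderiv ℝ f) x v w := by
  have h : ContDiffAt ℝ 1 (fderiv ℝ f) x :=
    ((hf x hx).contDiffAt (hU.mem_nhds hx)).fderiv_right (by norm_num)
  have h1 := (hasFDerivAt_gradient hU hf hx).inner ℝ (hasFDerivAt_const w x)
  have h2 := (h.differentiableAt (by norm_num)).hasFDerivAt.clm_apply (hasFDerivAt_const w x)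
  have e : (fun y => ⟪gradient f y, w⟫) = fun y => fderiv ℝ f y w :=
    funext fun y => inner_gradient_left
  rw [e] at h1
  have := DFunLike.congr_fun (h1.unique h2) v
  simpa using this

lemma isSymmetric_hessian (hU : IsOpen U) (hf : ContDiffOn ℝ 2 f U) {x : Vec n} (hx : x ∈ U) :
    (hessian f x : Vec n →ₗ[ℝ] Vec n).IsSymmetric := by
  intro v w
  have hs : IsSymmSndFDerivAt ℝ f x :=
    ((hf x hx).contDiffAt (hU.mem_nhds hx)).isSymmSndFDerivAt (by simp)
  change ⟪hessian f x v, w⟫ = ⟪v, hessian f x w⟫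
  rw [real_inner_comm (hessian f x w) v, inner_hessian hU hf hx, inner_hessian hU hf hx, hs v w]

lemma norm_sub_le_of_mem_segment {x y w : Vec n} (hw : w ∈ segment ℝ x y) :
    ‖w - x‖ ≤ ‖y - x‖ := by
  obtain ⟨a, b, ha, hb, hab, rfl⟩ := hw
  have : a • x + b • y - x = b • (y - x) := by
    rw [← eq_sub_iff_add_eq] at hab; subst hab; module
  rw [this, norm_smul, Real.norm_of_nonneg hb]
  nlinarith [norm_nonneg (y - x)]

/-- The mean value inequality for `∇f` minus its linearization. The constant is not optimal, as this
estimate only serves qualitatively. -/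
lemma gradient_taylor_segment (hU : IsOpen U) (hf : ContDiffOn ℝ 2 f U) {C : ℝ≥0}
    (hC : LipschitzOnWith C (hessian f) U) {x y : Vec n} (hseg : segment ℝ x y ⊆ U) :
    ‖gradient f y - gradient f x - hessian f x (y - x)‖ ≤ C * ‖y - x‖ ^ 2 := by
  have hx := hseg (left_mem_segment ℝ x y)
  have key := Convex.norm_image_sub_le_of_norm_hasFDerivWithin_le (𝕜 := ℝ)
    (f := fun w => gradient f w - hessian f x w) (f' := fun w => hessian f w - hessian f x)
    (C := C * ‖y - x‖) (s := segment ℝ x y) (x := x) (y := y)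
    (fun w hw => ((hasFDerivAt_gradient hU hf (hseg hw)).sub
      (hessian f x).hasFDerivAt).hasFDerivWithinAt)
    (fun w hw => ?_) (convex_segment x y) (left_mem_segment ℝ x y) (right_mem_segment ℝ x y)
  · convert key using 1
    · rw [map_sub]; congr 1; abel
    · ring
  · rw [← dist_eq_norm]
    refine (hC.dist_le_mul w (hseg hw) x hx).trans ?_
    rw [dist_eq_norm]
    gcongr
    exact norm_sub_le_of_mem_segment hw

lemma taylor_segment (hU : IsOpen U) (hf : ContDiffOn ℝ 2 f U) {C : ℝ≥0}
    (hC : LipschitzOnWith C (hessian f) U) {x y : Vec n} (hseg : segment ℝ x y ⊆ U) :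
    f y ≤ f x + ⟪gradient f x, y - x⟫ + 1 / 2 * ⟪y - x, hessian f x (y - x)⟫ +
      C * ‖y - x‖ ^ 3 := by
  have hx := hseg (left_mem_segment ℝ x y)
  have hsymm := isSymmetric_hessian hU hf hx
  -- The derivative of `f` minus its quadratic model is the remainder bounded in
  -- `gradient_taylor_segment`; symmetry of the Hessian enters here.
  have hder : ∀ w ∈ segment ℝ x y, HasFDerivAt
      (fun w => f w - ⟪gradient f x, w - x⟫ - 1 / 2 * ⟪w - x, hessian f x (w - x)⟫)
      (InnerProductSpace.toDual ℝ (Vec n)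
        (gradient f w - gradient f x - hessian f x (w - x))) w := by
    intro w hw
    have h1 := (hasGradientAt_of_contDiffOn hU hf (hseg hw)).hasFDerivAt
    have h0 : HasFDerivAt (fun w : Vec n => w - x) (ContinuousLinearMap.id ℝ (Vec n)) w :=
      (hasFDerivAt_id w).sub_const x
    have h2 := (hasFDerivAt_const (gradient f x) w).inner ℝ h0
    have h3 := (h0.inner ℝ ((hessian f x).hasFDerivAt.comp w h0)).const_mul (1 / 2 : ℝ)
    refine ((h1.sub h2).sub h3).congr_fderiv ?_
    ext v
    have e1 : ⟪w - x, hessian f x v⟫ = ⟪hessian f x (w - x), v⟫ := (hsymm (w - x) v).symm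
    simp only [_root_.sub_apply, _root_.smul_apply,
      ContinuousLinearMap.comp_apply, ContinuousLinearMap.prod_apply, fderivInnerCLM_apply,
      _root_.zero_apply, ContinuousLinearMap.id_apply, inner_zero_left, add_zero,
      InnerProductSpace.toDual_apply_apply, Function.comp_apply, smul_eq_mul, e1, inner_sub_left,
      real_inner_comm (hessian f x (w - x)) v]
    ring
  have key := Convex.norm_image_sub_le_of_norm_hasFDerivWithin_le (𝕜 := ℝ)
    (C := C * ‖y - x‖ ^ 2) (s := segment ℝ x y) (x := x) (y := y)
    (fun w hw => (hder w hw).hasFDerivWithinAt)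
    (fun w hw => ?_) (convex_segment x y) (left_mem_segment ℝ x y) (right_mem_segment ℝ x y)
  · have := (le_abs_self _).trans key
    simp only [sub_self, inner_zero_right, mul_zero, sub_zero, map_zero] at this
    have e : C * ‖y - x‖ ^ 2 * ‖y - x‖ = C * ‖y - x‖ ^ 3 := by ring
    linarith
  · rw [LinearIsometryEquiv.norm_map]
    refine (gradient_taylor_segment hU hf hC (x := x) (y := w) ?_).trans ?_
    · exact ((convex_segment x y).segment_subset (left_mem_segment ℝ x y) hw).trans hseg
    · gcongr
      exact norm_sub_le_of_mem_segment hw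

lemma continuous_l1norm : Continuous (l1norm : Vec n → ℝ) := by
  unfold l1norm
  fun_prop

lemma continuous_objective (hf : Continuous f) (lam : ℝ) : Continuous (objective f lam) :=
  hf.add (continuous_const.mul continuous_l1norm)

lemma isClosed_levelSet (hf : Continuous f) (lam : ℝ) (x0 : Vec n) :
    IsClosed (levelSet f lam x0) :=
  isClosed_le (continuous_objective hf lam) continuous_const

/-- Taylor estimates near the points of the level set. -/
lemma ProblemAssumption.exists_local_taylor {lam : ℝ} {x0 : Vec n} (hf : Continuous f)
    (hA : ProblemAssumption f lam x0) : ∃ ρ > 0, ∃ C ≥ 0, ∀ x ∈ levelSet f lam x0, ∀ y,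
      ‖y - x‖ < ρ →
      ‖gradient f y - gradient f x - hessian f x (y - x)‖ ≤ C * ‖y - x‖ ^ 2 ∧
      f y ≤ f x + ⟪gradient f x, y - x⟫ + 1 / 2 * ⟪y - x, hessian f x (y - x)⟫ +
        C * ‖y - x‖ ^ 3 := by
  obtain ⟨U, hU, hLU, hfU, C, hC⟩ := hA.smooth
  have hcomp : IsCompact (levelSet f lam x0) :=
    Metric.isCompact_of_isClosed_isBounded (isClosed_levelSet hf lam x0) hA.bounded
  -- Compactness gives one radius for all points: segments shorter than `ρ` stay in `U`, although
  -- the level set need not be convex.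
  obtain ⟨ρ, hρ, hth⟩ := hcomp.exists_thickening_subset_open hU hLU
  refine ⟨ρ, hρ, C, C.2, fun x hx y hxy => ?_⟩
  have hseg : segment ℝ x y ⊆ U := by
    intro w hw
    refine hth (Metric.mem_thickening_iff.2 ⟨x, hx, ?_⟩)
    rw [dist_eq_norm]
    exact (norm_sub_le_of_mem_segment hw).trans_lt hxy
  exact ⟨gradient_taylor_segment hU hfU hC hseg, taylor_segment hU hfU hC hseg⟩

lemma ProblemAssumption.isSymmetric_hessian {lam : ℝ} {x0 x : Vec n}
    (hA : ProblemAssumption f lam x0) (hx : x ∈ levelSet f lam x0) :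
    (hessian f x : Vec n →ₗ[ℝ] Vec n).IsSymmetric := by
  obtain ⟨U, hU, hLU, hfU, -⟩ := hA.smooth
  exact PGN2CM.isSymmetric_hessian hU hfU (hLU hx)

lemma inner_hessian_le (x v : Vec n) : ⟪v, hessian f x v⟫ ≤ ‖hessian f x‖ * ‖v‖ ^ 2 := by
  refine (real_inner_le_norm _ _).trans ?_
  have := (hessian f x).le_opNorm v
  nlinarith [norm_nonneg v]

/-- Smoothness constants exist. -/
lemma ProblemAssumption.exists_smoothnessConstants {lam : ℝ} {x0 : Vec n} (hf : Continuous f)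
    (hA : ProblemAssumption f lam x0) : ∃ Lg LH, SmoothnessConstants f lam x0 Lg LH := by
  obtain ⟨ρ, hρ, C, hC0, hloc⟩ := hA.exists_local_taylor hf
  obtain ⟨U, hU, hLU, hfU, C', hC'⟩ := hA.smooth
  have hcomp : IsCompact (levelSet f lam x0) :=
    Metric.isCompact_of_isClosed_isBounded (isClosed_levelSet hf lam x0) hA.bounded
  obtain ⟨B0, hB0⟩ := hcomp.exists_bound_of_continuousOn hf.continuousOn
  obtain ⟨B1, hB1⟩ := hcomp.exists_bound_of_continuousOn (f := gradient f)
    fun x hx => (hasFDerivAt_gradient hU hfU (hLU hx)).continuousAt.continuousWithinAt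
  obtain ⟨B2, hB2⟩ := hcomp.exists_bound_of_continuousOn (hC'.continuousOn.mono hLU)
  have hx0 : x0 ∈ levelSet f lam x0 := le_refl (objective f lam x0)
  have h0 : 0 ≤ B0 := (norm_nonneg _).trans (hB0 x0 hx0)
  have h1 : 0 ≤ B1 := (norm_nonneg _).trans (hB1 x0 hx0)
  have h2 : 0 ≤ B2 := (norm_nonneg _).trans (hB2 x0 hx0)
  set q := ρ⁻¹ with hq
  have hq0 : 0 < q := inv_pos.2 hρ
  -- For distant pairs the segment may leave `U`. There all quantities are merely bounded, and
  -- factors `q d ≥ 1` raise them to the required power of the distance.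
  have hfar : ∀ d : ℝ, ¬ d < ρ → 1 ≤ q * d := fun d hd => by
    rw [hq, inv_mul_eq_div, one_le_div hρ]; exact not_lt.1 hd
  have hgr : ∀ x ∈ levelSet f lam x0, ∀ v : Vec n, -(B1 * ‖v‖) ≤ ⟪gradient f x, v⟫ := by
    intro x hx v
    have := (abs_le.1 (abs_real_inner_le_norm (gradient f x) v)).1
    have h := hB1 x hx
    nlinarith [norm_nonneg v]
  have hfb : ∀ x ∈ levelSet f lam x0, ∀ y ∈ levelSet f lam x0, f y - f x ≤ 2 * B0 := by
    intro x hx y hy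
    have h := hB0 x hx
    have h' := hB0 y hy
    rw [Real.norm_eq_abs, abs_le] at h h'
    linarith
  have hHn : ∀ x ∈ levelSet f lam x0, ∀ v : Vec n, ‖hessian f x v‖ ≤ B2 * ‖v‖ := by
    intro x hx v
    refine ((hessian f x).le_opNorm v).trans ?_
    gcongr
    exact hB2 x hx
  have hHq : ∀ x ∈ levelSet f lam x0, ∀ v : Vec n, |⟪v, hessian f x v⟫| ≤ B2 * ‖v‖ ^ 2 := by
    intro x hx v
    refine (abs_real_inner_le_norm _ _).trans ?_
    have := hHn x hx v
    nlinarith [norm_nonneg v]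
  refine ⟨2 * (B2 + C * ρ + 2 * B0 * q ^ 2 + B1 * q) + 1,
    6 * (C + B2 * q + 2 * B1 * q ^ 2 + 2 * B0 * q ^ 3) + 1, ?_, ?_, ?_, ?_, ?_, ?_⟩
  · positivity
  · positivity
  · intro x hx y hy L hL
    set d := ‖y - x‖ with hd
    have hd0 : 0 ≤ d := norm_nonneg _
    have hLd : (B2 + C * ρ + 2 * B0 * q ^ 2 + B1 * q) * d ^ 2 ≤ L / 2 * d ^ 2 := by
      gcongr; linarith
    by_cases hnear : d < ρ
    · have h := (hloc x hx y hnear).2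
      have hH := (abs_le.1 (hHq x hx (y - x))).2
      rw [← hd] at h hH
      have e : C * d ^ 3 ≤ C * ρ * d ^ 2 := by
        have : C * d ^ 3 = C * d * d ^ 2 := by ring
        rw [this]; gcongr
      have p1 : 0 ≤ B2 * d ^ 2 := by positivity
      have p2 : 0 ≤ (2 * B0 * q ^ 2 + B1 * q) * d ^ 2 := by positivity
      nlinarith
    · have hqd := hfar d hnear
      have h3 := hfb x hx y hy
      have h4 := hgr x hx (y - x)
      rw [← hd] at h4
      have a1 : 2 * B0 ≤ 2 * B0 * (q * d) ^ 2 :=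
        le_mul_of_one_le_right (by positivity) (one_le_pow₀ hqd)
      have a2 : B1 * d ≤ B1 * d * (q * d) := le_mul_of_one_le_right (by positivity) hqd
      have p2 : 0 ≤ (B2 + C * ρ) * d ^ 2 := by positivity
      nlinarith
  · intro x hx y hy
    set d := ‖y - x‖ with hd
    have hd0 : 0 ≤ d := norm_nonneg _
    by_cases hnear : d < ρ
    · have h := (hloc x hx y hnear).1
      rw [← norm_sub_rev, ← hd] at h
      have p : 0 ≤ (3 * (B2 * q + 2 * B1 * q ^ 2 + 2 * B0 * q ^ 3) + 1 / 2) * d ^ 2 := by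
        positivity
      have p2 : 0 ≤ C * d ^ 2 := by positivity
      linarith
    · have hqd := hfar d hnear
      have b1 : ‖hessian f x (y - x) - (gradient f y - gradient f x)‖ ≤ B2 * d + 2 * B1 := by
        refine (norm_sub_le _ _).trans ?_
        have := norm_sub_le (gradient f y) (gradient f x)
        linarith [hHn x hx (y - x), hB1 x hx, hB1 y hy]
      have a1 : 2 * B1 ≤ 2 * B1 * (q * d) ^ 2 :=
        le_mul_of_one_le_right (by positivity) (one_le_pow₀ hqd)
      have a2 : B2 * d ≤ B2 * d * (q * d) := le_mul_of_one_le_right (by positivity) hqd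
      have p : 0 ≤ (3 * (C + 2 * B0 * q ^ 3) + 1 / 2) * d ^ 2 := by positivity
      have p2 : 0 ≤ (B2 * q + 2 * B1 * q ^ 2) * d ^ 2 := by positivity
      linarith
  · intro x hx y hy
    set d := ‖y - x‖ with hd
    have hd0 : 0 ≤ d := norm_nonneg _
    by_cases hnear : d < ρ
    · have h := (hloc x hx y hnear).2
      rw [← hd] at h
      have p : 0 ≤ (B2 * q + 2 * B1 * q ^ 2 + 2 * B0 * q ^ 3 + 1 / 6) * d ^ 3 := by positivity
      linarith
    · have hqd := hfar d hnear
      have h3 := hfb x hx y hy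
      have h4 := hgr x hx (y - x)
      have hH := (abs_le.1 (hHq x hx (y - x))).1
      rw [← hd] at h4 hH
      have a0 : 2 * B0 ≤ 2 * B0 * (q * d) ^ 3 :=
        le_mul_of_one_le_right (by positivity) (one_le_pow₀ hqd)
      have a1 : B1 * d ≤ B1 * d * (q * d) ^ 2 :=
        le_mul_of_one_le_right (by positivity) (one_le_pow₀ hqd)
      have a2 : B2 * d ^ 2 ≤ B2 * d ^ 2 * (q * d) := le_mul_of_one_le_right (by positivity) hqd
      have p : 0 ≤ (C + 1 / 6) * d ^ 3 := by positivity
      have p2 : 0 ≤ B1 * q ^ 2 * d ^ 3 := by positivity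
      have p3 : 0 ≤ B2 * q * d ^ 3 := by positivity
      linarith
  · intro x hx
    refine (hB2 x hx).trans ?_
    have : 0 ≤ C * ρ + 2 * B0 * q ^ 2 + B1 * q := by positivity
    linarith

end Smoothness

/-! ### Line searches -/

section Searches

open Filter Topology

variable {n : ℕ} {f : Vec n → ℝ} {lam : ℝ} {x0 : Vec n}

/-- A path that starts in the level set and cannot reach its boundary from inside stays in it. -/
lemma path_mem_levelSet (hf : Continuous f) {γ : ℝ → Vec n} (hγ : Continuous γ) {b : ℝ}
    (h0 : γ 0 ∈ levelSet f lam x0) (hnear : ∀ᶠ s in 𝓝[>] (0 : ℝ), γ s ∈ levelSet f lam x0)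
    (hstep : ∀ s ∈ Set.Ioo 0 b, γ s ∈ levelSet f lam x0 →
      objective f lam (γ s) < objective f lam x0) :
    ∀ s ∈ Set.Icc 0 b, γ s ∈ levelSet f lam x0 := by
  -- Continuous induction. At positive times the strict inequality is stable; at time `0` the value
  -- may equal `φ(x⁰)`, so `hnear` is needed.
  refine IsClosed.Icc_subset_of_forall_mem_nhdsWithin (s := γ ⁻¹' levelSet f lam x0)
    (((isClosed_levelSet hf lam x0).preimage hγ).inter isClosed_Icc) h0 ?_
  rintro s ⟨hs, hs0, hsb⟩
  rcases eq_or_lt_of_le hs0 with rfl | hpos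
  · exact hnear
  · refine mem_nhdsWithin_of_mem_nhds ?_
    have := ((continuous_objective hf lam).comp hγ).continuousAt.eventually_lt_const
      (hstep s ⟨hpos, hsb⟩ hs)
    filter_upwards [this] with t ht using ht.le

/-- Backtracking succeeds if all small steps are acceptable. -/
lemma LineSearch.exists_step {trial : ℕ → Vec n} {ok : ℕ → Prop} {s : State n} {θ a : ℝ}
    (h : LineSearch trial ok s) (hθ : 0 < θ) (hθ1 : θ < 1) (ha : 0 < a)
    (hok : ∀ j, θ ^ j < a → ok j) :
    ∃ j, s = .running (trial j) ∧ ok j ∧ (j = 0 ∨ θ * a ≤ θ ^ j) := by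
  rcases h with ⟨j, hj, hs⟩ | ⟨hno, -⟩
  · refine ⟨j, hs, hj.1, ?_⟩
    cases j with
    | zero => exact Or.inl rfl
    | succ j =>
      -- If the previous power were below `a`, the previous trial would have been acceptable,
      -- against minimality.
      right
      by_contra hlt
      rw [not_le, pow_succ, mul_comm, mul_lt_mul_iff_right₀ hθ] at hlt
      exact absurd (hj.2 (hok j hlt)) (by omega)
  · obtain ⟨j, hj⟩ := exists_pow_lt_of_lt_one ha hθ1
    exact absurd (hok j hj) (hno j)

/-- The cubic upper bound along a direction that keeps the signs. -/
lemma objective_le_cubic (hf : Continuous f) (hA : ProblemAssumption f lam x0) {Lg LH : ℝ}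
    (hS : SmoothnessConstants f lam x0 Lg LH) {x e : Vec n} (hx : x ∈ levelSet f lam x0)
    {b c D : ℝ} (hb : 0 < b) (hc : 0 < c) (hD : ‖e‖ ≤ D) (hkeep : ∀ i, b * |e i| ≤ |x i|)
    (hcurve : ∀ a ∈ Set.Icc 0 b, a * dirSlope f lam x e + a ^ 2 / 2 * ⟪e, hessian f x e⟫ ≤
      -(c * a ^ 2))
    (hbc : LH / 6 * b * D ^ 3 < c) :
    objective f lam (x + b • e) ≤ objective f lam x - c * b ^ 2 + LH / 6 * b ^ 3 * D ^ 3 := by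
  have hLH := hS.LH_pos
  have hD0 : 0 ≤ D := (norm_nonneg e).trans hD
  -- The cubic constant is left free: the local Taylor constant serves to leave `x`, and `LH / 6`
  -- serves once the point is known to be in the level set.
  have hexp : ∀ a ∈ Set.Icc 0 b, ∀ C ≥ 0,
      f (x + a • e) ≤ f x + ⟪gradient f x, x + a • e - x⟫ +
        1 / 2 * ⟪x + a • e - x, hessian f x (x + a • e - x)⟫ + C * ‖x + a • e - x‖ ^ 3 →
      objective f lam (x + a • e) ≤ objective f lam x - c * a ^ 2 + C * a ^ 3 * D ^ 3 := by
    intro a ha C hC h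
    have hk : ∀ i, |(a • e) i| ≤ |x i| := fun i => by
      rw [PiLp.smul_apply, smul_eq_mul, abs_mul, abs_of_nonneg ha.1]
      exact (mul_le_mul_of_nonneg_right ha.2 (abs_nonneg _)).trans (hkeep i)
    rw [add_sub_cancel_left, map_smul, inner_smul_left, inner_smul_right (𝕜 := ℝ) e, norm_smul,
      Real.norm_of_nonneg ha.1, conj_trivial] at h
    rw [objective_add_of_abs_le f lam hk, dirSlope_smul]
    have h1 := hcurve a ha
    have h2 : C * (a * ‖e‖) ^ 3 ≤ C * a ^ 3 * D ^ 3 := by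
      rw [mul_pow, mul_assoc]
      have := ha.1
      gcongr
    linarith
  have hmem : x + b • e ∈ levelSet f lam x0 := by
    refine path_mem_levelSet hf (γ := fun a => x + a • e) (b := b) (by fun_prop) (by simpa)
      ?_ ?_ b ⟨hb.le, le_rfl⟩
    · obtain ⟨ρ, hρ, C, hC, hloc⟩ := hA.exists_local_taylor hf
      have hδ : 0 < min b (min (ρ / (D + 1)) (c / (C * D ^ 3 + 1))) := by positivity
      filter_upwards [Ioo_mem_nhdsGT hδ] with a ha
      obtain ⟨ha0, ha1⟩ := ha
      rw [lt_min_iff, lt_min_iff, lt_div_iff₀ (by positivity), lt_div_iff₀ (by positivity)] at ha1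
      obtain ⟨hab, haρ, hac⟩ := ha1
      have hnear : ‖x + a • e - x‖ < ρ := by
        rw [add_sub_cancel_left, norm_smul, Real.norm_of_nonneg ha0.le]
        nlinarith
      have h := hexp a ⟨ha0.le, hab.le⟩ C hC (hloc x hx _ hnear).2
      have : C * a ^ 3 * D ^ 3 ≤ c * a ^ 2 := by
        have : C * a ^ 3 * D ^ 3 = (a * (C * D ^ 3)) * a ^ 2 := by ring
        rw [this]
        gcongr
        linarith
      exact (by linarith : _ ≤ objective f lam x).trans hx
    · intro a ha hmem
      have h := hexp a ⟨ha.1.le, ha.2.le⟩ (LH / 6) (by positivity) (hS.taylor x hx _ hmem)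
      have ha0 := ha.1
      have : LH / 6 * a ^ 3 * D ^ 3 < c * a ^ 2 := by
        have e1 : LH / 6 * a ^ 3 * D ^ 3 = (LH / 6 * a * D ^ 3) * a ^ 2 := by ring
        rw [e1]
        gcongr
        refine lt_of_le_of_lt ?_ hbc
        gcongr
        exact ha.2.le
      exact (by linarith : _ < objective f lam x).trans_le hx
  exact hexp b ⟨hb.le, le_rfl⟩ (LH / 6) (by positivity) (hS.taylor x hx _ hmem)

/-- Backtracking along a direction that keeps the signs up to the length `r`. -/
lemma LineSearch.exists_step_of_keep_sign (hf : Continuous f) (hA : ProblemAssumption f lam x0)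
    {Lg LH : ℝ} (hS : SmoothnessConstants f lam x0 Lg LH) {x e : Vec n}
    (hx : x ∈ levelSet f lam x0) {θ c m r D : ℝ} (hθ : 0 < θ) (hθ1 : θ < 1) (hm : 0 < m)
    (hmc : m < c) (hr : 0 < r) (hD0 : 0 < D) (hD : ‖e‖ ≤ D)
    (hkeep : ∀ a > 0, a * D < r → ∀ i, a * |e i| ≤ |x i|)
    (hcurve : ∀ a ∈ Set.Icc (0 : ℝ) 1,
      a * dirSlope f lam x e + a ^ 2 / 2 * ⟪e, hessian f x e⟫ ≤ -(c * a ^ 2))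
    {ok : ℕ → Prop}
    (hok : ∀ j, objective f lam (x + θ ^ j • e) < objective f lam x - m * (θ ^ j) ^ 2 → ok j)
    {s : State n} (h : LineSearch (fun j => x + θ ^ j • e) ok s) :
    ∃ j, s = .running (x + θ ^ j • e) ∧ ok j ∧
      (j = 0 ∨ θ * r ≤ θ ^ j * D ∨ θ * (6 * (c - m)) ≤ θ ^ j * (LH * D ^ 3)) := by
  have hLH := hS.LH_pos
  have hcm : 0 < c - m := sub_pos.2 hmc
  -- Below `r / D` the signs are kept; below the second threshold the cubic remainder is less than
  -- the surplus `c - m`.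
  obtain ⟨j, hj, hj1, hj2⟩ := h.exists_step hθ hθ1
    (a := min (r / D) (6 * (c - m) / (LH * D ^ 3))) (by positivity) fun j hj => by
      rw [lt_min_iff, lt_div_iff₀ hD0, lt_div_iff₀ (by positivity)] at hj
      obtain ⟨h1, h2⟩ := hj
      have hpos : 0 < θ ^ j := pow_pos hθ j
      have hle : θ ^ j ≤ 1 := pow_le_one₀ hθ.le hθ1.le
      have := objective_le_cubic hf hA hS hx hpos (hm.trans hmc) hD (hkeep _ hpos h1)
        (fun a ha => hcurve a ⟨ha.1, ha.2.trans hle⟩) (by nlinarith)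
      refine hok j (this.trans_lt ?_)
      have e1 : LH / 6 * (θ ^ j) ^ 3 * D ^ 3 = (θ ^ j * (LH * D ^ 3)) / 6 * (θ ^ j) ^ 2 := by ring
      rw [e1]
      have : (θ ^ j * (LH * D ^ 3)) / 6 * (θ ^ j) ^ 2 < (c - m) * (θ ^ j) ^ 2 := by
        gcongr; linarith
      linarith
  refine ⟨j, hj, hj1, hj2.imp id fun h => ?_⟩
  rcases min_cases (r / D) (6 * (c - m) / (LH * D ^ 3)) with ⟨h', -⟩ | ⟨h', -⟩
  · left
    rwa [h', mul_div_assoc', div_le_iff₀ hD0] at h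
  · right
    rwa [h', mul_div_assoc', div_le_iff₀ (by positivity)] at h

/-! ### The proximal gradient step -/

lemma soft_zero (w : ℝ) : soft 0 w = w := by
  unfold soft
  rcases le_total 0 w with h | h
  · rw [max_eq_left (by linarith), max_eq_right (by linarith)]; ring
  · rw [max_eq_right (by linarith), max_eq_left (by linarith)]; ring

lemma continuous_softVec (lam : ℝ) (x g : Vec n) :
    Continuous fun s : ℝ => softVec (s * lam) (x - s • g) := by
  unfold softVec soft
  fun_prop

lemma norm_sq_gradMap (f : Vec n → ℝ) (lam : ℝ) (x : Vec n) (t : ℝ) :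
    ‖gradMap f lam x t‖ ^ 2 = t ^ 2 * ‖proxPoint f lam x t - x‖ ^ 2 := by
  rw [gradMap, norm_smul, mul_pow, Real.norm_eq_abs, sq_abs, norm_sub_rev]

/-- The sufficient decrease condition of the proximal gradient step holds for large `t`. -/
lemma ProxStage.objective_lt {P : Params} (hf : Continuous f) (hlam : 0 < lam)
    (hA : ProblemAssumption f lam x0) {Lg LH : ℝ} (hS : SmoothnessConstants f lam x0 Lg LH)
    {x : Vec n} (hx : x ∈ levelSet f lam x0) (hst : ProxStage P f lam x) {t : ℝ}
    (ht : Lg / (2 - 2 * P.ηbar) < t) :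
    objective f lam (proxPoint f lam x t) <
      objective f lam x - P.ηbar / t * ‖gradMap f lam x t‖ ^ 2 := by
  have hLg := hS.Lg_pos
  obtain ⟨hη0, hη1⟩ := P.ηbar_mem
  have hden : 0 < 2 - 2 * P.ηbar := by linarith
  have ht0 : 0 < t := lt_trans (by positivity) ht
  have hLt : ∀ t', t ≤ t' → Lg / 2 < t' := by
    intro t' htt
    rw [div_lt_iff₀ hden] at ht
    nlinarith
  have hexp : ∀ t' > 0, ∀ C, f (proxPoint f lam x t') ≤ f x +
      ⟪gradient f x, proxPoint f lam x t' - x⟫ + C * ‖proxPoint f lam x t' - x‖ ^ 2 →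
      objective f lam (proxPoint f lam x t') ≤
        objective f lam x - (t' - C) * ‖proxPoint f lam x t' - x‖ ^ 2 := by
    intro t' ht' C h
    have := proxPoint_optimal f hlam x ht'
    simp only [objective]
    linarith
  -- The lower bound on the gradient mapping makes the proximal point move for every `t'`, so all
  -- decreases are strict.
  have hne : ∀ t' > 0, 0 < ‖proxPoint f lam x t' - x‖ ^ 2 := by
    intro t' ht'
    have h := hst.norm_gradMap_sq hlam ht'
    rw [norm_sq_gradMap] at h
    have := (Real.rpow_pos_of_pos P.εg_mem.1 (3 / 2)).trans h
    exact (pos_iff_pos_of_mul_pos this).1 (by positivity)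
  -- The proximal points, parametrized by `s = 1/t`, extend continuously to `x` at `s = 0`.
  set γ : ℝ → Vec n := fun s => softVec (s * lam) (x - s • gradient f x) with hγ
  have hγc : Continuous γ := continuous_softVec lam x (gradient f x)
  have hγp : ∀ s > 0, γ s = proxPoint f lam x s⁻¹ := by
    intro s hs
    rw [proxPoint_eq f hlam x (inv_pos.2 hs), inv_inv]
  have hγ0 : γ 0 = x := by
    ext i
    simp [hγ, softVec_apply, soft_zero]
  have hmem : proxPoint f lam x t ∈ levelSet f lam x0 := by
    have := path_mem_levelSet hf (γ := γ) (b := t⁻¹) hγc (by rwa [hγ0]) ?_ ?_ t⁻¹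
      ⟨(inv_pos.2 ht0).le, le_rfl⟩
    · rwa [hγp _ (inv_pos.2 ht0), inv_inv] at this
    · obtain ⟨ρ, hρ, C, hC, hloc⟩ := hA.exists_local_taylor hf
      have hball : ∀ᶠ s in 𝓝[>] (0 : ℝ), ‖γ s - x‖ < ρ := by
        have hc : Continuous fun s => ‖γ s - x‖ := (hγc.sub continuous_const).norm
        have := (hc.tendsto 0).eventually_lt_const (u := ρ) (by simpa [hγ0] using hρ)
        exact nhdsWithin_le_nhds this
      -- Near `x`, the Hessian bound and the cubic remainder give the quadratic constant `Lg / 2 + C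
      -- ρ`, which `1/s` exceeds for small `s`.
      have hδ : 0 < (Lg / 2 + C * ρ)⁻¹ := by positivity
      filter_upwards [hball, Ioo_mem_nhdsGT hδ] with s hs hsδ
      have hs0 := hsδ.1
      have hinv : Lg / 2 + C * ρ < s⁻¹ := (lt_inv_comm₀ hs0 (by positivity)).1 hsδ.2
      have h2 := (hloc x hx _ hs).2
      have hH := (inner_hessian_le (f := f) x (γ s - x)).trans
        (mul_le_mul_of_nonneg_right (hS.hessian_le x hx) (sq_nonneg _))
      have h3 : C * ‖γ s - x‖ ^ 3 ≤ C * ρ * ‖γ s - x‖ ^ 2 := by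
        have : C * ‖γ s - x‖ ^ 3 = C * ‖γ s - x‖ * ‖γ s - x‖ ^ 2 := by ring
        rw [this]; gcongr
      rw [hγp s hs0] at h2 hH h3 ⊢
      have h4 := hexp s⁻¹ (inv_pos.2 hs0) (Lg / 2 + C * ρ) (by linarith)
      have h5 := mul_pos (sub_pos.2 hinv) (hne s⁻¹ (inv_pos.2 hs0))
      exact (by linarith : _ ≤ objective f lam x).trans hx
    · intro s hs hmem
      have hs0 := hs.1
      have hts : t < s⁻¹ := (lt_inv_comm₀ hs0 ht0).1 hs.2
      rw [hγp s hs0] at hmem ⊢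
      have h4 := hexp s⁻¹ (inv_pos.2 hs0) (Lg / 2) (hS.descent x hx _ hmem Lg le_rfl)
      have h5 := mul_pos (sub_pos.2 (hLt s⁻¹ hts.le)) (hne s⁻¹ (inv_pos.2 hs0))
      exact (by linarith : _ < objective f lam x).trans_le hx
  have h4 := hexp t ht0 (Lg / 2) (hS.descent x hx _ hmem Lg le_rfl)
  refine h4.trans_lt ?_
  have e : P.ηbar / t * ‖gradMap f lam x t‖ ^ 2 =
      P.ηbar * t * ‖proxPoint f lam x t - x‖ ^ 2 := by
    rw [norm_sq_gradMap]; field_simp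
  rw [e]
  have : P.ηbar * t < t - Lg / 2 := by
    rw [div_lt_iff₀ hden] at ht; linarith
  have := mul_lt_mul_of_pos_right this (hne t ht0)
  linarith

/-- The decrease in a proximal gradient step. -/
lemma ProxStage.exists_decrease {P : Params} (hf : Continuous f) (hlam : 0 < lam)
    (hA : ProblemAssumption f lam x0) {Lg LH : ℝ} (hS : SmoothnessConstants f lam x0 Lg LH)
    {x : Vec n} (hx : x ∈ levelSet f lam x0) (hst : ProxStage P f lam x) {s : State n}
    (hs : LineSearch (fun j => proxPoint f lam x (P.β ^ j))
      (fun j => objective f lam (proxPoint f lam x (P.β ^ j)) <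
        objective f lam x - P.ηbar / P.β ^ j * ‖gradMap f lam x (P.β ^ j)‖ ^ 2) s) :
    ∃ x', s = .running x' ∧
      objective f lam x' ≤ objective f lam x - cPG P Lg * P.εg ^ (3 / 2 : ℝ) := by
  have hLg := hS.Lg_pos
  obtain ⟨hη0, hη1⟩ := P.ηbar_mem
  have hβ := P.β_gt
  have hβ0 : 0 < P.β := by linarith
  have hden : 0 < 2 - 2 * P.ηbar := by linarith
  obtain ⟨j, hj, hok, hj2⟩ := hs.exists_step (θ := P.β⁻¹) (a := (Lg / (2 - 2 * P.ηbar))⁻¹)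
    (by positivity) (inv_lt_one_of_one_lt₀ hβ) (by positivity) fun j hj => by
      rw [inv_pow, inv_lt_inv₀ (by positivity) (by positivity)] at hj
      exact hst.objective_lt hf hlam hA hS hx hj
  refine ⟨_, hj, hok.le.trans ?_⟩
  -- The entry `1` of the maximum is the case that the first trial is accepted.
  have hle : P.β ^ j ≤ max (P.β * Lg / (2 - 2 * P.ηbar)) 1 := by
    rcases hj2 with rfl | h
    · simp
    · rw [inv_pow, ← mul_inv, inv_le_inv₀ (by positivity) (by positivity)] at h
      exact le_max_of_le_left (h.trans_eq (mul_div_assoc _ _ _).symm)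
  have h1 := (hst.norm_gradMap_sq hlam (t := P.β ^ j) (by positivity)).le
  have h2 : cPG P Lg ≤ P.ηbar / P.β ^ j := by
    unfold cPG
    gcongr
  have h3 : 0 ≤ P.εg ^ (3 / 2 : ℝ) := Real.rpow_nonneg P.εg_mem.1.le _
  have h4 : cPG P Lg * P.εg ^ (3 / 2 : ℝ) ≤
      P.ηbar / P.β ^ j * ‖gradMap f lam x (P.β ^ j)‖ ^ 2 := by gcongr
  linarith

end Searches

/-! ### The Newton-CG step and the negative curvature step -/

section Steps

variable {n : ℕ} {f : Vec n → ℝ} {lam : ℝ} {x0 : Vec n}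

lemma sgn_mul_self (a : ℝ) : sgn a * a = |a| := by
  unfold sgn
  split_ifs with h
  · rw [abs_of_nonneg h, one_mul]
  · rw [abs_of_neg (not_le.1 h)]; ring

lemma sgn_sq (a : ℝ) : sgn a ^ 2 = 1 := by
  unfold sgn
  split_ifs <;> norm_num

lemma abs_sgn (a : ℝ) : |sgn a| = 1 := by
  unfold sgn
  split_ifs <;> simp

/-- The amount `Δ` by which an iteration (or one of two successive ones) decreases the
objective. -/
structure IsDecrease (P : Params) (Lg LH Δ : ℝ) : Prop where
  pg : Δ ≤ cPG P Lg * P.εg ^ (3 / 2 : ℝ)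
  nc_cube : Δ ≤ cNC P LH / 8 * P.εh ^ 3
  nc_mul : Δ ≤ cNC P LH / 8 * (P.εg * P.εh)
  sol_cube : Δ ≤ cSOL P LH * P.εh ^ 3
  sol_mul : Δ ≤ cSOL P LH * (P.εg * P.εh)
  sol_div : Δ ≤ cSOL P LH * (P.εg ^ 2 / P.εh)

lemma Params.η_pos (P : Params) : 0 < P.η := P.η_mem.1

lemma Params.one_sub_pos (P : Params) : 0 < 1 - P.ζ - 2 * P.η := by
  have := P.η_mem.2; linarith

lemma Params.two_η_lt (P : Params) : 0 < 1 - 2 * P.η := by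
  have := P.one_sub_pos; have := P.ζ_mem.1; linarith

lemma cNC_nonneg (P : Params) (LH : ℝ) : 0 ≤ cNC P LH := by
  have := P.η_pos
  unfold cNC
  positivity

lemma cNC_le_left (P : Params) (LH : ℝ) : cNC P LH ≤ P.η * P.θ ^ 2 := by
  have := P.η_pos
  unfold cNC
  exact mul_le_of_le_one_right (by positivity) (min_le_left _ _)

lemma cNC_le_right (P : Params) (LH : ℝ) :
    cNC P LH ≤ P.η * P.θ ^ 2 * (9 * (1 - 2 * P.η) ^ 2 / LH ^ 2) := by
  have := P.η_pos
  unfold cNC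
  gcongr
  exact min_le_right _ _

lemma cSOL_le_root (P : Params) (LH : ℝ) : cSOL P LH ≤ P.η *
    (4 / (√((P.ζ + 4 * P.τhat) ^ 2 + 8 * LH) + (P.ζ + 4 * P.τhat))) ^ 2 := by
  have := P.η_pos
  unfold cSOL
  gcongr
  exact (min_le_left _ _).trans (min_le_left _ _)

lemma cSOL_le_curv (P : Params) (LH : ℝ) :
    cSOL P LH ≤ P.η * (9 * (1 - P.ζ - 2 * P.η) ^ 2 * P.θ ^ 2 / LH ^ 2) := by
  have := P.η_pos
  unfold cSOL
  gcongr
  exact (min_le_left _ _).trans (min_le_right _ _)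

lemma cSOL_le_sq (P : Params) (LH : ℝ) : cSOL P LH ≤ P.η * P.θ ^ 2 := by
  have := P.η_pos
  unfold cSOL
  gcongr
  exact (min_le_right _ _).trans (min_le_left _ _)

lemma Params.sq_rpow_half (P : Params) : (P.εg ^ (1 / 2 : ℝ)) ^ 2 = P.εg := by
  rw [← Real.rpow_natCast, ← Real.rpow_mul P.εg_mem.1.le]; norm_num

lemma Params.θ_sq_le (P : Params) : P.θ ^ 2 ≤ 1 := pow_le_one₀ P.θ_mem.1.le P.θ_mem.2.le

lemma keep_sign_extend {P : Params} {x : Vec n} {d : EuclideanSpace ℝ (largeSet P.εg x)} {a : ℝ}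
    (ha : 0 < a) (had : a * ‖d‖ < P.εg ^ (1 / 2 : ℝ)) (i : Fin n) :
    a * |extend (largeSet P.εg x) d i| ≤ |x i| := by
  by_cases hi : i ∈ largeSet P.εg x
  · have h1 := abs_apply_le_norm (extend (largeSet P.εg x) d) i
    rw [norm_extend] at h1
    have h2 := mem_largeSet.1 hi
    exact ((mul_le_mul_of_nonneg_left h1 ha.le).trans had.le).trans h2.le
  · rw [extend_apply_of_notMem _ hi, abs_zero, mul_zero]
    exact abs_nonneg _

/-- The lengths, slopes and curvatures of the negative curvature directions of the first phase. -/
lemma newtonDir_nc {V : Type*} [NormedAddCommGroup V] [InnerProductSpace ℝ V] {H : V →ₗ[ℝ] V}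
    {g d : V} {ε : ℝ} (hε : 0 < ε) (hd : ⟪d, H d⟫ < -(ε * ‖d‖ ^ 2)) :
    ε ≤ ‖newtonDir H g d .nc‖ ∧ ⟪g, newtonDir H g d .nc⟫ ≤ 0 ∧
      ⟪newtonDir H g d .nc, H (newtonDir H g d .nc)⟫ = -‖newtonDir H g d .nc‖ ^ 3 := by
  have hd0 : d ≠ 0 := by rintro rfl; simp at hd
  have hn : 0 < ‖d‖ := norm_pos_iff.2 hd0
  have hneg : ⟪d, H d⟫ < 0 := hd.trans_le (by
    have : 0 ≤ ε * ‖d‖ ^ 2 := by positivity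
    linarith)
  -- The direction has length `k` and Rayleigh quotient `-k`, hence curvature `-k³`; the sign factor
  -- makes it a descent direction.
  set k := |⟪d, H d⟫| / ‖d‖ ^ 2 with hk
  have hk0 : 0 ≤ k := by positivity
  have hkd : ⟪d, H d⟫ = -(k * ‖d‖ ^ 2) := by
    rw [hk, abs_of_neg hneg]; field_simp
  have hdir : newtonDir H g d .nc = (-(sgn ⟪d, g⟫ * k * ‖d‖⁻¹)) • d := by
    simp only [newtonDir, ← hk, smul_smul, neg_smul]
  have hnorm : ‖newtonDir H g d .nc‖ = k := by
    rw [hdir, norm_smul, norm_neg, norm_mul, norm_mul, Real.norm_eq_abs, abs_sgn,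
      Real.norm_of_nonneg hk0, norm_inv, norm_norm]
    field_simp
  refine ⟨?_, ?_, ?_⟩
  · rw [hnorm, hk, le_div_iff₀ (by positivity), abs_of_neg hneg]; linarith
  · rw [hdir, inner_smul_right, real_inner_comm d g]
    have : -(sgn ⟪d, g⟫ * k * ‖d‖⁻¹) * ⟪d, g⟫ = -(k * ‖d‖⁻¹ * |⟪d, g⟫|) := by
      rw [← sgn_mul_self]; ring
    rw [this]
    have : 0 ≤ k * ‖d‖⁻¹ * |⟪d, g⟫| := by positivity
    linarith
  · rw [hnorm, hdir, map_smul, inner_smul_left, inner_smul_right, hkd, conj_trivial]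
    have : -(sgn ⟪d, g⟫ * k * ‖d‖⁻¹) * (-(sgn ⟪d, g⟫ * k * ‖d‖⁻¹) * -(k * ‖d‖ ^ 2)) =
        -(sgn ⟪d, g⟫ ^ 2 * k ^ 3 * (‖d‖⁻¹ * ‖d‖) ^ 2) := by ring
    rw [this, sgn_sq, inv_mul_cancel₀ hn.ne']; ring

/-- The shift of the Newton system. -/
lemma shift_mem {P : Params} {G τ : ℝ} (hG : 0 < G)
    (hτ : τ ∈ Set.Icc (2 * P.εh / G ^ P.δ) (2 * P.τhat * P.εh / G ^ P.δ)) :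
    2 * P.εh ≤ τ * G ^ P.δ ∧ τ * G ^ P.δ ≤ 2 * P.τhat * P.εh := by
  have hpos : 0 < G ^ P.δ := Real.rpow_pos_of_pos hG _
  exact ⟨(div_le_iff₀ hpos).1 hτ.1, (le_div_iff₀ hpos).1 hτ.2⟩

/-- The decrease in a Newton-CG step of type `NC`. -/
lemma exists_decrease_newton_nc {P : Params} (hf : Continuous f)
    (hA : ProblemAssumption f lam x0) {Lg LH Δ : ℝ} (hS : SmoothnessConstants f lam x0 Lg LH)
    (hΔ : IsDecrease P Lg LH Δ) {x : Vec n} (hx : x ∈ levelSet f lam x0)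
    {D : EuclideanSpace ℝ (largeSet P.εg x)} (hD : P.εh ≤ ‖D‖)
    (hslope : ⟪redGrad P f lam x, D⟫ ≤ 0) (hcurve : ⟪D, redHess P f x D⟫ = -‖D‖ ^ 3)
    {s : State n}
    (hs : LineSearch (fun j => x + P.θ ^ j • extend (largeSet P.εg x) D)
      (fun j => objective f lam (x + P.θ ^ j • extend (largeSet P.εg x) D) <
        objective f lam x - P.η * P.θ ^ (2 * j) * P.εh * ‖extend (largeSet P.εg x) D‖ ^ 2) s) :
    ∃ x', s = .running x' ∧ objective f lam x' ≤ objective f lam x - Δ := by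
  have hLH := hS.LH_pos
  have hεh := P.εh_mem.1
  have hεg := P.εg_mem.1
  have hη := P.η_pos
  have hη2 := P.two_η_lt
  obtain ⟨hθ, hθ1⟩ := P.θ_mem
  have hr : 0 < P.εg ^ (1 / 2 : ℝ) := Real.rpow_pos_of_pos hεg _
  have hD0 : 0 < ‖D‖ := hεh.trans_le hD
  rw [redHess, inner_principal] at hcurve
  change ⟪_, hessian f x _⟫ = _ at hcurve
  rw [inner_redGrad] at hslope
  have hmc : P.η * P.εh * ‖D‖ ^ 2 ≤ P.η * ‖D‖ ^ 3 := by
    have : P.η * ‖D‖ ^ 3 = P.η * ‖D‖ * ‖D‖ ^ 2 := by ring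
    rw [this]; gcongr
  have hD3 : 0 < ‖D‖ ^ 3 := by positivity
  obtain ⟨j, hj, hok, hj2⟩ := hs.exists_step_of_keep_sign hf hA hS hx hθ hθ1
    (m := P.η * P.εh * ‖D‖ ^ 2) (c := 1 / 2 * ‖D‖ ^ 3) (r := P.εg ^ (1 / 2 : ℝ)) (D := ‖D‖)
    (by positivity) (by nlinarith) hr hD0 (norm_extend _ D).le
    (fun a ha had => keep_sign_extend ha had)
    (fun a ha => by rw [hcurve]; nlinarith [ha.1])
    (fun j hj => by
      rw [norm_extend, pow_mul']
      refine hj.trans_eq ?_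
      ring)
  refine ⟨_, hj, hok.le.trans ?_⟩
  rw [norm_extend, pow_mul']
  suffices h : Δ ≤ P.η * P.εh * (P.θ ^ j * ‖D‖) ^ 2 by
    have e : P.η * (P.θ ^ j) ^ 2 * P.εh * ‖D‖ ^ 2 = P.η * P.εh * (P.θ ^ j * ‖D‖) ^ 2 := by ring
    rw [e]; linarith
  have hcn := cNC_nonneg P LH
  -- The cases are: full step, step limited by the signs, step limited by the cubic remainder. The
  -- factor `1/8` in `Δ` is slack here and is spent in the second phase.
  rcases hj2 with rfl | h | h
  · calc Δ ≤ cNC P LH / 8 * P.εh ^ 3 := hΔ.nc_cube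
      _ ≤ cNC P LH * P.εh ^ 3 := by gcongr; linarith
      _ ≤ P.η * P.εh ^ 3 := by
        gcongr
        exact (cNC_le_left P LH).trans (mul_le_of_le_one_right hη.le P.θ_sq_le)
      _ = P.η * P.εh * (P.θ ^ 0 * P.εh) ^ 2 := by ring
      _ ≤ _ := by gcongr
  · calc Δ ≤ cNC P LH / 8 * (P.εg * P.εh) := hΔ.nc_mul
      _ ≤ cNC P LH * (P.εg * P.εh) := by gcongr; linarith
      _ ≤ P.η * P.θ ^ 2 * (P.εg * P.εh) := by gcongr; exact cNC_le_left P LH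
      _ = P.η * P.εh * (P.θ * P.εg ^ (1 / 2 : ℝ)) ^ 2 := by rw [mul_pow, P.sq_rpow_half]; ring
      _ ≤ _ := by gcongr
  · have h2 : P.θ * (3 * (1 - 2 * P.η) / LH) * P.εh ≤ P.θ ^ j * ‖D‖ := by
      have h3 : P.θ * (6 * ((1 / 2 - P.η) * ‖D‖ ^ 3)) ≤ P.θ ^ j * (LH * ‖D‖ ^ 3) :=
        le_trans (by gcongr; linarith) h
      have h4 : P.θ * (3 * (1 - 2 * P.η)) ≤ P.θ ^ j * LH := by
        refine le_of_mul_le_mul_right ?_ hD3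
        linarith
      have h5 : P.θ * (3 * (1 - 2 * P.η) / LH) ≤ P.θ ^ j := by
        rw [mul_div_assoc', div_le_iff₀ hLH]; exact h4
      gcongr
    calc Δ ≤ cNC P LH / 8 * P.εh ^ 3 := hΔ.nc_cube
      _ ≤ cNC P LH * P.εh ^ 3 := by gcongr; linarith
      _ ≤ P.η * P.θ ^ 2 * (9 * (1 - 2 * P.η) ^ 2 / LH ^ 2) * P.εh ^ 3 := by
        gcongr; exact cNC_le_right P LH
      _ = P.η * P.εh * (P.θ * (3 * (1 - 2 * P.η) / LH) * P.εh) ^ 2 := by ring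
      _ ≤ _ := by gcongr

/-- The reduced gradient after a short step along `d`. -/
lemma norm_redGrad_add_le {P : Params} {Lg LH : ℝ} (hS : SmoothnessConstants f lam x0 Lg LH)
    {x : Vec n} (hx : x ∈ levelSet f lam x0) {d : EuclideanSpace ℝ (largeSet P.εg x)}
    (hd : ‖d‖ < P.εg ^ (1 / 2 : ℝ)) (hx' : x + extend (largeSet P.εg x) d ∈ levelSet f lam x0)
    {q : EuclideanSpace ℝ (largeSet P.εg x)}
    (hq : q = redHess P f x d + redGrad P f lam x) :
    ‖redGrad P f lam (x + extend (largeSet P.εg x) d)‖ ≤ LH / 2 * ‖d‖ ^ 2 + ‖q‖ := by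
  have hεg := P.εg_mem.1
  set e := extend (largeSet P.εg x) d with he
  set W : Vec n := extend (largeSet P.εg x) q -
    (hessian f x e - (gradient f (x + e) - gradient f x)) with hW
  -- Coordinates outside the large set do not move and the others keep their signs. So the large set
  -- can only shrink, and the new reduced gradient is `q` minus the Taylor error.
  have hrestr : redGrad P f lam (x + e) = restrict (largeSet P.εg (x + e)) W := by
    ext ⟨i, hi⟩
    have hi' := mem_largeSet.1 hi
    have hiJ : i ∈ largeSet P.εg x := by
      by_contra hcon
      rw [PiLp.add_apply, he, extend_apply_of_notMem _ hcon, add_zero] at hi'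
      exact hcon (mem_largeSet.2 hi')
    have hxi := mem_largeSet.1 hiJ
    have hei : |e i| < |x i| := ((abs_apply_le_norm e i).trans_lt (by
      rw [he, norm_extend]; exact hd)).trans hxi
    have hsign : Real.sign ((x + e) i) = Real.sign (x i) := by
      rw [PiLp.add_apply]
      rcases lt_trichotomy (x i) 0 with h | h | h
      · rw [abs_of_neg h, abs_lt] at hei
        rw [Real.sign_of_neg h, Real.sign_of_neg (by linarith)]
      · rw [h, abs_zero] at hei
        exact absurd hei (abs_nonneg _).not_gt
      · rw [abs_of_pos h, abs_lt] at hei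
        rw [Real.sign_of_pos h, Real.sign_of_pos (by linarith)]
    have h1 : redGrad P f lam (x + e) ⟨i, hi⟩ =
        gradient f (x + e) i + lam * Real.sign ((x + e) i) :=
      gEps_apply_of_large f lam hεg hi'
    have h2 : redGrad P f lam x ⟨i, hiJ⟩ = gradient f x i + lam * Real.sign (x i) :=
      gEps_apply_of_large f lam hεg hxi
    have h3 : redHess P f x d ⟨i, hiJ⟩ = hessian f x e i := rfl
    have h4 : extend (largeSet P.εg x) q i =
        hessian f x e i + (gradient f x i + lam * Real.sign (x i)) := by
      rw [extend_apply, dif_pos hiJ, hq, PiLp.add_apply, h2, h3]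
    rw [h1, hsign, restrict_apply, hW]
    simp only [PiLp.sub_apply, h4]
    ring
  rw [hrestr]
  refine (norm_restrict_le _ _).trans ?_
  rw [hW]
  refine (norm_sub_le _ _).trans ?_
  have := hS.grad_taylor x hx _ hx'
  have hen : ‖e‖ = ‖d‖ := norm_extend _ d
  rw [add_sub_cancel_left, hen] at this
  rw [norm_extend, add_comm]
  gcongr

/-- A lower bound from a quadratic inequality. -/
lemma le_of_lt_quadratic {B L εg εh D : ℝ} (hB : 0 < B) (hL : 0 < L) (hεg : 0 < εg)
    (hεh : 0 < εh) (hD : 0 ≤ D) (h : εg < L / 2 * D ^ 2 + B / 2 * εh * D) :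
    4 / (√(B ^ 2 + 8 * L) + B) * min (εg / εh) εh ≤ D := by
  set w := √(B ^ 2 + 8 * L) with hw
  have hw2 : w ^ 2 = B ^ 2 + 8 * L := Real.sq_sqrt (by positivity)
  have hw0 : 0 ≤ w := Real.sqrt_nonneg _
  set q := 4 / (w + B) with hq
  have hq0 : 0 < q := by positivity
  -- The constant `q` is the positive root of this quadratic in rationalized form; scaling it by `m`
  -- uses `m ≤ ε_h` and `m ε_h ≤ ε_g`.
  have hroot : L / 2 * q ^ 2 + B / 2 * q = 1 := by
    have hwB : 0 < w + B := by positivity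
    rw [hq]
    field_simp
    nlinarith
  set m := min (εg / εh) εh with hm
  have hm0 : 0 < m := by positivity
  have hm1 : m ≤ εh := min_le_right _ _
  have hm2 : m * εh ≤ εg := (le_div_iff₀ hεh).1 (min_le_left _ _)
  by_contra hcon
  rw [not_le] at hcon
  have h1 : L / 2 * D ^ 2 + B / 2 * εh * D ≤ L / 2 * (q * m) ^ 2 + B / 2 * εh * (q * m) := by
    gcongr
  have h2 : L / 2 * (q * m) ^ 2 ≤ L / 2 * q ^ 2 * (m * εh) := by
    have : L / 2 * (q * m) ^ 2 = L / 2 * q ^ 2 * (m * m) := by ring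
    rw [this]; gcongr
  have h3 : L / 2 * q ^ 2 * (m * εh) + B / 2 * εh * (q * m) = m * εh := by
    have : L / 2 * q ^ 2 * (m * εh) + B / 2 * εh * (q * m) =
      (L / 2 * q ^ 2 + B / 2 * q) * (m * εh) := by ring
    rw [this, hroot, one_mul]
  linarith

/-- The decrease in a Newton-CG step of type `SOL`. It may be small only if the next iterate is
not in the case of the Newton-CG step. -/
lemma exists_decrease_newton_sol {P : Params} (hf : Continuous f)
    (hA : ProblemAssumption f lam x0) {Lg LH Δ : ℝ} (hS : SmoothnessConstants f lam x0 Lg LH)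
    (hΔ : IsDecrease P Lg LH Δ) {x : Vec n} (hx : x ∈ levelSet f lam x0)
    {d : EuclideanSpace ℝ (largeSet P.εg x)} {μ : ℝ} (hμ : 2 * P.εh ≤ μ)
    (hμ2 : μ ≤ 2 * P.τhat * P.εh) (hd0 : d ≠ 0)
    (hcurv : P.εh * ‖d‖ ^ 2 ≤ ⟪d, redHess P f x d⟫ + μ * ‖d‖ ^ 2)
    (hres : ‖redHess P f x d + μ • d + redGrad P f lam x‖ ≤ P.ζ / 2 * P.εh * ‖d‖)
    {s : State n}
    (hs : LineSearch (fun j => x + P.θ ^ j • extend (largeSet P.εg x) d)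
      (fun j => objective f lam (x + P.θ ^ j • extend (largeSet P.εg x) d) <
        objective f lam x - P.η * P.θ ^ (2 * j) * P.εh * ‖extend (largeSet P.εg x) d‖ ^ 2) s) :
    ∃ x', s = .running x' ∧ objective f lam x' ≤ objective f lam x ∧
      (NewtonStage P f lam x' → objective f lam x' ≤ objective f lam x - Δ) := by
  have hLH := hS.LH_pos
  have hεh := P.εh_mem.1
  have hεg := P.εg_mem.1
  have hη := P.η_pos
  have hη2 := P.one_sub_pos
  obtain ⟨hζ, hζ1⟩ := P.ζ_mem
  obtain ⟨hθ, hθ1⟩ := P.θ_mem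
  have hr : 0 < P.εg ^ (1 / 2 : ℝ) := Real.rpow_pos_of_pos hεg _
  have hD0 : 0 < ‖d‖ := norm_pos_iff.2 hd0
  have hD2 : 0 < P.εh * ‖d‖ ^ 2 := by positivity
  -- The residual is tested against `d` itself.
  have hslope : dirSlope f lam x (extend (largeSet P.εg x) d) +
      (⟪d, redHess P f x d⟫ + μ * ‖d‖ ^ 2) ≤ P.ζ / 2 * (P.εh * ‖d‖ ^ 2) := by
    rw [← inner_redGrad]
    have h1 := real_inner_le_norm (redHess P f x d + μ • d + redGrad P f lam x) d
    rw [inner_add_left, inner_add_left, inner_smul_left, conj_trivial, real_inner_self_eq_norm_sq,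
      real_inner_comm] at h1
    have h2 := mul_le_mul_of_nonneg_right hres hD0.le
    linarith
  have hHe : ⟪extend (largeSet P.εg x) d, hessian f x (extend (largeSet P.εg x) d)⟫ =
      ⟪d, redHess P f x d⟫ := by
    rw [redHess, inner_principal]; rfl
  have hμd : 0 ≤ μ * ‖d‖ ^ 2 := by
    have : 0 ≤ μ := by linarith
    positivity
  obtain ⟨j, hj, hok, hj2⟩ := hs.exists_step_of_keep_sign hf hA hS hx hθ hθ1
    (m := P.η * P.εh * ‖d‖ ^ 2) (c := (1 - P.ζ) / 2 * (P.εh * ‖d‖ ^ 2))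
    (r := P.εg ^ (1 / 2 : ℝ)) (D := ‖d‖)
    (by positivity) (by nlinarith) hr hD0 (norm_extend _ d).le
    (fun a ha had => keep_sign_extend ha had)
    -- The slack between the two sides is `h4`, which vanishes at `a = 0` and `a = 1`; this fixes
    -- the constant `(1 - ζ)/2`.
    (fun a ha => by
      obtain ⟨ha0, ha1⟩ := ha
      rw [hHe]
      set Q := ⟪d, redHess P f x d⟫
      set w := P.εh * ‖d‖ ^ 2
      set S := dirSlope f lam x (extend (largeSet P.εg x) d)
      have h1 : a * S ≤ a * (P.ζ / 2 * w - (Q + μ * ‖d‖ ^ 2)) := by gcongr; linarith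
      have h2 : a * (1 - a / 2) * w ≤ a * (1 - a / 2) * (Q + μ * ‖d‖ ^ 2) := by
        have : 0 ≤ 1 - a / 2 := by linarith
        gcongr
      have h3 : 0 ≤ a ^ 2 / 2 * (μ * ‖d‖ ^ 2) := by positivity
      have h4 : 0 ≤ a * (1 - a) * ((1 - P.ζ / 2) * w) := by
        have : 0 ≤ 1 - a := by linarith
        have : 0 ≤ 1 - P.ζ / 2 := by linarith
        positivity
      have h5 : a * S + a ^ 2 / 2 * Q ≤ a * (P.ζ / 2 * w) - a * (1 - a / 2) * w := by linarith
      linarith)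
    (fun j hj => by
      rw [norm_extend, pow_mul']
      refine hj.trans_eq ?_
      ring)
  rw [norm_extend, pow_mul'] at hok
  have e : P.η * (P.θ ^ j) ^ 2 * P.εh * ‖d‖ ^ 2 = P.η * P.εh * (P.θ ^ j * ‖d‖) ^ 2 := by ring
  rw [e] at hok
  have hle : objective f lam (x + P.θ ^ j • extend (largeSet P.εg x) d) ≤ objective f lam x := by
    have : 0 ≤ P.η * P.εh * (P.θ ^ j * ‖d‖) ^ 2 := by positivity
    linarith
  refine ⟨_, hj, hle, fun hst => hok.le.trans ?_⟩
  suffices h : Δ ≤ P.η * P.εh * (P.θ ^ j * ‖d‖) ^ 2 by linarith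
  have hlong : P.θ * P.εg ^ (1 / 2 : ℝ) ≤ P.θ ^ j * ‖d‖ →
      Δ ≤ P.η * P.εh * (P.θ ^ j * ‖d‖) ^ 2 := fun h =>
    calc Δ ≤ cSOL P LH * (P.εg * P.εh) := hΔ.sol_mul
      _ ≤ P.η * P.θ ^ 2 * (P.εg * P.εh) := by gcongr; exact cSOL_le_sq P LH
      _ = P.η * P.εh * (P.θ * P.εg ^ (1 / 2 : ℝ)) ^ 2 := by rw [mul_pow, P.sq_rpow_half]; ring
      _ ≤ _ := by gcongr
  rcases hj2 with rfl | h | h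
  · rcases le_or_gt (P.εg ^ (1 / 2 : ℝ)) ‖d‖ with hD | hD
    · refine hlong ?_
      rw [pow_zero, one_mul]
      exact (mul_le_of_le_one_left hr.le hθ1.le).trans hD
    · rw [pow_zero, one_smul] at hle hst
      rw [pow_zero, one_mul]
      -- A short full step: the Newton residual and the removed shift give `B = ζ + 4 τhat` in the
      -- quadratic bound, while the next Newton test makes the left side exceed `ε_g`.
      have h1 := norm_redGrad_add_le hS hx hD (hle.trans hx) rfl
      have h2 : ‖redHess P f x d + redGrad P f lam x‖ ≤
          P.ζ / 2 * P.εh * ‖d‖ + 2 * P.τhat * P.εh * ‖d‖ := by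
        have e1 : redHess P f x d + redGrad P f lam x =
            redHess P f x d + μ • d + redGrad P f lam x - μ • d := by abel
        rw [e1]
        refine (norm_sub_le _ _).trans (add_le_add hres ?_)
        rw [norm_smul, Real.norm_of_nonneg (by linarith)]
        gcongr
      have h3 : P.εg < ‖redGrad P f lam (x + extend (largeSet P.εg x) d)‖ := hst.2.2
      have hB : 0 < P.ζ + 4 * P.τhat := by have := P.τhat_ge; linarith
      have h4 := le_of_lt_quadratic hB hLH hεg hεh hD0.le (by linarith)
      set q := 4 / (√((P.ζ + 4 * P.τhat) ^ 2 + 8 * LH) + (P.ζ + 4 * P.τhat)) with hq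
      have hq0 : 0 ≤ q := by positivity
      have hcs : cSOL P LH ≤ P.η * q ^ 2 := cSOL_le_root P LH
      rcases min_cases (P.εg / P.εh) P.εh with ⟨h', -⟩ | ⟨h', -⟩
      · rw [h'] at h4
        calc Δ ≤ cSOL P LH * (P.εg ^ 2 / P.εh) := hΔ.sol_div
          _ ≤ P.η * q ^ 2 * (P.εg ^ 2 / P.εh) := by gcongr
          _ = P.η * P.εh * (q * (P.εg / P.εh)) ^ 2 := by field_simp
          _ ≤ _ := by gcongr
      · rw [h'] at h4
        calc Δ ≤ cSOL P LH * P.εh ^ 3 := hΔ.sol_cube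
          _ ≤ P.η * q ^ 2 * P.εh ^ 3 := by gcongr
          _ = P.η * P.εh * (q * P.εh) ^ 2 := by ring
          _ ≤ _ := by gcongr
  · exact hlong h
  · have h2 : P.θ * (3 * (1 - P.ζ - 2 * P.η) / LH) * P.εh ≤ P.θ ^ j * ‖d‖ := by
      have h4 : P.θ * (3 * (1 - P.ζ - 2 * P.η)) * P.εh ≤ P.θ ^ j * ‖d‖ * LH := by
        have : 0 < ‖d‖ ^ 2 := by positivity
        refine le_of_mul_le_mul_right ?_ this
        linarith
      have e2 : P.θ * (3 * (1 - P.ζ - 2 * P.η) / LH) * P.εh =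
        P.θ * (3 * (1 - P.ζ - 2 * P.η)) * P.εh / LH := by ring
      rw [e2, div_le_iff₀ hLH]; exact h4
    calc Δ ≤ cSOL P LH * P.εh ^ 3 := hΔ.sol_cube
      _ ≤ P.η * (9 * (1 - P.ζ - 2 * P.η) ^ 2 * P.θ ^ 2 / LH ^ 2) * P.εh ^ 3 := by
        gcongr; exact cSOL_le_curv P LH
      _ = P.η * P.εh * (P.θ * (3 * (1 - P.ζ - 2 * P.η) / LH) * P.εh) ^ 2 := by ring
      _ ≤ _ := by gcongr

/-- On a small coordinate the scaling turns the move into a multiple of `x_i` of factor at most `1`,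
since `ε_g ≤ 1`. This is why `S` allows steps of length `ε_g^{1/2}` however close `x_i` is to zero.
-/
lemma keep_sign_scaling {P : Params} {x w : Vec n} {a : ℝ} (ha : 0 < a)
    (haw : a * ‖w‖ < P.εg ^ (1 / 2 : ℝ)) (i : Fin n) : a * |scaling P.εg x w i| ≤ |x i| := by
  have h1 : a * |w i| < P.εg ^ (1 / 2 : ℝ) :=
    (mul_le_mul_of_nonneg_left (abs_apply_le_norm w i) ha.le).trans_lt haw
  rw [scaling, diag_apply]
  split_ifs with h
  · rw [one_mul]; exact (h1.trans h).le
  · have h2 : P.εg ^ (1 / 2 : ℝ) ≤ 1 :=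
      Real.rpow_le_one P.εg_mem.1.le P.εg_mem.2.le (by norm_num)
    rw [abs_mul, mul_left_comm]
    exact mul_le_of_le_one_right (abs_nonneg _) (h1.le.trans h2)

lemma norm_scaling_le {P : Params} (x w : Vec n) : ‖scaling P.εg x w‖ ≤ ‖w‖ := by
  refine norm_diag_le (fun i => ?_) w
  split_ifs with h
  · simp
  · exact (not_lt.1 h).trans (Real.rpow_le_one P.εg_mem.1.le P.εg_mem.2.le (by norm_num))

/-- The decrease in a negative curvature step of the second phase. -/
lemma exists_decrease_oracle {P : Params} (hf : Continuous f)
    (hA : ProblemAssumption f lam x0) {Lg LH Δ : ℝ} (hS : SmoothnessConstants f lam x0 Lg LH)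
    (hΔ : IsDecrease P Lg LH Δ) {x : Vec n} (hx : x ∈ levelSet f lam x0)
    {u : EuclideanSpace ℝ (supp x)} (hu : ‖u‖ = 1)
    (hcurv : ⟪u, scaledHessian f P.εg x u⟫ ≤ -P.εh / 2) {s : State n}
    (hs : LineSearch
      (fun j => x + P.θ ^ j • scaling P.εg x (curvDir P f lam x u))
      (fun j => objective f lam (x + P.θ ^ j • scaling P.εg x (curvDir P f lam x u)) <
        objective f lam x - P.η * P.θ ^ (2 * j) * ‖curvDir P f lam x u‖ ^ 3) s) :
    ∃ x', s = .running x' ∧ objective f lam x' ≤ objective f lam x - Δ := by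
  have hLH := hS.LH_pos
  have hεh := P.εh_mem.1
  have hεg := P.εg_mem.1
  have hη := P.η_pos
  have hη2 := P.two_η_lt
  obtain ⟨hθ, hθ1⟩ := P.θ_mem
  have hr : 0 < P.εg ^ (1 / 2 : ℝ) := Real.rpow_pos_of_pos hεg _
  set κ := |⟪u, scaledHessian f P.εg x u⟫| with hκ
  have hneg : ⟪u, scaledHessian f P.εg x u⟫ < 0 := by linarith
  have hκu : ⟪u, scaledHessian f P.εg x u⟫ = -κ := by rw [hκ, abs_of_neg hneg, neg_neg]
  have hκε : P.εh / 2 ≤ κ := by linarith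
  have hκ0 : 0 < κ := by linarith
  set g := ⟪restrict (supp x) (gVec f lam x), principal (supp x) (scaling P.εg x) u⟫ with hg
  have hdir : curvDir P f lam x u = (-(sgn g * κ)) • extend (supp x) u := by
    rw [curvDir, ← hg, ← hκ, map_neg, map_smul, neg_smul]
  have hnorm : ‖curvDir P f lam x u‖ = κ := by
    rw [hdir, norm_smul, norm_extend, hu, norm_neg, norm_mul, Real.norm_eq_abs, abs_sgn,
      Real.norm_of_nonneg hκ0.le]; ring
  set e := scaling P.εg x (curvDir P f lam x u) with he
  have hes : e = (-(sgn g * κ)) • scaling P.εg x (extend (supp x) u) := by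
    rw [he, hdir, map_smul]
  have hslope : dirSlope f lam x e ≤ 0 := by
    rw [hes, dirSlope_smul, ← inner_gVec, ← hg]
    have : -(sgn g * κ) * g = -(κ * |g|) := by rw [← sgn_mul_self]; ring
    rw [this]
    have : 0 ≤ κ * |g| := by positivity
    linarith
  have hcurve : ⟪e, hessian f x e⟫ = -κ ^ 3 := by
    rw [hes, map_smul, inner_smul_left, inner_smul_right, ← inner_scaledHessian, hκu, conj_trivial]
    have : -(sgn g * κ) * (-(sgn g * κ) * -κ) = -(sgn g ^ 2 * κ ^ 3) := by ring
    rw [this, sgn_sq, one_mul]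
  have hκ3 : 0 < κ ^ 3 := by positivity
  obtain ⟨j, hj, hok, hj2⟩ := hs.exists_step_of_keep_sign hf hA hS hx hθ hθ1
    (m := P.η * κ ^ 3) (c := 1 / 2 * κ ^ 3) (r := P.εg ^ (1 / 2 : ℝ)) (D := κ)
    (by positivity) (by nlinarith) hr hκ0 ((norm_scaling_le x _).trans_eq hnorm)
    (fun a ha had => keep_sign_scaling ha (by rwa [hnorm]))
    (fun a ha => by rw [hcurve]; nlinarith [ha.1])
    (fun j hj => by
      rw [hnorm, pow_mul']
      refine hj.trans_eq ?_
      ring)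
  refine ⟨_, hj, hok.le.trans ?_⟩
  rw [hnorm, pow_mul']
  suffices h : Δ ≤ P.η * (P.θ ^ j) ^ 2 * κ ^ 3 by linarith
  have hcn := cNC_nonneg P LH
  -- The oracle guarantees only half of `ε_h`; cubing this gives the `8` in `c_nc/8`.
  have hcube : P.εh ^ 3 / 8 ≤ κ ^ 3 := by
    have : P.εh ^ 3 / 8 = (P.εh / 2) ^ 3 := by ring
    rw [this]; gcongr
  rcases hj2 with rfl | h | h
  · calc Δ ≤ cNC P LH / 8 * P.εh ^ 3 := hΔ.nc_cube
      _ = cNC P LH * (P.εh ^ 3 / 8) := by ring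
      _ ≤ P.η * (P.εh ^ 3 / 8) := by
        gcongr
        exact (cNC_le_left P LH).trans (mul_le_of_le_one_right hη.le P.θ_sq_le)
      _ ≤ P.η * κ ^ 3 := by gcongr
      _ = _ := by ring
  · calc Δ ≤ cNC P LH / 8 * (P.εg * P.εh) := hΔ.nc_mul
      _ ≤ cNC P LH * (P.εg * (P.εh / 2)) := by
        have : 0 ≤ cNC P LH * (P.εg * P.εh) := by positivity
        linarith
      _ ≤ P.η * P.θ ^ 2 * (P.εg * κ) := by gcongr; exact cNC_le_left P LH
      _ = P.η * (P.θ * P.εg ^ (1 / 2 : ℝ)) ^ 2 * κ := by rw [mul_pow, P.sq_rpow_half]; ring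
      _ ≤ P.η * (P.θ ^ j * κ) ^ 2 * κ := by gcongr
      _ = _ := by ring
  · have h5 : P.θ * (3 * (1 - 2 * P.η) / LH) ≤ P.θ ^ j := by
      rw [mul_div_assoc', div_le_iff₀ hLH]
      refine le_of_mul_le_mul_right ?_ hκ3
      linarith
    calc Δ ≤ cNC P LH / 8 * P.εh ^ 3 := hΔ.nc_cube
      _ = cNC P LH * (P.εh ^ 3 / 8) := by ring
      _ ≤ P.η * P.θ ^ 2 * (9 * (1 - 2 * P.η) ^ 2 / LH ^ 2) * κ ^ 3 := by
        gcongr; exact cNC_le_right P LH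
      _ = P.η * (P.θ * (3 * (1 - 2 * P.η) / LH)) ^ 2 * κ ^ 3 := by ring
      _ ≤ _ := by gcongr

/-- What happens in an iteration. -/
lemma Step.running_cases {P : Params} (hf : Continuous f) (hlam : 0 < lam)
    (hA : ProblemAssumption f lam x0) {Lg LH Δ : ℝ} (hS : SmoothnessConstants f lam x0 Lg LH)
    (hΔ0 : 0 ≤ Δ) (hΔ : IsDecrease P Lg LH Δ) {x : Vec n} (hx : x ∈ levelSet f lam x0)
    {s : State n} (h : Step P f lam (.running x) s) :
    (s = .stopped x ∧ OracleStage P f lam x) ∨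
      ∃ x', s = .running x' ∧ objective f lam x' ≤ objective f lam x ∧
        (¬ NewtonStage P f lam x ∨ NewtonStage P f lam x' →
          objective f lam x' ≤ objective f lam x - Δ) := by
  have hgood : (∃ x', s = .running x' ∧ objective f lam x' ≤ objective f lam x - Δ) →
      ∃ x', s = .running x' ∧ objective f lam x' ≤ objective f lam x ∧
        (¬ NewtonStage P f lam x ∨ NewtonStage P f lam x' →
          objective f lam x' ≤ objective f lam x - Δ) := by
    rintro ⟨x', hs, hle⟩
    exact ⟨x', hs, by linarith, fun _ => hle⟩
  have hεh := P.εh_mem.1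
  have hHs := isSymmetric_principal (largeSet P.εg x) (hA.isSymmetric_hessian hx)
  cases h with
  | prox_step _ _ hst hs =>
    right
    obtain ⟨x', h1, h2⟩ := hst.exists_decrease hf hlam hA hS hx hs
    exact hgood ⟨x', h1, h2.trans (by linarith [hΔ.pg])⟩
  | newton_step _ _ hst τ hτ M hM d c hd D hD hs =>
    right
    have hG : 0 < ‖redGrad P f lam x‖ := P.εg_mem.1.trans hst.2.2
    obtain ⟨hμ1, hμ2⟩ := shift_mem hG hτ
    subst hD
    cases c with
    | nc =>
      have hsc := hd.smallCurvature
      rw [SmallCurvature, inner_shifted] at hsc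
      -- Curvature below `ε_h` after a shift by at least `2ε_h` means curvature below `-ε_h` before
      -- it.
      have hlt : ⟪d, redHess P f x d⟫ < -(P.εh * ‖d‖ ^ 2) := by
        nlinarith [sq_nonneg ‖d‖]
      obtain ⟨h1, h2, h3⟩ := newtonDir_nc (g := redGrad P f lam x) hεh hlt
      exact hgood (exists_decrease_newton_nc hf hA hS hΔ hx h1 h2 h3 hs)
    | sol =>
      obtain ⟨h1, h2, h3⟩ := hd.sol_properties (norm_pos_iff.1 hG) hεh hμ1 P.ζ_mem.1.le
        P.ζ_mem.2.le hM
      obtain ⟨x', h4, h5, h6⟩ := exists_decrease_newton_sol hf hA hS hΔ hx hμ1 hμ2 h1 h2 h3 hs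
      exact ⟨x', h4, h5, fun h => h6 (h.resolve_left (not_not.2 hst))⟩
  | newton_fail _ hst τ hτ M hM hd =>
    have hG : 0 < ‖redGrad P f lam x‖ := P.εg_mem.1.trans hst.2.2
    obtain ⟨hμ1, hμ2⟩ := shift_mem hG hτ
    obtain ⟨d, c, h⟩ := exists_cappedCGReturns hHs (norm_pos_iff.1 hG) hεh
      (by linarith : P.εh ≤ τ * ‖redGrad P f lam x‖ ^ P.δ) P.ζ_mem.1.le hM
    exact absurd h (hd d c)
  | certificate _ hst => exact Or.inl ⟨rfl, hst⟩
  | curvature_step _ _ hst u hu hcurv hs =>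
    right
    exact hgood (exists_decrease_oracle hf hA hS hΔ hx hu hcurv hs)

/-- A point at which the oracle is called is a weak first-order point. -/
lemma OracleStage.weakFirstOrder {P : Params} {x : Vec n} (h : OracleStage P f lam x) :
    WeakFirstOrder f lam P.εg x := by
  have hε := P.εg_mem.1
  obtain ⟨h1, h2⟩ := h
  have hsmall : ∀ i ∈ smallSet P.εg x, gEps f lam P.εg x i ^ 2 = 0 := by
    intro i hi
    have h0 : ‖restrict (smallSet P.εg x) (gEps f lam P.εg x)‖ = 0 := by
      by_contra hne
      exact h1 ⟨⟨i, hi⟩, hne⟩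
    have hz := abs_apply_le_norm (restrict (smallSet P.εg x) (gEps f lam P.εg x)) ⟨i, hi⟩
    rw [h0, restrict_apply] at hz
    have := abs_nonpos_iff.1 hz
    rw [this]; norm_num
  have hlarge : ‖restrict (largeSet P.εg x) (gEps f lam P.εg x)‖ ≤ P.εg := by
    by_contra hne
    rw [not_le] at hne
    refine h2 ⟨h1, ?_, hne⟩
    by_contra hemp
    rw [Finset.not_nonempty_iff_eq_empty] at hemp
    have h0 := norm_sq_restrict (largeSet P.εg x) (gEps f lam P.εg x)
    have h3 : ∑ i ∈ largeSet P.εg x, gEps f lam P.εg x i ^ 2 = 0 :=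
      Finset.sum_eq_zero fun i hi => absurd hi (by rw [hemp]; simp)
    rw [h3] at h0
    have := pow_eq_zero_iff two_ne_zero |>.1 h0
    linarith
  have hsq : ‖gEps f lam P.εg x‖ ^ 2 =
      ‖restrict (largeSet P.εg x) (gEps f lam P.εg x)‖ ^ 2 := by
    rw [norm_sq_restrict, EuclideanSpace.norm_sq_eq]
    simp only [Real.norm_eq_abs, sq_abs]
    symm
    refine Finset.sum_subset (Finset.subset_univ _) fun i _ hi => hsmall i ?_
    rw [mem_smallSet]
    exact not_lt.1 (mt mem_largeSet.2 hi)
  have := (sq_eq_sq₀ (norm_nonneg _) (norm_nonneg _)).1 hsq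
  rw [WeakFirstOrder, this]
  exact hlarge

end Steps

/-! ### The iteration complexity -/

section Complexity

variable {n : ℕ} {f : Vec n → ℝ} {lam : ℝ} {x0 : Vec n}

lemma cMin_pos (P : Params) (Lg : ℝ) {LH : ℝ} (hLH : 0 < LH) : 0 < cMin P Lg LH := by
  have hη := P.η_pos
  have h1 := P.one_sub_pos
  have h2 := P.two_η_lt
  have hθ := P.θ_mem.1
  have hζ := P.ζ_mem.1
  have hζ1 : 0 < 1 - P.ζ := sub_pos.2 P.ζ_mem.2
  have hτ : 0 < P.τhat := lt_of_lt_of_le one_pos P.τhat_ge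
  have hηb := P.ηbar_mem.1
  have hmax : 0 < max (LH / 3) (2 * P.η) := lt_max_of_lt_left (by positivity)
  refine lt_min (lt_min ?_ ?_) ?_
  · unfold cNC
    have : 0 < min 1 (9 * (1 - 2 * P.η) ^ 2 / LH ^ 2) := lt_min one_pos (by positivity)
    positivity
  · exact div_pos hηb (lt_max_of_lt_right one_pos)
  · exact mul_pos hη (lt_min (lt_min (by positivity) (by positivity))
      (lt_min (by positivity) (by positivity)))

lemma soRate_pos (P : Params) : 0 < soRate P.εg P.εh :=
  lt_max_of_lt_right (lt_max_of_lt_right (Real.rpow_pos_of_pos P.εg_mem.1 _))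

/-- Each power of `ε_g` and `ε_h` in `IsDecrease` is the reciprocal of one entry of the maximum
`soRate`. -/
lemma isDecrease_cMin_div (P : Params) {Lg LH : ℝ} (hLH : 0 < LH) :
    IsDecrease P Lg LH (cMin P Lg LH / soRate P.εg P.εh) := by
  have hc := cMin_pos P Lg hLH
  have hR := soRate_pos P
  have hεg := P.εg_mem.1
  have hεh := P.εh_mem.1
  have key : ∀ c v : ℝ, cMin P Lg LH ≤ c → 0 < v → v⁻¹ ≤ soRate P.εg P.εh →
      cMin P Lg LH / soRate P.εg P.εh ≤ c * v := by
    intro c v h1 hv h2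
    rw [div_le_iff₀ hR]
    have h3 : 1 ≤ v * soRate P.εg P.εh := by
      rwa [inv_le_iff_one_le_mul₀' hv] at h2
    calc cMin P Lg LH ≤ c := h1
      _ ≤ c * (v * soRate P.εg P.εh) := le_mul_of_one_le_right (hc.le.trans h1) h3
      _ = _ := by ring
  have h1 : cMin P Lg LH ≤ cNC P LH / 8 := (min_le_left _ _).trans (min_le_left _ _)
  have h2 : cMin P Lg LH ≤ cPG P Lg := (min_le_left _ _).trans (min_le_right _ _)
  have h3 : cMin P Lg LH ≤ cSOL P LH := min_le_right _ _
  have r1 : (P.εg * P.εh)⁻¹ ≤ soRate P.εg P.εh := by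
    rw [mul_inv]; exact (le_max_left _ _).trans (le_max_left _ _)
  have r2 : (P.εh ^ 3)⁻¹ ≤ soRate P.εg P.εh := (le_max_right _ _).trans (le_max_left _ _)
  have r3 : (P.εg ^ 2 / P.εh)⁻¹ ≤ soRate P.εg P.εh := by
    rw [inv_div, div_eq_inv_mul]
    exact (le_max_left _ _).trans (le_max_right _ _)
  have r4 : (P.εg ^ (3 / 2 : ℝ))⁻¹ ≤ soRate P.εg P.εh := by
    rw [← Real.rpow_neg hεg.le]
    exact (le_max_right _ _).trans (le_max_right _ _)
  exact ⟨key _ _ h2 (Real.rpow_pos_of_pos hεg _) r4, key _ _ h1 (by positivity) r2,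
    key _ _ h1 (by positivity) r1, key _ _ h3 (by positivity) r2, key _ _ h3 (by positivity) r1,
    key _ _ h3 (by positivity) r3⟩

/-- For `ε_h = ε_g^{1/2}` all rates agree. -/
lemma soRate_eq (P : Params) (h : P.εh = P.εg ^ (1 / 2 : ℝ)) :
    soRate P.εg P.εh = P.εg ^ (-(3 / 2) : ℝ) := by
  have hεg := P.εg_mem.1
  have h1 : P.εg⁻¹ * P.εh⁻¹ = P.εg ^ (-(3 / 2) : ℝ) := by
    rw [h, ← Real.rpow_neg hεg.le, ← Real.rpow_neg_one, ← Real.rpow_add hεg]; norm_num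
  have h2 : (P.εh ^ 3)⁻¹ = P.εg ^ (-(3 / 2) : ℝ) := by
    rw [h, ← Real.rpow_natCast, ← Real.rpow_mul hεg.le, ← Real.rpow_neg hεg.le]; norm_num
  have h3 : (P.εg ^ 2)⁻¹ * P.εh = P.εg ^ (-(3 / 2) : ℝ) := by
    rw [h, ← Real.rpow_natCast, ← Real.rpow_neg hεg.le, ← Real.rpow_add hεg]; norm_num
  rw [soRate, h1, h2, h3]
  simp

/-- A run that starts at `x⁰` never fails, decreases the objective by `Δ` in any two successive
iterations, and stops only at points at which the oracle has been called. -/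
lemma run_invariant {P : Params} (hf : Continuous f) (hlam : 0 < lam)
    (hA : ProblemAssumption f lam x0) {Lg LH Δ : ℝ} (hS : SmoothnessConstants f lam x0 Lg LH)
    (hΔ0 : 0 ≤ Δ) (hΔ : IsDecrease P Lg LH Δ) {z : ℕ → State n} (h0 : z 0 = .running x0)
    (hz : ∀ k, Step P f lam (z k) (z (k + 1))) (k : ℕ) :
    (∃ x, z k = .running x ∧ x ∈ levelSet f lam x0 ∧
      objective f lam x ≤ objective f lam x0 - ((k - 1 : ℝ) / 2) * Δ ∧
      (¬ NewtonStage P f lam x ∨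
        objective f lam x ≤ objective f lam x0 - ((k : ℝ) / 2) * Δ)) ∨
    (∃ x, z k = .stopped x ∧ OracleStage P f lam x ∧
      ∃ i < k, z i = .running x ∧ z (i + 1) = .stopped x) := by
  -- The extra `Δ/2` held in the Newton case is credit: a Newton step that leaves this case may earn
  -- nothing and spends the credit, and every other step earns `Δ`.
  induction k with
  | zero =>
    left
    refine ⟨x0, h0, le_refl (objective f lam x0), ?_, Or.inr ?_⟩
    · push_cast; linarith
    · push_cast; linarith
  | succ k ih =>
    rcases ih with ⟨x, hx, hxL, hle, hor⟩ | ⟨x, hx, hst, i, hi, hi1, hi2⟩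
    · have hstep := hz k
      rw [hx] at hstep
      rcases hstep.running_cases hf hlam hA hS hΔ0 hΔ hxL with ⟨hs, hst⟩ | ⟨x', hs, hdec, hgood⟩
      · exact Or.inr ⟨x, hs, hst, k, Nat.lt_succ_self k, hx, hs⟩
      · left
        refine ⟨x', hs, hdec.trans hxL, ?_, ?_⟩
        · push_cast
          by_cases hN : NewtonStage P f lam x
          · have := hor.resolve_left (not_not.2 hN)
            linarith
          · have := hgood (Or.inl hN)
            linarith
        · by_cases hN' : NewtonStage P f lam x'
          · right
            have := hgood (Or.inr hN')
            push_cast; linarith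
          · exact Or.inl hN'
    · right
      have hstep := hz k
      rw [hx] at hstep
      refine ⟨x, ?_, hst, i, hi.trans (Nat.lt_succ_self k), hi1, hi2⟩
      generalize z (k + 1) = s at hstep
      cases hstep
      rfl

/-- Without a wrong certificate, the run stops in time with a weak second-order point. -/
lemma run_stops {P : Params} (hf : Continuous f) (hlam : 0 < lam)
    (hA : ProblemAssumption f lam x0) {Lg LH φlow : ℝ}
    (hS : SmoothnessConstants f lam x0 Lg LH) (hlow : ∀ x, φlow ≤ objective f lam x)
    {z : ℕ → State n} (h0 : z 0 = .running x0)
    (hz : ∀ k, Step P f lam (z k) (z (k + 1))) {K : ℕ}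
    (hK : K = iterBound P Lg LH (objective f lam x0 - φlow) (soRate P.εg P.εh))
    (hcert : ∀ k < K, ¬ ∃ x, z k = .running x ∧ z (k + 1) = .stopped x ∧
      ¬ MinEigenvalueGE (scaledHessian f P.εg x) (-P.εh)) :
    ∃ x, z K = .stopped x ∧ WeakSecondOrder f lam P.εg P.εh x := by
  have hc := cMin_pos P Lg hS.LH_pos
  have hR := soRate_pos P
  have hΔ := div_pos hc hR
  rcases run_invariant hf hlam hA hS hΔ.le (isDecrease_cMin_div P hS.LH_pos) h0 hz K with
    ⟨x, -, -, hle, -⟩ | ⟨x, hx, hst, i, hi, hi1, hi2⟩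
  · exfalso
    set gap := objective f lam x0 - φlow with hgap
    set Δ := cMin P Lg LH / soRate P.εg P.εh with hΔdef
    have hgap0 : 0 ≤ gap := sub_nonneg.2 (hlow x0)
    -- This contradicts `(K - 2) Δ ≥ 5 gap`; the summand `2` in the bound keeps the contradiction
    -- strict when `gap = 0`.
    have h1 : ((K - 1 : ℝ) / 2) * Δ ≤ gap := by have := hlow x; linarith
    have h2 : 5 * gap / cMin P Lg LH * soRate P.εg P.εh ≤ (K : ℝ) - 2 := by
      rw [hK, iterBound]
      push_cast
      have := Nat.le_ceil (5 * gap / cMin P Lg LH * soRate P.εg P.εh)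
      linarith
    have h3 : 5 * gap / cMin P Lg LH * soRate P.εg P.εh * Δ = 5 * gap := by
      rw [hΔdef]; field_simp
    have h4 := mul_le_mul_of_nonneg_right h2 hΔ.le
    rw [h3] at h4
    nlinarith
  · refine ⟨x, hx, hst.weakFirstOrder, ?_⟩
    by_contra hne
    exact hcert i hi ⟨x, hi1, hi2, hne⟩

/-! ### The failure probability -/

variable {Ω : Type*} {P : Params} {Z : ℕ → Ω → State n}

/-- No wrong certificate is issued before iteration `k`. -/
def noWrongCertificate (P : Params) (f : Vec n → ℝ) (Z : ℕ → Ω → State n) (k : ℕ) : Set Ω :=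
  ⋂ i ∈ Finset.range k, (wrongCertificate P f Z i)ᶜ

lemma mem_noWrongCertificate {k : ℕ} {ω : Ω} : ω ∈ noWrongCertificate P f Z k ↔
    ∀ i < k, ω ∉ wrongCertificate P f Z i := by
  simp [noWrongCertificate]

variable [mΩ : MeasurableSpace Ω] {σ : ℝ} {μ : Measure Ω} {ℱ : Filtration ℕ mΩ}

lemma IsRandomRun.measurableSet_noWrongCertificate
    (hZ : IsRandomRun P f lam x0 σ μ ℱ Z) (k : ℕ) :
    MeasurableSet[ℱ k] (noWrongCertificate P f Z k) :=
  Finset.measurableSet_biInter _ fun i hi =>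
    (ℱ.mono (Nat.succ_le_of_lt (Finset.mem_range.1 hi)) _ (hZ.measurable i)).compl

/-- The probability that no wrong certificate is issued in the first `k` iterations. -/
lemma IsRandomRun.le_measure_noWrongCertificate [IsProbabilityMeasure μ] (hσ : σ < 1)
    (hZ : IsRandomRun P f lam x0 σ μ ℱ Z) (k : ℕ) :
    (1 - σ) ^ k ≤ μ.real (noWrongCertificate P f Z k) := by
  induction k with
  | zero => simp [noWrongCertificate]
  | succ k ih =>
    set G := noWrongCertificate P f Z k with hG
    set W := wrongCertificate P f Z k with hW
    have hGm : MeasurableSet[ℱ k] G := hZ.measurableSet_noWrongCertificate k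
    have hGm' : MeasurableSet G := ℱ.le k _ hGm
    have hWm : MeasurableSet W := ℱ.le (k + 1) _ (hZ.measurable k)
    have hsucc : noWrongCertificate P f Z (k + 1) = G \ W := by
      ext ω
      simp only [hG, hW, Set.mem_sdiff, mem_noWrongCertificate, Nat.lt_succ_iff_lt_or_eq]
      constructor
      · exact fun h => ⟨fun i hi => h i (Or.inl hi), h k (Or.inr rfl)⟩
      · rintro ⟨h1, h2⟩ i (hi | rfl)
        · exact h1 i hi
        · exact h2
    have hint : Integrable (W.indicator fun _ => (1 : ℝ)) μ :=
      (integrable_const (1 : ℝ)).indicator hWm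
    -- The past event `G` belongs to `ℱ k`, so the conditional bound `σ` may be integrated over it.
    have h1 : μ.real (G ∩ W) = ∫ ω in G, (μ⟦W | ℱ k⟧) ω ∂μ := by
      rw [setIntegral_condExp (ℱ.le k) hint hGm, setIntegral_indicator hWm, setIntegral_const,
        smul_eq_mul, mul_one]
    have h2 : μ.real (G ∩ W) ≤ σ * μ.real G := by
      rw [h1]
      calc ∫ ω in G, (μ⟦W | ℱ k⟧) ω ∂μ ≤ ∫ _ in G, σ ∂μ :=
            setIntegral_mono_ae integrable_condExp.integrableOn
              (integrable_const σ).integrableOn (hZ.oracle k)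
        _ = σ * μ.real G := by rw [setIntegral_const, smul_eq_mul, mul_comm]
    have h3 : μ.real (G \ W) = μ.real G - μ.real (G ∩ W) := by
      have := measureReal_inter_add_sdiff (μ := μ) (s := G) hWm
      linarith
    rw [hsucc, h3, pow_succ]
    have h4 : 0 ≤ 1 - σ := by linarith
    nlinarith [mul_le_mul_of_nonneg_right ih h4]

/-- The complexity bound in probability. -/
lemma IsRandomRun.le_measure_stopped [IsProbabilityMeasure μ] (hf : Continuous f)
    (hlam : 0 < lam) (hA : ProblemAssumption f lam x0) {Lg LH φlow : ℝ}
    (hS : SmoothnessConstants f lam x0 Lg LH) (hlow : ∀ x, φlow ≤ objective f lam x)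
    (hσ : σ < 1) (hZ : IsRandomRun P f lam x0 σ μ ℱ Z) {K : ℕ}
    (hK : K = iterBound P Lg LH (objective f lam x0 - φlow) (soRate P.εg P.εh)) :
    (1 - σ) ^ K ≤
      μ.real {ω | ∃ x, Z K ω = .stopped x ∧ WeakSecondOrder f lam P.εg P.εh x} := by
  refine (hZ.le_measure_noWrongCertificate hσ K).trans ?_
  -- Monotonicity of the outer measure suffices; the event of stopping need not be measurable.
  refine ENNReal.toReal_mono (measure_ne_top _ _) (measure_mono_ae ?_)
  filter_upwards [hZ.init, hZ.step] with ω h0 hstep hω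
  exact run_stops hf hlam hA hS hlow h0 hstep hK fun k hk => mem_noWrongCertificate.1 hω k hk

end Complexity

end PGN2CM

end

theorem mainTheorem1 {n : ℕ} (f : PGN2CM.Vec n → ℝ) (lam : ℝ) (hlam : 0 < lam)
    (x0 : PGN2CM.Vec n) (hf : Continuous f) (hA : PGN2CM.ProblemAssumption f lam x0)
    (φlow : ℝ) (hlow : IsLeast (Set.range (PGN2CM.objective f lam)) φlow) :
    (∃ Lg LH : ℝ, PGN2CM.SmoothnessConstants f lam x0 Lg LH) ∧
    ∀ Lg LH : ℝ, PGN2CM.SmoothnessConstants f lam x0 Lg LH →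
      ∀ (P : PGN2CM.Params) (σ : ℝ), σ ∈ Set.Ico (0 : ℝ) 1 →
      ∀ {Ω : Type*} [mΩ : MeasurableSpace Ω] (μ : MeasureTheory.Measure Ω)
        [MeasureTheory.IsProbabilityMeasure μ] (ℱ : MeasureTheory.Filtration ℕ mΩ)
        (Z : ℕ → Ω → PGN2CM.State n), PGN2CM.IsRandomRun P f lam x0 σ μ ℱ Z →
      (∀ K : ℕ, K = PGN2CM.iterBound P Lg LH (PGN2CM.objective f lam x0 - φlow)
            (PGN2CM.soRate P.εg P.εh) →
          (1 - σ) ^ K ≤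
            μ.real {ω | ∃ x, Z K ω = .stopped x ∧
              PGN2CM.WeakSecondOrder f lam P.εg P.εh x}) ∧
      (P.εh = P.εg ^ (1 / 2 : ℝ) →
        ∀ K : ℕ, K = PGN2CM.iterBound P Lg LH (PGN2CM.objective f lam x0 - φlow)
            (P.εg ^ (-(3 / 2) : ℝ)) →
          (1 - σ) ^ K ≤
            μ.real {ω | ∃ x, Z K ω = .stopped x ∧
              PGN2CM.WeakSecondOrder f lam P.εg P.εh x}) := by
  refine ⟨hA.exists_smoothnessConstants hf, fun Lg LH hS P σ hσ Ω mΩ μ _ ℱ Z hZ => ?_⟩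
  have hlow' : ∀ x, φlow ≤ PGN2CM.objective f lam x := fun x => hlow.2 ⟨x, rfl⟩
  refine ⟨fun K hK => hZ.le_measure_stopped hf hlam hA hS hlow' hσ.2 hK, fun h K hK => ?_⟩
  rw [← PGN2CM.soRate_eq P h] at hK
  exact hZ.le_measure_stopped hf hlam hA hS hlow' hσ.2 hK
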